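/- **The framework TF.** *Arities* are generated by: if $\alpha_1,\dots,\alpha_n$ ($n\ge 0$) are arities, so is $(\alpha_1,\dots,\alpha_n)$. The order of $()$ is $0$; for $n\geq 1$ the order of $(\alpha_1,\dots,\alpha_n)$ is $1+\max_i \operatorname{order}(\alpha_i)$. Every variable and every constant has an arity. An *object* is $z[F_1,\dots,F_n]$ with $z$ a variable or constant of arity $(\alpha_1,\dots,\alpha_n)$ and $F_i$ an $\alpha_i$-ary *abstraction*; a $(\beta_1,\dots,\beta_r)$-ary abstraction is $[x_1,\dots,x_r]M$ with $x_j$ distinct bound variables of arity $\beta_j$ and $M$ an object. A *base kind* is $\mathbf{Type}$ or $\mathrm{El}(A)$ with $A$ an object. An $(\alpha_1,\dots,\alpha_n)$-ary *context* is $\Delta\equiv x_1:K_1,\dots,x_n:K_n$ with $K_i$ an $\alpha_i$-ary kind, and an $\alpha$-ary *kind* is $(\Delta)T$ with $\Delta$ an $\alpha$-ary context and $T$ a base kind; $x_i$ is bound in $K_{i+1},\dots,K_n$ and $T$. Expressions are taken up to $\alpha$-conversion. The order of a context or kind is that of its arity. *Instantiation* $\{F/x\}$ commutes with symbols $z\not\equiv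 x$, and $\{F/x\}\,x[G_1,\dots,G_n]\equiv\{G_1'/t_1\}\cdots\{G_n'/t_n\}P$ where $F\equiv[t_1,\dots,t_n]P$ and $G_i'\equiv\{F/x\}G_i$; $\{\vec F/\Delta\}$ instantiates $F_i$ for $x_i$, for all $i$. The judgements are $\Gamma\ \mathrm{valid}$, $\Gamma\vdash M:T$ and $\Gamma\vdash M=N:T$ ($T$ a base kind). Write $\Gamma\Vdash(\Delta)\mathbf{Type}\ \mathrm{kind}$ for $\Gamma,\Delta\ \mathrm{valid}$; $\Gamma\Vdash(\Delta)\mathrm{El}(A)\ \mathrm{kind}$ for $\Gamma,\Delta\vdash A:\mathbf{Type}$; $\Gamma\Vdash[\vec x]M:(\Delta)T$ for $\Gamma,\Delta\vdash M:T$; $\Gamma\Vdash[\vec x]M=[\vec x]N:(\Delta)T$ for $\Gamma,\Delta\vdash M=N:T$ (with $\vec x$ the variables of $\Delta$); $\Gamma\Vdash\vec F::\Delta$ for $\Gamma\ \mathrm{valid}$ together with $\Gamma\Vdash F_i:\{F_1/x_1,\dots,F_{i-1}/x_{i-1}\}K_i$ for all $i$; and $\Gamma\Vdash\vec F=\vec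 G::\Delta$ for $\Gamma\ \mathrm{valid}$ together with $\Gamma\Vdash F_i=G_i:\{F_1/x_1,\dots,F_{i-1}/x_{i-1}\}K_i$ for all $i$. A *specification* is a set of declarations $c:K$ ($c$ a constant, $K$ a kind of the same arity without free variables) and $(\Delta)(M=N:T)$ ($\Delta$ a context, $M$, $N$, $T$ objects and a base kind over $\Delta$), in which no constant is declared twice. The order of $c:K$ is the order of $K$, that of $(\Delta)(M=N:T)$ is the order of $\Delta$. The rules of deduction under a specification are: the empty context is valid; from $\Gamma\Vdash K\ \mathrm{kind}$ infer $\Gamma,x:K\ \mathrm{valid}$ ($x$ new); for $z:(\Delta)T$ in $\Gamma$ or in the specification, from $\Gamma\Vdash\vec F::\Delta$ infer $\Gamma\vdash z\vec F:\{\vec F/\Delta\}T$, and from $\Gamma\Vdash\vec F=\vec G::\Delta$ infer $\Gamma\vdash z\vec F=z\vec G:\{\vec F/\Delta\}T$; for $(\Delta)(M=N:T)$ in the specification, from $\Gamma\Vdash\vec F::\Delta$ infer $\Gamma\vdash\{\vec F/\Delta\}M=\{\vec F/\Delta\}N:\{\vec F/\Delta\}T$; reflexivity (from $\Gamma\vdash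 M:T$), symmetry and transitivity of equality; and from $\Gamma\vdash A=B:\mathbf{Type}$ together with $\Gamma\vdash M:\mathrm{El}(A)$ (resp. $\Gamma\vdash M=N:\mathrm{El}(A)$) infer $\Gamma\vdash M:\mathrm{El}(B)$ (resp. $\Gamma\vdash M=N:\mathrm{El}(B)$). A specification $\mathcal S$ is *orderable* if its declarations have a well-ordering $\prec$ such that, under the specification consisting of the declarations $\prec\delta$: if $\delta$ is $c:K$, then $\Vdash K\ \mathrm{kind}$ is derivable; if $\delta$ is $(\Delta)(M=N:T)$, then $\Delta\vdash M:T$, $\Delta\vdash N:T$ and $\Delta\Vdash T\ \mathrm{kind}$ are derivable. It is *$n$-good* if, whenever $\Gamma$ has order $\le n$ and $\Gamma\vdash M=N:T$ is derivable under $\mathcal S$, so are $\Gamma\vdash M:T$ and $\Gamma\vdash N:T$. **The framework $\mathrm{TF}_{\mathrm k}$** is the same except that an $\alpha$-ary abstraction is $[\Delta]M$ with $\Delta$ an $\alpha$-ary context (so objects, abstractions, contexts and kinds are defined simultaneously, and instantiation also acts on the labels $\Delta$). $\Gamma\Vdash[\Delta_1]M:(\Delta)T$ now means $\Gamma\Vdash\Delta=\Delta_1$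 together with $\Gamma,\Delta\vdash M:T$, and $\Gamma\Vdash[\Delta_1]M=[\Delta_2]N:(\Delta)T$ means $\Gamma\Vdash\Delta=\Delta_1$, $\Gamma\Vdash\Delta=\Delta_2$ and $\Gamma,\Delta\vdash M=N:T$. Here $\Gamma\Vdash\langle\rangle=\langle\rangle$ is $\Gamma\ \mathrm{valid}$; $\Gamma\Vdash(\Delta,x:K)=(\Delta',x:K')$ is $\Gamma\Vdash\Delta=\Delta'$ with $\Gamma,\Delta\Vdash K=K'$; $\Gamma\Vdash(\Delta)T=(\Delta')T'$ is $\Gamma\Vdash\Delta=\Delta'$ with $\Gamma,\Delta\Vdash T=T'$; $\Gamma\Vdash\mathbf{Type}=\mathbf{Type}$ is $\Gamma\ \mathrm{valid}$; $\Gamma\Vdash\mathrm{El}(A)=\mathrm{El}(B)$ is $\Gamma\vdash A=B:\mathbf{Type}$; and $\mathbf{Type}$ is never equal to $\mathrm{El}(A)$. **The translation $\mathcal L$** (relative to $\mathcal S$) is the least partial function such that $\mathcal L_\Gamma(z[F_1,\dots,F_m])\equiv z[F_1',\dots,F_m']$, where $z:(x_1:K_1,\dots,x_m:K_m)T$ is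 declared in $\Gamma$ or in $\mathcal S$ and $F_i'\equiv\mathcal L_\Gamma^{\{F_1/x_1,\dots,F_{i-1}/x_{i-1}\}K_i}(F_i)$; $\mathcal L_\Gamma^{(\Delta)T}([\vec x]M)\equiv[\mathcal L_\Gamma(\Delta)]\,\mathcal L_{\Gamma,\Delta}(M)$ with $\vec x$ the variables of $\Delta$; $\mathcal L_\Gamma(\mathbf{Type})\equiv\mathbf{Type}$, $\mathcal L_\Gamma(\mathrm{El}(A))\equiv\mathrm{El}(\mathcal L_\Gamma(A))$, $\mathcal L_\Gamma((\Delta)T)\equiv(\mathcal L_\Gamma(\Delta))\mathcal L_{\Gamma,\Delta}(T)$; $\mathcal L_\Gamma(\langle\rangle)\equiv\langle\rangle$, $\mathcal L_\Gamma(\Delta,x:K)\equiv\mathcal L_\Gamma(\Delta),\,x:\mathcal L_{\Gamma,\Delta}(K)$. For a judgement $J$ with context $\Gamma$, $\mathcal L(J)$ is obtained by applying $\mathcal L_{\langle\rangle}$ to $\Gamma$ and $\mathcal L_\Gamma$ to the objects and the base kind. $\mathcal L(\mathcal S)$ consists of the $c:\mathcal L_{\langle\rangle}(K)$ for $c:K$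 in $\mathcal S$ and the $(\mathcal L_{\langle\rangle}(\Delta))(\mathcal L_\Delta(M)=\mathcal L_\Delta(N):\mathcal L_\Delta(T))$ for $(\Delta)(M=N:T)$ in $\mathcal S$. **Theorem.** Let $n$ be a natural number and $\mathcal S$ an orderable $n$-good specification in TF in which every declaration has order $\le n$. Then $\mathcal L$ is defined on every declaration of $\mathcal S$, and for every judgement $J$ with context of order $\le n$ that is derivable in TF under $\mathcal S$, $\mathcal L(J)$ is defined and is derivable in $\mathrm{TF}_{\mathrm k}$ under $\mathcal L(\mathcal S)$. -/

import Mathlib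

universe u

namespace TF

/-! ## Arities and variables -/

/-- Arities: if `α₁, …, αₙ` are arities then `(α₁, …, αₙ)` is an arity.  The list is stored with
the last component `αₙ` at its head, as are all scopes and contexts below. -/
inductive Arity : Type
  | mk : List Arity → Arity

def Arity.args : Arity → List Arity
  | .mk l => l

mutual
/-- `()` has order `0`; otherwise the order is one more than the highest order of a component. -/
def Arity.order : Arity → ℕ
  | .mk l => orderList l
def orderList : List Arity → ℕ
  | [] => 0
  | α :: l => max (α.order + 1) (orderList l)
end

/-- `Var G α`: the `α`-ary variables of a scope `G` (de Bruijn indices, `zero` is the last variable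
of the scope).  Expressions are thereby taken up to `α`-conversion. -/
inductive Var : List Arity → Arity → Type
  | zero {G : List Arity} {α : Arity} : Var (α :: G) α
  | succ {G : List Arity} {α β : Arity} : Var G α → Var (β :: G) α

theorem Var.order_lt_orderList {Δ : List Arity} {β : Arity} (y : Var Δ β) :
    β.order < orderList Δ := by
  induction y with
  | zero => rw [orderList]; omega
  | succ _ ih => rw [orderList]; omega

theorem Var.order_lt {α β : Arity} (y : Var α.args β) : β.order < α.order := by
  cases α with
  | mk l => rw [Arity.order]; exact y.order_lt_orderList

/-- Renamings of variables. -/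
def Ren (G G' : List Arity) : Type := ∀ α, Var G α → Var G' α

def Ren.lift1 {G G' : List Arity} (ρ : Ren G G') (β : Arity) : Ren (β :: G) (β :: G')
  | _, .zero => .zero
  | _, .succ x => .succ (ρ _ x)

/-- A renaming carried under the binding of the variables `Δ`. -/
def Ren.lift {G G' : List Arity} (ρ : Ren G G') : (Δ : List Arity) → Ren (Δ ++ G) (Δ ++ G')
  | [] => ρ
  | β :: Δ => (Ren.lift ρ Δ).lift1 β

def Ren.wk1 {G : List Arity} (β : Arity) : Ren G (β :: G) := fun _ x => .succ x

/-- Weakening by a block of variables `Δ`. -/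
def Ren.wk {G : List Arity} : (Δ : List Arity) → Ren G (Δ ++ G)
  | [] => fun _ x => x
  | _ :: Δ => fun α x => .succ (Ren.wk Δ α x)

/-- From the empty scope to any scope. -/
def Ren.empty (G : List Arity) : Ren [] G := fun _ x => nomatch x

section Curry

variable {C : Type u} (ar : C → Arity)

/-! ## Objects of `TF` -/

/-- Objects `x[F₁, …, Fₙ]` and `c[F₁, …, Fₙ]` in a scope, with `x` a variable and `c` a constant;
`C` is the type of constants and `ar c` is the arity of `c`.  The `β`-ary argument at position `y` is
a `β`-ary abstraction `[x₁, …, xᵣ]M`, that is, an object `M` in the scope extended by the variables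
`β.args`. -/
inductive Obj : List Arity → Type u
  | var {G : List Arity} {α : Arity} (x : Var G α)
      (F : ∀ β, Var α.args β → Obj (β.args ++ G)) : Obj G
  | const {G : List Arity} (c : C)
      (F : ∀ β, Var (ar c).args β → Obj (β.args ++ G)) : Obj G

/-- `α`-ary abstractions. -/
abbrev Abs (G : List Arity) (α : Arity) : Type u := Obj ar (α.args ++ G)

/-- Abstraction sequences whose arity is `(α₁, …, αₙ)`, with `Δ` listing the `αᵢ`. -/
abbrev Args (G Δ : List Arity) : Type u := ∀ β, Var Δ β → Abs ar G β

variable {ar}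

def Obj.ren {G G' : List Arity} (ρ : Ren G G') : Obj ar G → Obj ar G'
  | .var x F => .var (ρ _ x) fun β y => (F β y).ren (ρ.lift β.args)
  | .const c F => .const c fun β y => (F β y).ren (ρ.lift β.args)

/-! ## Instantiation (hereditary substitution) -/

variable (ar)

/-- What is to be done with an `α`-ary variable: replace it by a variable, or instantiate it with
an abstraction.  Only variables of arity of order `< b` are instantiated. -/
inductive Entry (b : ℕ) (G : List Arity) (α : Arity) : Type u
  | var (x : Var G α) : Entry b G α
  | abs (h : α.order < b) (F : Abs ar G α) : Entry b G α

/-- Simultaneous instantiations. -/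
abbrev Sub (b : ℕ) (G G' : List Arity) : Type u := ∀ α, Var G α → Entry ar b G' α

variable {ar}

def Entry.ren {b : ℕ} {G G' : List Arity} {α : Arity} (ρ : Ren G G') :
    Entry ar b G α → Entry ar b G' α
  | .var x => .var (ρ _ x)
  | .abs h F => .abs h (F.ren (ρ.lift α.args))

def Sub.lift1 {b : ℕ} {G G' : List Arity} (σ : Sub ar b G G') (β : Arity) :
    Sub ar b (β :: G) (β :: G')
  | _, .zero => .var .zero
  | _, .succ x => (σ _ x).ren (Ren.wk1 β)

/-- An instantiation carried under the binding of the variables `Δ`. -/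
def Sub.lift {b : ℕ} {G G' : List Arity} (σ : Sub ar b G G') :
    (Δ : List Arity) → Sub ar b (Δ ++ G) (Δ ++ G')
  | [] => σ
  | β :: Δ => Sub.lift1 (Sub.lift σ Δ) β

/-- The instantiation `{F/Δ}` of the sequence `F` for the block of variables `Δ`; the remaining
variables are left alone. -/
def Sub.block {b : ℕ} {G : List Arity} : {Δ : List Arity} → orderList Δ ≤ b → Args ar G Δ →
    Sub ar b (Δ ++ G) G
  | [], _, _ => fun _ x => .var x
  | α :: Δ, h, F => fun _ x => match x with
    | .zero => .abs (lt_of_lt_of_le (Var.zero (G := Δ)).order_lt_orderList h) (F α .zero)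
    | .succ x => Sub.block (le_trans (by rw [orderList]; exact le_max_right _ _) h)
        (fun β y => F β (.succ y)) _ x

/-- The recursion on objects in the definition of instantiation; `emp` performs `F • G₁ • … • Gₙ`
for the `F` of arity of order `< b`. -/
def Obj.subWith {b : ℕ}
    (emp : ∀ {G : List Arity} {α : Arity}, α.order < b → Abs ar G α → Args ar G α.args → Obj ar G) :
    {G G' : List Arity} → Sub ar b G G' → Obj ar G → Obj ar G'
  | _, _, σ, .const c F =>
      .const c fun β y => Obj.subWith emp (Sub.lift σ β.args) (F β y)
  | _, _, σ, .var x F =>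
      match σ _ x with
      | .var x' => .var x' fun β y => Obj.subWith emp (Sub.lift σ β.args) (F β y)
      | .abs h P => emp h P fun β y => Obj.subWith emp (Sub.lift σ β.args) (F β y)

/-- `([t₁, …, tₙ]P) • G₁ • … • Gₙ = {G₁/t₁} ⋯ {Gₙ/tₙ} P`, by recursion on (a bound for the order of)
the arity. -/
def employ : (b : ℕ) → {G : List Arity} → {α : Arity} → α.order < b → Abs ar G α →
    Args ar G α.args → Obj ar G
  | 0, _, _, h, _, _ => absurd h (Nat.not_lt_zero _)
  | b + 1, _, .mk _, h, P, F =>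
      Obj.subWith (employ b)
        (Sub.block (by rw [Arity.order] at h; exact Nat.lt_succ_iff.mp h) F) P

def Obj.sub {b : ℕ} {G G' : List Arity} (σ : Sub ar b G G') (M : Obj ar G) : Obj ar G' :=
  Obj.subWith (employ b) σ M

/-! ## Kinds and contexts of `TF` -/

variable (ar)

/-- Base kinds: `Type` and `El(A)`. -/
inductive Base (G : List Arity) : Type u
  | type : Base G
  | el (A : Obj ar G) : Base G

mutual
/-- `α`-ary kinds `(Δ)T`, with `Δ` an `α`-ary context and `T` a base kind. -/
inductive Kind : List Arity → Arity → Type u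
  | mk {G : List Arity} {α : Arity} (Δ : Tel G α.args) (T : Base ar (α.args ++ G)) : Kind G α
/-- Contexts `x₁ : K₁, …, xₙ : Kₙ` on top of a scope `G` of variables that are free in them. -/
inductive Tel : List Arity → List Arity → Type u
  | nil {G : List Arity} : Tel G []
  | snoc {G Δ : List Arity} {α : Arity} (Θ : Tel G Δ) (K : Kind (Δ ++ G) α) : Tel G (α :: Δ)
end

/-- Contexts (with no free variables). -/
inductive Ctx : List Arity → Type u
  | nil : Ctx []
  | snoc {G : List Arity} {α : Arity} (Γ : Ctx G) (K : Kind ar G α) : Ctx (α :: G)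

variable {ar}

def Kind.tel {G : List Arity} {α : Arity} : Kind ar G α → Tel ar G α.args
  | .mk Δ _ => Δ

def Kind.base {G : List Arity} {α : Arity} : Kind ar G α → Base ar (α.args ++ G)
  | .mk _ T => T

def Base.ren {G G' : List Arity} (ρ : Ren G G') : Base ar G → Base ar G'
  | .type => .type
  | .el A => .el (A.ren ρ)

mutual
def Kind.ren : {G G' : List Arity} → {α : Arity} → Ren G G' → Kind ar G α → Kind ar G' α
  | _, _, α, ρ, .mk Δ T => .mk (Tel.ren ρ Δ) (T.ren (ρ.lift α.args))
def Tel.ren : {G G' Δ : List Arity} → Ren G G' → Tel ar G Δ → Tel ar G' Δ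
  | _, _, _, _, .nil => .nil
  | _, _, _ :: Δ, ρ, .snoc Θ K => .snoc (Tel.ren ρ Θ) (Kind.ren (ρ.lift Δ) K)
end

def Base.sub {b : ℕ} {G G' : List Arity} (σ : Sub ar b G G') : Base ar G → Base ar G'
  | .type => .type
  | .el A => .el (A.sub σ)

mutual
def Kind.sub {b : ℕ} : {G G' : List Arity} → {α : Arity} → Sub ar b G G' → Kind ar G α →
    Kind ar G' α
  | _, _, α, σ, .mk Δ T => .mk (Tel.sub σ Δ) (T.sub (Sub.lift σ α.args))
def Tel.sub {b : ℕ} : {G G' Δ : List Arity} → Sub ar b G G' → Tel ar G Δ → Tel ar G' Δ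
  | _, _, _, _, .nil => .nil
  | _, _, _ :: Δ, σ, .snoc Θ K => .snoc (Tel.sub σ Θ) (Kind.sub (Sub.lift σ Δ) K)
end

/-- `{F/Δ}M`. -/
def Obj.inst {G Δ : List Arity} (F : Args ar G Δ) (M : Obj ar (Δ ++ G)) : Obj ar G :=
  M.sub (Sub.block le_rfl F)

/-- `{F/Δ}T`. -/
def Base.inst {G Δ : List Arity} (F : Args ar G Δ) (T : Base ar (Δ ++ G)) : Base ar G :=
  T.sub (Sub.block le_rfl F)

/-- `{F/Δ}K`. -/
def Kind.inst {G Δ : List Arity} {α : Arity} (F : Args ar G Δ) (K : Kind ar (Δ ++ G) α) :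
    Kind ar G α :=
  K.sub (Sub.block le_rfl F)

/-- `{F₁/x₁, …, Fᵢ₋₁/xᵢ₋₁}Kᵢ`, the kind which the `i`-th member of a sequence `F` must have in order
that `F` satisfies the context `x₁ : K₁, …, xₙ : Kₙ`. -/
def Tel.argKind {G : List Arity} : {Δ : List Arity} → Tel ar G Δ → Args ar G Δ →
    (β : Arity) → Var Δ β → Kind ar G β
  | _, .snoc _ K, F, _, .zero => K.inst fun β y => F β (.succ y)
  | _, .snoc Θ _, F, _, .succ y => Tel.argKind Θ (fun β y => F β (.succ y)) _ y

/-- `Γ, Δ`. -/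
def Ctx.append {G : List Arity} (Γ : Ctx ar G) : {Δ : List Arity} → Tel ar G Δ → Ctx ar (Δ ++ G)
  | _, .nil => Γ
  | _, .snoc Θ K => .snoc (Ctx.append Γ Θ) K

/-- The kind of a variable in a context. -/
def Ctx.lookup : {G : List Arity} → Ctx ar G → {α : Arity} → Var G α → Kind ar G α
  | _, .snoc _ K, _, .zero => K.ren (Ren.wk1 _)
  | _, .snoc Γ _, _, .succ x => (Ctx.lookup Γ x).ren (Ren.wk1 _)

/-! ## Judgements, specifications, and derivability in `TF` -/

variable (ar)

/-- The primitive judgement forms `Γ valid`, `Γ ⊢ M : T` and `Γ ⊢ M = N : T`. -/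
inductive Jdg : Type u
  | valid {G : List Arity} (Γ : Ctx ar G) : Jdg
  | typ {G : List Arity} (Γ : Ctx ar G) (M : Obj ar G) (T : Base ar G) : Jdg
  | eq {G : List Arity} (Γ : Ctx ar G) (M N : Obj ar G) (T : Base ar G) : Jdg

/-- Declarations: `c : K`, and `(Δ)(M = N : T)`. -/
inductive Decl : Type u
  | const (c : C) (K : Kind ar [] (ar c)) : Decl
  | eqn {Δ : List Arity} (Θ : Tel ar [] Δ) (M N : Obj ar (Δ ++ [])) (T : Base ar (Δ ++ [])) : Decl

variable {ar}

/-- The order of a context, whose variables have the arities listed in `G`. -/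
def Ctx.order {G : List Arity} (_ : Ctx ar G) : ℕ := (Arity.mk G).order

/-- The order of the context of a judgement. -/
def Jdg.ctxOrder : Jdg ar → ℕ
  | .valid Γ => Γ.order
  | .typ Γ _ _ => Γ.order
  | .eq Γ _ _ _ => Γ.order

def Decl.order : Decl ar → ℕ
  | .const c _ => (ar c).order
  | .eqn (Δ := Δ) _ _ _ _ => (Arity.mk Δ).order

/-- `Γ ⊩ T kind` for a base kind `T`. -/
def Ctx.baseKind {G : List Arity} (Γ : Ctx ar G) : Base ar G → Jdg ar
  | .type => .valid Γ
  | .el A => .typ Γ A .type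

/-- `Γ ⊩ (Δ)T kind`. -/
def Ctx.isKind {G : List Arity} {α : Arity} (Γ : Ctx ar G) (K : Kind ar G α) : Jdg ar :=
  (Γ.append K.tel).baseKind K.base

/-- `Γ ⊩ F : K`. -/
def Ctx.absTyp {G : List Arity} {α : Arity} (Γ : Ctx ar G) (F : Abs ar G α) (K : Kind ar G α) :
    Jdg ar :=
  .typ (Γ.append K.tel) F K.base

/-- `Γ ⊩ F = F' : K`. -/
def Ctx.absEq {G : List Arity} {α : Arity} (Γ : Ctx ar G) (F F' : Abs ar G α) (K : Kind ar G α) :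
    Jdg ar :=
  .eq (Γ.append K.tel) F F' K.base

/-- Derivability in `TF` under a type theory specification, that is, a set `S` of declarations.
The premise `Γ ⊩ F :: Δ` consists of `Γ valid` and of `Γ ⊩ Fᵢ : {F₁/x₁, …, Fᵢ₋₁/xᵢ₋₁}Kᵢ` for all
`i`, and similarly for `Γ ⊩ F = F' :: Δ`. -/
inductive Der (S : Set (Decl ar)) : Jdg ar → Prop
  | emp : Der S (.valid .nil)
  | ctxt {G : List Arity} {α : Arity} (Γ : Ctx ar G) (K : Kind ar G α) :
      Der S (Γ.isKind K) → Der S (.valid (Γ.snoc K))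
  | var {G : List Arity} {α : Arity} (Γ : Ctx ar G) (x : Var G α) (F : Args ar G α.args) :
      Der S (.valid Γ) →
      (∀ β y, Der S (Γ.absTyp (F β y) ((Γ.lookup x).tel.argKind F β y))) →
      Der S (.typ Γ (.var x F) ((Γ.lookup x).base.inst F))
  | var_eq {G : List Arity} {α : Arity} (Γ : Ctx ar G) (x : Var G α) (F F' : Args ar G α.args) :
      Der S (.valid Γ) →
      (∀ β y, Der S (Γ.absEq (F β y) (F' β y) ((Γ.lookup x).tel.argKind F β y))) →
      Der S (.eq Γ (.var x F) (.var x F') ((Γ.lookup x).base.inst F))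
  | ref {G : List Arity} {Γ : Ctx ar G} {M : Obj ar G} {T : Base ar G} :
      Der S (.typ Γ M T) → Der S (.eq Γ M M T)
  | sym {G : List Arity} {Γ : Ctx ar G} {M N : Obj ar G} {T : Base ar G} :
      Der S (.eq Γ M N T) → Der S (.eq Γ N M T)
  | trans {G : List Arity} {Γ : Ctx ar G} {M N P : Obj ar G} {T : Base ar G} :
      Der S (.eq Γ M N T) → Der S (.eq Γ N P T) → Der S (.eq Γ M P T)
  | conv {G : List Arity} {Γ : Ctx ar G} {M A B : Obj ar G} :
      Der S (.typ Γ M (.el A)) → Der S (.eq Γ A B .type) → Der S (.typ Γ M (.el B))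
  | conv_eq {G : List Arity} {Γ : Ctx ar G} {M N A B : Obj ar G} :
      Der S (.eq Γ M N (.el A)) → Der S (.eq Γ A B .type) → Der S (.eq Γ M N (.el B))
  | const {G : List Arity} (Γ : Ctx ar G) (c : C) (K : Kind ar [] (ar c))
      (F : Args ar G (ar c).args) : Decl.const c K ∈ S →
      Der S (.valid Γ) →
      (∀ β y, Der S (Γ.absTyp (F β y) ((K.ren (Ren.empty G)).tel.argKind F β y))) →
      Der S (.typ Γ (.const c F) ((K.ren (Ren.empty G)).base.inst F))
  | const_eq {G : List Arity} (Γ : Ctx ar G) (c : C) (K : Kind ar [] (ar c))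
      (F F' : Args ar G (ar c).args) : Decl.const c K ∈ S →
      Der S (.valid Γ) →
      (∀ β y, Der S (Γ.absEq (F β y) (F' β y) ((K.ren (Ren.empty G)).tel.argKind F β y))) →
      Der S (.eq Γ (.const c F) (.const c F') ((K.ren (Ren.empty G)).base.inst F))
  | eqn {G Δ : List Arity} (Γ : Ctx ar G) (Θ : Tel ar [] Δ) (M N : Obj ar (Δ ++ []))
      (T : Base ar (Δ ++ [])) (F : Args ar G Δ) : Decl.eqn Θ M N T ∈ S →
      Der S (.valid Γ) →
      (∀ β y, Der S (Γ.absTyp (F β y) ((Θ.ren (Ren.empty G)).argKind F β y))) →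
      Der S (.eq Γ ((M.ren ((Ren.empty G).lift Δ)).inst F) ((N.ren ((Ren.empty G).lift Δ)).inst F)
        ((T.ren ((Ren.empty G).lift Δ)).inst F))

/-- No constant is declared twice. -/
def UniquelyDeclared (S : Set (Decl ar)) : Prop :=
  ∀ (c : C) (K K' : Kind ar [] (ar c)), Decl.const c K ∈ S → Decl.const c K' ∈ S → K = K'

/-- What is required to be derivable of a declaration, under a specification `S`. -/
def Decl.WellFormed (S : Set (Decl ar)) : Decl ar → Prop
  | .const _ K => Der S (Ctx.nil.isKind K)
  | .eqn Θ M N T => Der S (.typ (Ctx.nil.append Θ) M T) ∧ Der S (.typ (Ctx.nil.append Θ) N T) ∧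
      Der S ((Ctx.nil.append Θ).baseKind T)

/-- Orderable specifications: there is a well-ordering of the declarations such that each of them is
well-formed under the specification that consists of its predecessors. -/
def Orderable (S : Set (Decl ar)) : Prop :=
  ∃ r : S → S → Prop, IsWellOrder S r ∧
    ∀ δ : S, (δ : Decl ar).WellFormed {ε | ∃ h : ε ∈ S, r ⟨ε, h⟩ δ}

/-- `n`-good specifications. -/
def Good (n : ℕ) (S : Set (Decl ar)) : Prop :=
  ∀ (G : List Arity) (Γ : Ctx ar G) (M N : Obj ar G) (T : Base ar G), Γ.order ≤ n →
    Der S (.eq Γ M N T) → Der S (.typ Γ M T) ∧ Der S (.typ Γ N T)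

end Curry

/-! ## The Church-typed framework `TFₖ` -/

section Church

variable {C : Type u} (ar : C → Arity)

mutual
/-- Objects `x[F₁, …, Fₙ]` and `c[F₁, …, Fₙ]`. -/
inductive KObj : List Arity → Type u
  | var {G : List Arity} {α : Arity} (x : Var G α) (F : ∀ β, Var α.args β → KAbs G β) : KObj G
  | const {G : List Arity} (c : C) (F : ∀ β, Var (ar c).args β → KAbs G β) : KObj G
/-- `α`-ary abstractions `[Δ]M`, with `Δ` an `α`-ary context. -/
inductive KAbs : List Arity → Arity → Type u
  | mk {G : List Arity} {α : Arity} (Δ : KTel G α.args) (M : KObj (α.args ++ G)) : KAbs G α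
/-- Base kinds. -/
inductive KBase : List Arity → Type u
  | type {G : List Arity} : KBase G
  | el {G : List Arity} (A : KObj G) : KBase G
/-- `α`-ary kinds `(Δ)T`. -/
inductive KKind : List Arity → Arity → Type u
  | mk {G : List Arity} {α : Arity} (Δ : KTel G α.args) (T : KBase (α.args ++ G)) : KKind G α
/-- Contexts on top of a scope. -/
inductive KTel : List Arity → List Arity → Type u
  | nil {G : List Arity} : KTel G []
  | snoc {G Δ : List Arity} {α : Arity} (Θ : KTel G Δ) (K : KKind (Δ ++ G) α) : KTel G (α :: Δ)
end

/-- Contexts (with no free variables). -/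
inductive KCtx : List Arity → Type u
  | nil : KCtx []
  | snoc {G : List Arity} {α : Arity} (Γ : KCtx G) (K : KKind ar G α) : KCtx (α :: G)

/-- Abstraction sequences. -/
abbrev KArgs (G Δ : List Arity) : Type u := ∀ β, Var Δ β → KAbs ar G β

variable {ar}

def KAbs.tel {G : List Arity} {α : Arity} : KAbs ar G α → KTel ar G α.args
  | .mk Δ _ => Δ

def KAbs.body {G : List Arity} {α : Arity} : KAbs ar G α → KObj ar (α.args ++ G)
  | .mk _ M => M

def KKind.tel {G : List Arity} {α : Arity} : KKind ar G α → KTel ar G α.args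
  | .mk Δ _ => Δ

def KKind.base {G : List Arity} {α : Arity} : KKind ar G α → KBase ar (α.args ++ G)
  | .mk _ T => T

mutual
def KObj.ren : {G G' : List Arity} → Ren G G' → KObj ar G → KObj ar G'
  | _, _, ρ, .var x F => .var (ρ _ x) fun β y => KAbs.ren ρ (F β y)
  | _, _, ρ, .const c F => .const c fun β y => KAbs.ren ρ (F β y)
def KAbs.ren : {G G' : List Arity} → {α : Arity} → Ren G G' → KAbs ar G α → KAbs ar G' α
  | _, _, α, ρ, .mk Δ M => .mk (KTel.ren ρ Δ) (KObj.ren (ρ.lift α.args) M)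
def KBase.ren : {G G' : List Arity} → Ren G G' → KBase ar G → KBase ar G'
  | _, _, _, .type => .type
  | _, _, ρ, .el A => .el (KObj.ren ρ A)
def KKind.ren : {G G' : List Arity} → {α : Arity} → Ren G G' → KKind ar G α → KKind ar G' α
  | _, _, α, ρ, .mk Δ T => .mk (KTel.ren ρ Δ) (KBase.ren (ρ.lift α.args) T)
def KTel.ren : {G G' Δ : List Arity} → Ren G G' → KTel ar G Δ → KTel ar G' Δ
  | _, _, _, _, .nil => .nil
  | _, _, _ :: Δ, ρ, .snoc Θ K => .snoc (KTel.ren ρ Θ) (KKind.ren (ρ.lift Δ) K)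
end

variable (ar)

inductive KEntry (b : ℕ) (G : List Arity) (α : Arity) : Type u
  | var (x : Var G α) : KEntry b G α
  | abs (h : α.order < b) (F : KAbs ar G α) : KEntry b G α

/-- Simultaneous instantiations. -/
abbrev KSub (b : ℕ) (G G' : List Arity) : Type u := ∀ α, Var G α → KEntry ar b G' α

variable {ar}

def KEntry.ren {b : ℕ} {G G' : List Arity} {α : Arity} (ρ : Ren G G') :
    KEntry ar b G α → KEntry ar b G' α
  | .var x => .var (ρ _ x)
  | .abs h F => .abs h (F.ren ρ)

def KSub.lift1 {b : ℕ} {G G' : List Arity} (σ : KSub ar b G G') (β : Arity) :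
    KSub ar b (β :: G) (β :: G')
  | _, .zero => .var .zero
  | _, .succ x => (σ _ x).ren (Ren.wk1 β)

def KSub.lift {b : ℕ} {G G' : List Arity} (σ : KSub ar b G G') :
    (Δ : List Arity) → KSub ar b (Δ ++ G) (Δ ++ G')
  | [] => σ
  | β :: Δ => KSub.lift1 (KSub.lift σ Δ) β

/-- The instantiation `{F/Δ}`. -/
def KSub.block {b : ℕ} {G : List Arity} : {Δ : List Arity} → orderList Δ ≤ b → KArgs ar G Δ →
    KSub ar b (Δ ++ G) G
  | [], _, _ => fun _ x => .var x
  | α :: Δ, h, F => fun _ x => match x with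
    | .zero => .abs (lt_of_lt_of_le (Var.zero (G := Δ)).order_lt_orderList h) (F α .zero)
    | .succ x => KSub.block (le_trans (by rw [orderList]; exact le_max_right _ _) h)
        (fun β y => F β (.succ y)) _ x

/-- Employment of abstractions of arity of order `< b` on sequences of arguments. -/
abbrev KEmploy (ar : C → Arity) (b : ℕ) : Type u :=
  ∀ (G : List Arity) (α : Arity), α.order < b → KAbs ar G α → KArgs ar G α.args → KObj ar G

mutual
def KObj.subWith {b : ℕ} (emp : KEmploy ar b) :
    {G G' : List Arity} → KSub ar b G G' → KObj ar G → KObj ar G'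
  | _, _, σ, .const c F => .const c fun β y => KAbs.subWith emp σ (F β y)
  | _, _, σ, .var x F =>
      match σ _ x with
      | .var x' => .var x' fun β y => KAbs.subWith emp σ (F β y)
      | .abs h P => emp _ _ h P fun β y => KAbs.subWith emp σ (F β y)
def KAbs.subWith {b : ℕ} (emp : KEmploy ar b) :
    {G G' : List Arity} → {α : Arity} → KSub ar b G G' → KAbs ar G α → KAbs ar G' α
  | _, _, α, σ, .mk Δ M =>
      .mk (KTel.subWith emp σ Δ) (KObj.subWith emp (KSub.lift σ α.args) M)
def KBase.subWith {b : ℕ} (emp : KEmploy ar b) :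
    {G G' : List Arity} → KSub ar b G G' → KBase ar G → KBase ar G'
  | _, _, _, .type => .type
  | _, _, σ, .el A => .el (KObj.subWith emp σ A)
def KKind.subWith {b : ℕ} (emp : KEmploy ar b) :
    {G G' : List Arity} → {α : Arity} → KSub ar b G G' → KKind ar G α → KKind ar G' α
  | _, _, α, σ, .mk Δ T =>
      .mk (KTel.subWith emp σ Δ) (KBase.subWith emp (KSub.lift σ α.args) T)
def KTel.subWith {b : ℕ} (emp : KEmploy ar b) :
    {G G' Δ : List Arity} → KSub ar b G G' → KTel ar G Δ → KTel ar G' Δ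
  | _, _, _, _, .nil => .nil
  | _, _, _ :: Δ, σ, .snoc Θ K =>
      .snoc (KTel.subWith emp σ Θ) (KKind.subWith emp (KSub.lift σ Δ) K)
end

/-- `([t₁ : K₁, …, tₙ : Kₙ]P) • G₁ • … • Gₙ = {G₁/t₁} ⋯ {Gₙ/tₙ} P`. -/
def kemploy : (b : ℕ) → KEmploy ar b
  | 0 => fun _ _ h _ _ => absurd h (Nat.not_lt_zero _)
  | b + 1 => fun _ α h P F => match α, h, P, F with
    | .mk _, h, .mk _ M, F =>
      KObj.subWith (kemploy b)
        (KSub.block (by rw [Arity.order] at h; exact Nat.lt_succ_iff.mp h) F) M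

/-- `{F/Δ}M`. -/
def KObj.inst {G Δ : List Arity} (F : KArgs ar G Δ) (M : KObj ar (Δ ++ G)) : KObj ar G :=
  M.subWith (kemploy _) (KSub.block le_rfl F)

/-- `{F/Δ}T`. -/
def KBase.inst {G Δ : List Arity} (F : KArgs ar G Δ) (T : KBase ar (Δ ++ G)) : KBase ar G :=
  T.subWith (kemploy _) (KSub.block le_rfl F)

/-- `{F/Δ}K`. -/
def KKind.inst {G Δ : List Arity} {α : Arity} (F : KArgs ar G Δ) (K : KKind ar (Δ ++ G) α) :
    KKind ar G α :=
  K.subWith (kemploy _) (KSub.block le_rfl F)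

/-- `{F₁/x₁, …, Fᵢ₋₁/xᵢ₋₁}Kᵢ`. -/
def KTel.argKind {G : List Arity} : {Δ : List Arity} → KTel ar G Δ → KArgs ar G Δ →
    (β : Arity) → Var Δ β → KKind ar G β
  | _, .snoc _ K, F, _, .zero => K.inst fun β y => F β (.succ y)
  | _, .snoc Θ _, F, _, .succ y => KTel.argKind Θ (fun β y => F β (.succ y)) _ y

/-- `Γ, Δ`. -/
def KCtx.append {G : List Arity} (Γ : KCtx ar G) :
    {Δ : List Arity} → KTel ar G Δ → KCtx ar (Δ ++ G)
  | _, .nil => Γ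
  | _, .snoc Θ K => .snoc (KCtx.append Γ Θ) K

/-- The kind of a variable in a context. -/
def KCtx.lookup : {G : List Arity} → KCtx ar G → {α : Arity} → Var G α → KKind ar G α
  | _, .snoc _ K, _, .zero => K.ren (Ren.wk1 _)
  | _, .snoc Γ _, _, .succ x => (KCtx.lookup Γ x).ren (Ren.wk1 _)

variable (ar)

/-- The primitive judgement forms of `TFₖ`. -/
inductive KJdg : Type u
  | valid {G : List Arity} (Γ : KCtx ar G) : KJdg
  | typ {G : List Arity} (Γ : KCtx ar G) (M : KObj ar G) (T : KBase ar G) : KJdg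
  | eq {G : List Arity} (Γ : KCtx ar G) (M N : KObj ar G) (T : KBase ar G) : KJdg

/-- The declarations of `TFₖ`. -/
inductive KDecl : Type u
  | const (c : C) (K : KKind ar [] (ar c)) : KDecl
  | eqn {Δ : List Arity} (Θ : KTel ar [] Δ) (M N : KObj ar (Δ ++ [])) (T : KBase ar (Δ ++ [])) :
      KDecl

variable {ar}

/-- `Γ ⊩ T kind` for a base kind `T`. -/
def KCtx.baseKind {G : List Arity} (Γ : KCtx ar G) : KBase ar G → KJdg ar
  | .type => .valid Γ
  | .el A => .typ Γ A .type

/-- `Γ ⊩ (Δ)T kind`. -/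
def KCtx.isKind {G : List Arity} {α : Arity} (Γ : KCtx ar G) (K : KKind ar G α) : KJdg ar :=
  (Γ.append K.tel).baseKind K.base

mutual
/-- Derivability in `TFₖ` under a specification `S`.  It is defined together with the derivability
of the defined judgement forms, which are sets of primitive judgements: such a form is derivable
when it is defined and all its members are derivable. -/
inductive KDer (S : Set (KDecl ar)) : KJdg ar → Prop
  | emp : KDer S (.valid .nil)
  | ctxt {G : List Arity} {α : Arity} (Γ : KCtx ar G) (K : KKind ar G α) :
      KDer S (Γ.isKind K) → KDer S (.valid (Γ.snoc K))
  | var {G : List Arity} {α : Arity} (Γ : KCtx ar G) (x : Var G α) (F : KArgs ar G α.args) :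
      KSat S Γ F (Γ.lookup x).tel →
      KDer S (.typ Γ (.var x F) ((Γ.lookup x).base.inst F))
  | var_eq {G : List Arity} {α : Arity} (Γ : KCtx ar G) (x : Var G α) (F F' : KArgs ar G α.args) :
      KSatEq S Γ F F' (Γ.lookup x).tel →
      KDer S (.eq Γ (.var x F) (.var x F') ((Γ.lookup x).base.inst F))
  | ref {G : List Arity} {Γ : KCtx ar G} {M : KObj ar G} {T : KBase ar G} :
      KDer S (.typ Γ M T) → KDer S (.eq Γ M M T)
  | sym {G : List Arity} {Γ : KCtx ar G} {M N : KObj ar G} {T : KBase ar G} :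
      KDer S (.eq Γ M N T) → KDer S (.eq Γ N M T)
  | trans {G : List Arity} {Γ : KCtx ar G} {M N P : KObj ar G} {T : KBase ar G} :
      KDer S (.eq Γ M N T) → KDer S (.eq Γ N P T) → KDer S (.eq Γ M P T)
  | conv {G : List Arity} {Γ : KCtx ar G} {M A B : KObj ar G} :
      KDer S (.typ Γ M (.el A)) → KDer S (.eq Γ A B .type) → KDer S (.typ Γ M (.el B))
  | conv_eq {G : List Arity} {Γ : KCtx ar G} {M N A B : KObj ar G} :
      KDer S (.eq Γ M N (.el A)) → KDer S (.eq Γ A B .type) → KDer S (.eq Γ M N (.el B))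
  | const {G : List Arity} (Γ : KCtx ar G) (c : C) (K : KKind ar [] (ar c))
      (F : KArgs ar G (ar c).args) : KDecl.const c K ∈ S →
      KSat S Γ F (K.ren (Ren.empty G)).tel →
      KDer S (.typ Γ (.const c F) ((K.ren (Ren.empty G)).base.inst F))
  | const_eq {G : List Arity} (Γ : KCtx ar G) (c : C) (K : KKind ar [] (ar c))
      (F F' : KArgs ar G (ar c).args) : KDecl.const c K ∈ S →
      KSatEq S Γ F F' (K.ren (Ren.empty G)).tel →
      KDer S (.eq Γ (.const c F) (.const c F') ((K.ren (Ren.empty G)).base.inst F))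
  | eqn {G Δ : List Arity} (Γ : KCtx ar G) (Θ : KTel ar [] Δ) (M N : KObj ar (Δ ++ []))
      (T : KBase ar (Δ ++ [])) (F : KArgs ar G Δ) : KDecl.eqn Θ M N T ∈ S →
      KSat S Γ F (Θ.ren (Ren.empty G)) →
      KDer S (.eq Γ ((M.ren ((Ren.empty G).lift Δ)).inst F) ((N.ren ((Ren.empty G).lift Δ)).inst F)
        ((T.ren ((Ren.empty G).lift Δ)).inst F))
/-- `Γ ⊩ T = T'` for base kinds. -/
inductive KBaseEq (S : Set (KDecl ar)) :
    {G : List Arity} → KCtx ar G → KBase ar G → KBase ar G → Prop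
  | type {G : List Arity} {Γ : KCtx ar G} : KDer S (.valid Γ) → KBaseEq S Γ .type .type
  | el {G : List Arity} {Γ : KCtx ar G} {A B : KObj ar G} :
      KDer S (.eq Γ A B .type) → KBaseEq S Γ (.el A) (.el B)
/-- `Γ ⊩ K = K'`. -/
inductive KKindEq (S : Set (KDecl ar)) :
    {G : List Arity} → {α : Arity} → KCtx ar G → KKind ar G α → KKind ar G α → Prop
  | mk {G : List Arity} {α : Arity} {Γ : KCtx ar G} {Δ Δ' : KTel ar G α.args}
      {T T' : KBase ar (α.args ++ G)} :
      KTelEq S Γ Δ Δ' → KBaseEq S (Γ.append Δ) T T' → KKindEq S Γ (.mk Δ T) (.mk Δ' T')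
/-- `Γ ⊩ Δ = Δ'`. -/
inductive KTelEq (S : Set (KDecl ar)) :
    {G Δ : List Arity} → KCtx ar G → KTel ar G Δ → KTel ar G Δ → Prop
  | nil {G : List Arity} {Γ : KCtx ar G} : KDer S (.valid Γ) → KTelEq S Γ .nil .nil
  | snoc {G Δ : List Arity} {α : Arity} {Γ : KCtx ar G} {Θ Θ' : KTel ar G Δ}
      {K K' : KKind ar (Δ ++ G) α} :
      KTelEq S Γ Θ Θ' → KKindEq S (Γ.append Θ) K K' → KTelEq S Γ (.snoc Θ K) (.snoc Θ' K')
/-- `Γ ⊩ [Δ₁]M : (Δ)T`. -/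
inductive KAbsTyp (S : Set (KDecl ar)) :
    {G : List Arity} → {α : Arity} → KCtx ar G → KAbs ar G α → KKind ar G α → Prop
  | mk {G : List Arity} {α : Arity} {Γ : KCtx ar G} {Δ₁ Δ : KTel ar G α.args}
      {M : KObj ar (α.args ++ G)} {T : KBase ar (α.args ++ G)} :
      KTelEq S Γ Δ Δ₁ → KDer S (.typ (Γ.append Δ) M T) → KAbsTyp S Γ (.mk Δ₁ M) (.mk Δ T)
/-- `Γ ⊩ [Δ₁]M = [Δ₂]N : (Δ)T`. -/
inductive KAbsEq (S : Set (KDecl ar)) :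
    {G : List Arity} → {α : Arity} → KCtx ar G → KAbs ar G α → KAbs ar G α → KKind ar G α → Prop
  | mk {G : List Arity} {α : Arity} {Γ : KCtx ar G} {Δ₁ Δ₂ Δ : KTel ar G α.args}
      {M N : KObj ar (α.args ++ G)} {T : KBase ar (α.args ++ G)} :
      KTelEq S Γ Δ Δ₁ → KTelEq S Γ Δ Δ₂ → KDer S (.eq (Γ.append Δ) M N T) →
      KAbsEq S Γ (.mk Δ₁ M) (.mk Δ₂ N) (.mk Δ T)
/-- `Γ ⊩ F :: Δ`. -/
inductive KSat (S : Set (KDecl ar)) :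
    {G Δ : List Arity} → KCtx ar G → KArgs ar G Δ → KTel ar G Δ → Prop
  | mk {G Δ : List Arity} {Γ : KCtx ar G} {F : KArgs ar G Δ} {Θ : KTel ar G Δ} :
      KDer S (.valid Γ) → (∀ β y, KAbsTyp S Γ (F β y) (Θ.argKind F β y)) → KSat S Γ F Θ
/-- `Γ ⊩ F = F' :: Δ`. -/
inductive KSatEq (S : Set (KDecl ar)) :
    {G Δ : List Arity} → KCtx ar G → KArgs ar G Δ → KArgs ar G Δ → KTel ar G Δ → Prop
  | mk {G Δ : List Arity} {Γ : KCtx ar G} {F F' : KArgs ar G Δ} {Θ : KTel ar G Δ} :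
      KDer S (.valid Γ) → (∀ β y, KAbsEq S Γ (F β y) (F' β y) (Θ.argKind F β y)) →
      KSatEq S Γ F F' Θ
end

end Church

/-! ## The translation `L` from `TF` to `TFₖ`

The defining equations of `L` are recursive in a way that need not terminate under an arbitrary
specification (the label of a bound variable is the translation of a kind that is found in the
specification, and may contain the very constant whose argument is being labelled).  So `L` is given
by its graph, as the least relation that is closed under the defining equations. -/

section Labelling

variable {C : Type u} {ar : C → Arity}

mutual
/-- `L_Γ(M) = M'`. -/
inductive LabObj (S : Set (Decl ar)) : {G : List Arity} → Ctx ar G → Obj ar G → KObj ar G → Prop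
  | var {G : List Arity} {α : Arity} {Γ : Ctx ar G} (x : Var G α) (F : Args ar G α.args)
      (F' : KArgs ar G α.args) :
      (∀ β y, LabAbs S Γ ((Γ.lookup x).tel.argKind F β y) (F β y) (F' β y)) →
      LabObj S Γ (.var x F) (.var x F')
  | const {G : List Arity} {Γ : Ctx ar G} (c : C) (K : Kind ar [] (ar c))
      (F : Args ar G (ar c).args) (F' : KArgs ar G (ar c).args) : Decl.const c K ∈ S →
      (∀ β y, LabAbs S Γ ((K.ren (Ren.empty G)).tel.argKind F β y) (F β y) (F' β y)) →
      LabObj S Γ (.const c F) (.const c F')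
/-- `L_Γ^K(F) = F'`. -/
inductive LabAbs (S : Set (Decl ar)) : {G : List Arity} → {α : Arity} → Ctx ar G → Kind ar G α →
    Abs ar G α → KAbs ar G α → Prop
  | mk {G : List Arity} {α : Arity} {Γ : Ctx ar G} {Δ : Tel ar G α.args}
      {T : Base ar (α.args ++ G)} {M : Abs ar G α} {Δ' : KTel ar G α.args}
      {M' : KObj ar (α.args ++ G)} :
      LabTel S Γ Δ Δ' → LabObj S (Γ.append Δ) M M' → LabAbs S Γ (.mk Δ T) M (.mk Δ' M')
/-- `L_Γ(T) = T'` for base kinds. -/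
inductive LabBase (S : Set (Decl ar)) :
    {G : List Arity} → Ctx ar G → Base ar G → KBase ar G → Prop
  | type {G : List Arity} {Γ : Ctx ar G} : LabBase S Γ .type .type
  | el {G : List Arity} {Γ : Ctx ar G} {A : Obj ar G} {A' : KObj ar G} :
      LabObj S Γ A A' → LabBase S Γ (.el A) (.el A')
/-- `L_Γ(K) = K'`. -/
inductive LabKind (S : Set (Decl ar)) : {G : List Arity} → {α : Arity} → Ctx ar G →
    Kind ar G α → KKind ar G α → Prop
  | mk {G : List Arity} {α : Arity} {Γ : Ctx ar G} {Δ : Tel ar G α.args}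
      {T : Base ar (α.args ++ G)} {Δ' : KTel ar G α.args} {T' : KBase ar (α.args ++ G)} :
      LabTel S Γ Δ Δ' → LabBase S (Γ.append Δ) T T' → LabKind S Γ (.mk Δ T) (.mk Δ' T')
/-- `L_Γ(Δ) = Δ'`. -/
inductive LabTel (S : Set (Decl ar)) : {G Δ : List Arity} → Ctx ar G →
    Tel ar G Δ → KTel ar G Δ → Prop
  | nil {G : List Arity} {Γ : Ctx ar G} : LabTel S Γ .nil .nil
  | snoc {G Δ : List Arity} {α : Arity} {Γ : Ctx ar G} {Θ : Tel ar G Δ} {K : Kind ar (Δ ++ G) α}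
      {Θ' : KTel ar G Δ} {K' : KKind ar (Δ ++ G) α} :
      LabTel S Γ Θ Θ' → LabKind S (Γ.append Θ) K K' → LabTel S Γ (.snoc Θ K) (.snoc Θ' K')
end

/-- `L(Γ) = Γ'`. -/
inductive LabCtx (S : Set (Decl ar)) : {G : List Arity} → Ctx ar G → KCtx ar G → Prop
  | nil : LabCtx S .nil .nil
  | snoc {G : List Arity} {α : Arity} {Γ : Ctx ar G} {K : Kind ar G α} {Γ' : KCtx ar G}
      {K' : KKind ar G α} :
      LabCtx S Γ Γ' → LabKind S Γ K K' → LabCtx S (.snoc Γ K) (.snoc Γ' K')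

/-- `L(J) = J'`. -/
inductive LabJdg (S : Set (Decl ar)) : Jdg ar → KJdg ar → Prop
  | valid {G : List Arity} {Γ : Ctx ar G} {Γ' : KCtx ar G} :
      LabCtx S Γ Γ' → LabJdg S (.valid Γ) (.valid Γ')
  | typ {G : List Arity} {Γ : Ctx ar G} {M : Obj ar G} {T : Base ar G} {Γ' : KCtx ar G}
      {M' : KObj ar G} {T' : KBase ar G} :
      LabCtx S Γ Γ' → LabObj S Γ M M' → LabBase S Γ T T' → LabJdg S (.typ Γ M T) (.typ Γ' M' T')
  | eq {G : List Arity} {Γ : Ctx ar G} {M N : Obj ar G} {T : Base ar G} {Γ' : KCtx ar G}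
      {M' N' : KObj ar G} {T' : KBase ar G} :
      LabCtx S Γ Γ' → LabObj S Γ M M' → LabObj S Γ N N' → LabBase S Γ T T' →
      LabJdg S (.eq Γ M N T) (.eq Γ' M' N' T')

/-- The translation of declarations. -/
inductive LabDecl (S : Set (Decl ar)) : Decl ar → KDecl ar → Prop
  | const {c : C} {K : Kind ar [] (ar c)} {K' : KKind ar [] (ar c)} :
      LabKind S .nil K K' → LabDecl S (.const c K) (.const c K')
  | eqn {Δ : List Arity} {Θ : Tel ar [] Δ} {M N : Obj ar (Δ ++ [])} {T : Base ar (Δ ++ [])}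
      {Θ' : KTel ar [] Δ} {M' N' : KObj ar (Δ ++ [])} {T' : KBase ar (Δ ++ [])} :
      LabTel S .nil Θ Θ' → LabObj S (Ctx.nil.append Θ) M M' → LabObj S (Ctx.nil.append Θ) N N' →
      LabBase S (Ctx.nil.append Θ) T T' → LabDecl S (.eqn Θ M N T) (.eqn Θ' M' N' T')

/-- `L(S)`. -/
def labSpec (S : Set (Decl ar)) : Set (KDecl ar) := {δ' | ∃ δ ∈ S, LabDecl S δ δ'}

end Labelling

end TF

namespace TF

variable {C : Type u} {ar : C → Arity}

/-! ## Renamings -/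

-- The equations of $\mathcal L$ find the label of an argument by translating a kind of TF, and this
-- recursion need not end. The proof replaces it by a total evaluation `Obj.ev`. An environment
-- assigns to every variable a kind of $\mathrm{TF}_{\mathrm k}$, from which the labels of its
-- arguments are computed, and a value, which is a variable or an abstraction; a function `κ`
-- supplies the kinds of the constants. No kind of TF is evaluated to obtain a label, so the
-- recursion is structural. Evaluation commutes exactly with instantiation, both of its result
-- (`Obj.ev_vsub`) and of its argument (`Obj.inst_ev`). Where $\mathcal L$ is defined, it is
-- evaluation in the environment that maps each variable to itself (`LabObj.eq_ev`), which makes it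
-- single-valued.
--
-- Derivability is the harder half. When $F=F'$ are sequences of arguments, their labels are
-- instances of the same kinds by $F$ and by $F'$, hence different expressions, and the rules of
-- $\mathrm{TF}_{\mathrm k}$ demand that they be derivably equal. One needs to know that
-- instantiation by equal sequences gives equal kinds. This is built into a Kripke logical relation
-- on kinds and values, defined by recursion on arities. It is a partial equivalence closed under
-- conversion (`arityPer`), and related kinds are derivably equal, as one sees by applying the
-- relation to fresh variables (`reifyKind`). The fundamental lemma `Der.sem` says that a derivable
-- judgement holds in all pairs of related environments; the identity environment is related to
-- itself (`CtxOk.env`), so the evaluated judgement is derivable in $\mathrm{TF}_{\mathrm k}$.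
--
-- Well-founded induction along the order of the declarations shows that each of them is
-- semantically valid and that `κ` satisfies its fixed-point equation. It remains to see that
-- $\mathcal L$ is defined. A derivation directly yields translations of the context and of the
-- typed object (`Der.labelled`). Types are instances of translatable kinds, and translatability
-- survives hereditary instantiation (`LabObj.sub`, `employLab`). Goodness enters only here: it
-- provides typings for the two sides of an equation, and for the new type in a conversion.

@[reducible] def Ren.id (G : List Arity) : Ren G G := fun _ x => x

@[reducible] def Ren.comp {G G' G'' : List Arity} (ρ : Ren G G') (ρ' : Ren G' G'') : Ren G G'' :=
  fun α x => ρ' α (ρ α x)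

theorem Ren.lift_id {G : List Arity} (Δ : List Arity) : (Ren.id G).lift Δ = Ren.id (Δ ++ G) := by
  induction Δ with
  | nil => rfl
  | cons β Δ ih =>
    funext α x
    cases x with
    | zero => rfl
    | succ x => simp [Ren.lift, Ren.lift1, ih]

theorem Ren.lift_comp {G G' G'' : List Arity} (ρ : Ren G G') (ρ' : Ren G' G'') (Δ : List Arity) :
    (ρ.comp ρ').lift Δ = (ρ.lift Δ).comp (ρ'.lift Δ) := by
  induction Δ with
  | nil => rfl
  | cons β Δ ih =>
    funext α x
    cases x with
    | zero => rfl
    | succ x => exact congrArg Var.succ (congrFun (congrFun ih α) x)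

mutual
theorem KObj.ren_id : {G : List Arity} → (M : KObj ar G) → M.ren (Ren.id G) = M
  | _, .var x F => by simp only [KObj.ren]; congr 1; funext β y; exact KAbs.ren_id _
  | _, .const c F => by simp only [KObj.ren]; congr 1; funext β y; exact KAbs.ren_id _
theorem KAbs.ren_id : {G : List Arity} → {α : Arity} → (F : KAbs ar G α) → F.ren (Ren.id G) = F
  | _, _, .mk Δ M => by simp only [KAbs.ren, Ren.lift_id, KTel.ren_id Δ, KObj.ren_id M]
theorem KBase.ren_id : {G : List Arity} → (T : KBase ar G) → T.ren (Ren.id G) = T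
  | _, .type => by simp only [KBase.ren]
  | _, .el A => by simp only [KBase.ren, KObj.ren_id A]
theorem KKind.ren_id : {G : List Arity} → {α : Arity} → (K : KKind ar G α) → K.ren (Ren.id G) = K
  | _, _, .mk Δ T => by simp only [KKind.ren, Ren.lift_id, KTel.ren_id Δ, KBase.ren_id T]
theorem KTel.ren_id : {G Δ : List Arity} → (Θ : KTel ar G Δ) → Θ.ren (Ren.id G) = Θ
  | _, _, .nil => by simp only [KTel.ren]
  | _, _, .snoc Θ K => by simp only [KTel.ren, Ren.lift_id, KTel.ren_id Θ, KKind.ren_id K]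
end

mutual
theorem KObj.ren_ren : {G G' G'' : List Arity} → (ρ : Ren G G') → (ρ' : Ren G' G'') →
    (M : KObj ar G) → (M.ren ρ).ren ρ' = M.ren (ρ.comp ρ')
  | _, _, _, ρ, ρ', .var x F => by
    simp only [KObj.ren]; congr 1; funext β y; exact KAbs.ren_ren _ _ _
  | _, _, _, ρ, ρ', .const c F => by
    simp only [KObj.ren]; congr 1; funext β y; exact KAbs.ren_ren _ _ _
theorem KAbs.ren_ren : {G G' G'' : List Arity} → {α : Arity} → (ρ : Ren G G') → (ρ' : Ren G' G'') →
    (F : KAbs ar G α) → (F.ren ρ).ren ρ' = F.ren (ρ.comp ρ')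
  | _, _, _, _, ρ, ρ', .mk Δ M => by
    simp only [KAbs.ren, Ren.lift_comp, KTel.ren_ren ρ ρ' Δ, KObj.ren_ren _ _ M]
theorem KBase.ren_ren : {G G' G'' : List Arity} → (ρ : Ren G G') → (ρ' : Ren G' G'') →
    (T : KBase ar G) → (T.ren ρ).ren ρ' = T.ren (ρ.comp ρ')
  | _, _, _, ρ, ρ', .type => by simp only [KBase.ren]
  | _, _, _, ρ, ρ', .el A => by simp only [KBase.ren, KObj.ren_ren ρ ρ' A]
theorem KKind.ren_ren : {G G' G'' : List Arity} → {α : Arity} → (ρ : Ren G G') →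
    (ρ' : Ren G' G'') → (K : KKind ar G α) → (K.ren ρ).ren ρ' = K.ren (ρ.comp ρ')
  | _, _, _, _, ρ, ρ', .mk Δ T => by
    simp only [KKind.ren, Ren.lift_comp, KTel.ren_ren ρ ρ' Δ, KBase.ren_ren _ _ T]
theorem KTel.ren_ren : {G G' G'' Δ : List Arity} → (ρ : Ren G G') → (ρ' : Ren G' G'') →
    (Θ : KTel ar G Δ) → (Θ.ren ρ).ren ρ' = Θ.ren (ρ.comp ρ')
  | _, _, _, _, ρ, ρ', .nil => by simp only [KTel.ren]
  | _, _, _, _, ρ, ρ', .snoc Θ K => by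
    simp only [KTel.ren, Ren.lift_comp, KTel.ren_ren ρ ρ' Θ, KKind.ren_ren _ _ K]
end

/-! ## Instantiation in `TFₖ` without a bound on the orders -/

variable (ar) in
/-- What is substituted for an `α`-ary variable: a variable or an abstraction. -/
inductive Val (G : List Arity) (α : Arity) : Type u
  | var (x : Var G α) : Val G α
  | abs (F : KAbs ar G α) : Val G α

variable (ar) in
/-- Sequences of values; with `Δ` a whole scope, these are the simultaneous instantiations from
`Δ` to `G`. -/
abbrev VSub (Δ G : List Arity) : Type u := ∀ α, Var Δ α → Val ar G α

def Val.ren {G G' : List Arity} {α : Arity} (ρ : Ren G G') : Val ar G α → Val ar G' α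
  | .var x => .var (ρ _ x)
  | .abs F => .abs (F.ren ρ)

def VSub.ren {Δ G G' : List Arity} (ρ : Ren G G') (σ : VSub ar Δ G) : VSub ar Δ G' :=
  fun _ x => (σ _ x).ren ρ

def VSub.lift1 {G G' : List Arity} (σ : VSub ar G G') (β : Arity) : VSub ar (β :: G) (β :: G')
  | _, .zero => .var .zero
  | _, .succ x => (σ _ x).ren (Ren.wk1 β)

def VSub.lift {G G' : List Arity} (σ : VSub ar G G') : (Δ : List Arity) → VSub ar (Δ ++ G) (Δ ++ G')
  | [] => σ
  | β :: Δ => VSub.lift1 (VSub.lift σ Δ) β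

variable (ar) in
def Ren.toV {G G' : List Arity} (ρ : Ren G G') : VSub ar G G' := fun _ x => .var (ρ _ x)

/-- `h` for the variables `Δ` and `σ` for the others. -/
def VSub.ext {G G' : List Arity} : {Δ : List Arity} → VSub ar Δ G' → VSub ar G G' →
    VSub ar (Δ ++ G) G'
  | [], _, σ => σ
  | _ :: _, h, σ => fun _ x => match x with
    | .zero => h _ .zero
    | .succ x => VSub.ext (fun β y => h β (.succ y)) σ _ x

def VSub.block {G Δ : List Arity} (h : VSub ar Δ G) : VSub ar (Δ ++ G) G :=
  h.ext (Ren.toV ar (Ren.id G))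

def KArgs.toV {G Δ : List Arity} (F : KArgs ar G Δ) : VSub ar Δ G := fun β y => .abs (F β y)

def KEntry.toVal {b : ℕ} {G : List Arity} {α : Arity} : KEntry ar b G α → Val ar G α
  | .var x => .var x
  | .abs _ F => .abs F

/-- Every variable of `G` has order below `orderList G`, so this bound admits any `σ`. It gives
bound-free instantiations a canonical meaning in terms of the bounded ones. -/
def VSub.toK {G G' : List Arity} (σ : VSub ar G G') : KSub ar (orderList G) G G' := fun _ x =>
  match σ _ x with
  | .var x' => .var x'
  | .abs F => .abs x.order_lt_orderList F

theorem VSub.toVal_toK {G G' : List Arity} (σ : VSub ar G G') (α : Arity) (x : Var G α) :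
    (σ.toK α x).toVal = σ α x := by
  unfold VSub.toK
  cases σ α x <;> rfl

theorem KEntry.toVal_ren {b : ℕ} {G G' : List Arity} {α : Arity} (ρ : Ren G G')
    (v : KEntry ar b G α) : (v.ren ρ).toVal = v.toVal.ren ρ := by
  cases v <;> rfl

theorem KSub.toVal_lift {b : ℕ} {G G' : List Arity} (σ : KSub ar b G G') (τ : VSub ar G G')
    (h : ∀ α x, (σ α x).toVal = τ α x) (Δ : List Arity) (α : Arity) (x : Var (Δ ++ G) α) :
    (σ.lift Δ α x).toVal = τ.lift Δ α x := by
  induction Δ generalizing α with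
  | nil => exact h α x
  | cons β Δ ih =>
    cases x with
    | zero => rfl
    | succ x => simp only [KSub.lift, KSub.lift1, VSub.lift, VSub.lift1, KEntry.toVal_ren, ih]

theorem KSub.toVal_block {b : ℕ} {G Δ : List Arity} (h : orderList Δ ≤ b) (F : KArgs ar G Δ)
    (α : Arity) (x : Var (Δ ++ G) α) :
    (KSub.block h F α x).toVal = F.toV.block α x := by
  induction Δ generalizing α with
  | nil => rfl
  | cons β Δ ih =>
    cases x with
    | zero => rfl
    | succ x => exact ih _ _ _ _

-- Independence of instantiation from the bound on orders

section Congr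

variable {b₁ b₂ : ℕ}

def SameEmploy (e₁ : KEmploy ar b₁) (e₂ : KEmploy ar b₂) : Prop :=
  ∀ G α h₁ h₂ P F, e₁ G α h₁ P F = e₂ G α h₂ P F

def SameVal {G G' : List Arity} (σ₁ : KSub ar b₁ G G') (σ₂ : KSub ar b₂ G G') : Prop :=
  ∀ α x, (σ₁ α x).toVal = (σ₂ α x).toVal

theorem SameVal.lift {G G' : List Arity} {σ₁ : KSub ar b₁ G G'} {σ₂ : KSub ar b₂ G G'}
    (h : SameVal σ₁ σ₂) (Δ : List Arity) : SameVal (σ₁.lift Δ) (σ₂.lift Δ) := fun α x => by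
  rw [KSub.toVal_lift σ₁ (fun α x => (σ₂ α x).toVal) h,
    KSub.toVal_lift σ₂ (fun α x => (σ₂ α x).toVal) fun _ _ => rfl]

variable {e₁ : KEmploy ar b₁} {e₂ : KEmploy ar b₂}

mutual
theorem KObj.subWith_congr : SameEmploy e₁ e₂ →
    {G G' : List Arity} → (σ₁ : KSub ar b₁ G G') → (σ₂ : KSub ar b₂ G G') →
    SameVal σ₁ σ₂ → (M : KObj ar G) → M.subWith e₁ σ₁ = M.subWith e₂ σ₂
  | he, _, _, σ₁, σ₂, h, .const c F => by
    simp only [KObj.subWith]; congr 1; funext β y; exact KAbs.subWith_congr he _ _ h _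
  | he, _, _, σ₁, σ₂, h, .var x F => by
    have hF : (fun β y => KAbs.subWith e₁ σ₁ (F β y)) = fun β y => KAbs.subWith e₂ σ₂ (F β y) := by
      funext β y; exact KAbs.subWith_congr he _ _ h _
    have hx := h _ x
    simp only [KObj.subWith, hF]
    cases h₁ : σ₁ _ x <;> cases h₂ : σ₂ _ x <;> simp only [h₁, h₂, KEntry.toVal] at hx ⊢ <;>
      cases hx
    · rfl
    · exact he _ _ _ _ _ _
theorem KAbs.subWith_congr : SameEmploy e₁ e₂ →
    {G G' : List Arity} → {α : Arity} → (σ₁ : KSub ar b₁ G G') →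
    (σ₂ : KSub ar b₂ G G') → SameVal σ₁ σ₂ → (F : KAbs ar G α) → F.subWith e₁ σ₁ = F.subWith e₂ σ₂
  | he, _, _, _, σ₁, σ₂, h, .mk Δ M => by
    simp only [KAbs.subWith, KTel.subWith_congr he _ _ h Δ, KObj.subWith_congr he _ _ (h.lift _) M]
theorem KBase.subWith_congr : SameEmploy e₁ e₂ →
    {G G' : List Arity} → (σ₁ : KSub ar b₁ G G') →
    (σ₂ : KSub ar b₂ G G') → SameVal σ₁ σ₂ → (T : KBase ar G) → T.subWith e₁ σ₁ = T.subWith e₂ σ₂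
  | he, _, _, σ₁, σ₂, h, .type => by simp only [KBase.subWith]
  | he, _, _, σ₁, σ₂, h, .el A => by simp only [KBase.subWith, KObj.subWith_congr he _ _ h A]
theorem KKind.subWith_congr : SameEmploy e₁ e₂ →
    {G G' : List Arity} → {α : Arity} → (σ₁ : KSub ar b₁ G G') →
    (σ₂ : KSub ar b₂ G G') → SameVal σ₁ σ₂ → (K : KKind ar G α) → K.subWith e₁ σ₁ = K.subWith e₂ σ₂
  | he, _, _, _, σ₁, σ₂, h, .mk Δ T => by
    simp only [KKind.subWith, KTel.subWith_congr he _ _ h Δ, KBase.subWith_congr he _ _ (h.lift _) T]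
theorem KTel.subWith_congr : SameEmploy e₁ e₂ →
    {G G' Δ : List Arity} → (σ₁ : KSub ar b₁ G G') →
    (σ₂ : KSub ar b₂ G G') → SameVal σ₁ σ₂ → (Θ : KTel ar G Δ) → Θ.subWith e₁ σ₁ = Θ.subWith e₂ σ₂
  | he, _, _, _, σ₁, σ₂, h, .nil => by simp only [KTel.subWith]
  | he, _, _, _, σ₁, σ₂, h, .snoc Θ K => by
    simp only [KTel.subWith, KTel.subWith_congr he _ _ h Θ, KKind.subWith_congr he _ _ (h.lift _) K]
end

end Congr

/-- The bound only drives the recursion: employment at `b + 1` is instantiation with employment at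
`b`, so congruence of `subWith` reduces the claim to smaller bounds. -/
theorem kemploy_congr (b₁ b₂ : ℕ) : SameEmploy (kemploy (ar := ar) b₁) (kemploy (ar := ar) b₂) := by
  induction b₁ generalizing b₂ with
  | zero => intro G α h₁; exact absurd h₁ (Nat.not_lt_zero _)
  | succ b₁ ih =>
    intro G α h₁ h₂ P F
    cases b₂ with
    | zero => exact absurd h₂ (Nat.not_lt_zero _)
    | succ b₂ =>
      cases α with
      | mk l =>
        cases P with
        | mk Δ M =>
          simp only [kemploy]
          exact KObj.subWith_congr (ih b₂) _ _
            (fun _ _ => by rw [KSub.toVal_block, KSub.toVal_block]) M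

def KObj.vsub {G G' : List Arity} (σ : VSub ar G G') (M : KObj ar G) : KObj ar G' :=
  M.subWith (kemploy _) σ.toK
def KAbs.vsub {G G' : List Arity} {α : Arity} (σ : VSub ar G G') (F : KAbs ar G α) :
    KAbs ar G' α := F.subWith (kemploy _) σ.toK
def KBase.vsub {G G' : List Arity} (σ : VSub ar G G') (T : KBase ar G) : KBase ar G' :=
  T.subWith (kemploy _) σ.toK
def KKind.vsub {G G' : List Arity} {α : Arity} (σ : VSub ar G G') (K : KKind ar G α) :
    KKind ar G' α := K.subWith (kemploy _) σ.toK
def KTel.vsub {G G' Δ : List Arity} (σ : VSub ar G G') (Θ : KTel ar G Δ) : KTel ar G' Δ :=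
  Θ.subWith (kemploy _) σ.toK

theorem VSub.same_lift {G G' : List Arity} (σ : VSub ar G G') (Δ : List Arity) :
    SameVal (σ.toK.lift Δ) (σ.lift Δ).toK := fun α x => by
  rw [VSub.toVal_toK, KSub.toVal_lift _ _ σ.toVal_toK]

theorem VSub.same_block {b : ℕ} {G Δ : List Arity} (h : orderList Δ ≤ b) (F : KArgs ar G Δ) :
    SameVal (KSub.block h F) F.toV.block.toK := fun α x => by
  rw [VSub.toVal_toK, KSub.toVal_block]

theorem KObj.inst_eq {G Δ : List Arity} (F : KArgs ar G Δ) (M : KObj ar (Δ ++ G)) :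
    M.inst F = M.vsub F.toV.block :=
  KObj.subWith_congr (kemploy_congr _ _) _ _ (VSub.same_block _ _) M
theorem KBase.inst_eq {G Δ : List Arity} (F : KArgs ar G Δ) (T : KBase ar (Δ ++ G)) :
    T.inst F = T.vsub F.toV.block :=
  KBase.subWith_congr (kemploy_congr _ _) _ _ (VSub.same_block _ _) T
theorem KKind.inst_eq {G Δ : List Arity} {α : Arity} (F : KArgs ar G Δ)
    (K : KKind ar (Δ ++ G) α) : K.inst F = K.vsub F.toV.block :=
  KKind.subWith_congr (kemploy_congr _ _) _ _ (VSub.same_block _ _) K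

/-- What is done with a variable whose arguments have been instantiated. -/
def Val.app {G : List Arity} {α : Arity} : Val ar G α → KArgs ar G α.args → KObj ar G
  | .var x, F => .var x F
  | .abs P, F => P.body.vsub F.toV.block

theorem kemploy_eq {b : ℕ} {G : List Arity} {α : Arity} (h : α.order < b) (P : KAbs ar G α)
    (F : KArgs ar G α.args) : kemploy b G α h P F = P.body.vsub F.toV.block := by
  cases b with
  | zero => exact absurd h (Nat.not_lt_zero _)
  | succ b =>
    cases α with
    | mk l =>
      cases P with
      | mk Δ M =>
        simp only [kemploy, KAbs.body]
        exact KObj.subWith_congr (kemploy_congr _ _) _ _ (VSub.same_block _ _) M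

/-- Together with the clauses that follow, this computes `vsub` without reference to bounds. -/
theorem KObj.vsub_var {G G' : List Arity} (σ : VSub ar G G') {α : Arity} (x : Var G α)
    (F : KArgs ar G α.args) :
    (KObj.var x F).vsub σ = (σ _ x).app fun β y => (F β y).vsub σ := by
  simp only [KObj.vsub, KObj.subWith]
  have hx := σ.toVal_toK _ x
  cases h₁ : σ.toK _ x <;> rw [h₁] at hx <;> rw [← hx] <;>
    simp only [KEntry.toVal, Val.app, kemploy_eq] <;> rfl

theorem KObj.vsub_const {G G' : List Arity} (σ : VSub ar G G') (c : C)
    (F : KArgs ar G (ar c).args) :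
    (KObj.const c F).vsub σ = .const c fun β y => (F β y).vsub σ := by
  simp only [KObj.vsub, KObj.subWith]; rfl

theorem KAbs.vsub_mk {G G' : List Arity} {α : Arity} (σ : VSub ar G G') (Δ : KTel ar G α.args)
    (M : KObj ar (α.args ++ G)) :
    (KAbs.mk Δ M).vsub σ = .mk (Δ.vsub σ) (M.vsub (σ.lift α.args)) := by
  simp only [KAbs.vsub, KAbs.subWith, KTel.vsub, KObj.vsub]
  rw [KObj.subWith_congr (kemploy_congr _ _) _ _ (σ.same_lift _) M]

theorem KBase.vsub_type {G G' : List Arity} (σ : VSub ar G G') :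
    (KBase.type : KBase ar G).vsub σ = .type := by
  simp only [KBase.vsub, KBase.subWith]

theorem KBase.vsub_el {G G' : List Arity} (σ : VSub ar G G') (A : KObj ar G) :
    (KBase.el A).vsub σ = .el (A.vsub σ) := by
  simp only [KBase.vsub, KBase.subWith]; rfl

theorem KKind.vsub_mk {G G' : List Arity} {α : Arity} (σ : VSub ar G G') (Δ : KTel ar G α.args)
    (T : KBase ar (α.args ++ G)) :
    (KKind.mk Δ T).vsub σ = .mk (Δ.vsub σ) (T.vsub (σ.lift α.args)) := by
  simp only [KKind.vsub, KKind.subWith, KTel.vsub, KBase.vsub]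
  rw [KBase.subWith_congr (kemploy_congr _ _) _ _ (σ.same_lift _) T]

theorem KTel.vsub_nil {G G' : List Arity} (σ : VSub ar G G') :
    (KTel.nil : KTel ar G []).vsub σ = .nil := by
  simp only [KTel.vsub, KTel.subWith]

theorem KTel.vsub_snoc {G G' Δ : List Arity} {α : Arity} (σ : VSub ar G G') (Θ : KTel ar G Δ)
    (K : KKind ar (Δ ++ G) α) :
    (KTel.snoc Θ K).vsub σ = .snoc (Θ.vsub σ) (K.vsub (σ.lift Δ)) := by
  simp only [KTel.vsub, KTel.subWith, KKind.vsub]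
  rw [KKind.subWith_congr (kemploy_congr _ _) _ _ (σ.same_lift _) K]

/-! ## Instantiation and renaming -/

theorem Val.ren_ren {G G' G'' : List Arity} {α : Arity} (ρ : Ren G G') (ρ' : Ren G' G'')
    (v : Val ar G α) : (v.ren ρ).ren ρ' = v.ren (ρ.comp ρ') := by
  cases v with
  | var x => rfl
  | abs F => simp only [Val.ren, KAbs.ren_ren]

def VSub.preren {G G' G'' : List Arity} (ρ : Ren G G') (σ : VSub ar G' G'') : VSub ar G G'' :=
  fun α x => σ α (ρ α x)

theorem VSub.lift_preren {G G' G'' : List Arity} (ρ : Ren G G') (σ : VSub ar G' G'')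
    (Δ : List Arity) : (σ.preren ρ).lift Δ = (σ.lift Δ).preren (ρ.lift Δ) := by
  induction Δ with
  | nil => rfl
  | cons β Δ ih =>
    funext α x
    cases x with
    | zero => rfl
    | succ x => simp only [VSub.lift, VSub.lift1, ih]; rfl

theorem VSub.lift_toV {G G' : List Arity} (ρ : Ren G G') (Δ : List Arity) :
    (ρ.toV ar).lift Δ = (ρ.lift Δ).toV ar := by
  induction Δ with
  | nil => rfl
  | cons β Δ ih =>
    funext α x
    cases x with
    | zero => rfl
    | succ x => simp only [VSub.lift, VSub.lift1, ih]; rfl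

theorem VSub.lift_ren {G G' G'' : List Arity} (σ : VSub ar G G') (ρ : Ren G' G'')
    (Δ : List Arity) : (σ.ren ρ).lift Δ = (σ.lift Δ).ren (ρ.lift Δ) := by
  induction Δ with
  | nil => rfl
  | cons β Δ ih =>
    funext α x
    cases x with
    | zero => rfl
    | succ x => simp only [VSub.lift, VSub.lift1, VSub.ren, ih, Val.ren_ren]; rfl

mutual
theorem KObj.vsub_toV : {G G' : List Arity} → (ρ : Ren G G') → (M : KObj ar G) →
    M.vsub (ρ.toV ar) = M.ren ρ
  | _, _, ρ, .var x F => by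
    simp only [KObj.vsub_var, KObj.ren, Ren.toV, Val.app]; congr 1; funext β y
    exact KAbs.vsub_toV _ _
  | _, _, ρ, .const c F => by
    simp only [KObj.vsub_const, KObj.ren]; congr 1; funext β y; exact KAbs.vsub_toV _ _
theorem KAbs.vsub_toV : {G G' : List Arity} → {α : Arity} → (ρ : Ren G G') → (F : KAbs ar G α) →
    F.vsub (ρ.toV ar) = F.ren ρ
  | _, _, _, ρ, .mk Δ M => by
    simp only [KAbs.vsub_mk, KAbs.ren, VSub.lift_toV, KTel.vsub_toV ρ Δ, KObj.vsub_toV _ M]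
theorem KBase.vsub_toV : {G G' : List Arity} → (ρ : Ren G G') → (T : KBase ar G) →
    T.vsub (ρ.toV ar) = T.ren ρ
  | _, _, ρ, .type => by simp only [KBase.vsub_type, KBase.ren]
  | _, _, ρ, .el A => by simp only [KBase.vsub_el, KBase.ren, KObj.vsub_toV ρ A]
theorem KKind.vsub_toV : {G G' : List Arity} → {α : Arity} → (ρ : Ren G G') →
    (K : KKind ar G α) → K.vsub (ρ.toV ar) = K.ren ρ
  | _, _, _, ρ, .mk Δ T => by
    simp only [KKind.vsub_mk, KKind.ren, VSub.lift_toV, KTel.vsub_toV ρ Δ, KBase.vsub_toV _ T]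
theorem KTel.vsub_toV : {G G' Δ : List Arity} → (ρ : Ren G G') → (Θ : KTel ar G Δ) →
    Θ.vsub (ρ.toV ar) = Θ.ren ρ
  | _, _, _, ρ, .nil => by simp only [KTel.vsub_nil, KTel.ren]
  | _, _, _, ρ, .snoc Θ K => by
    simp only [KTel.vsub_snoc, KTel.ren, VSub.lift_toV, KTel.vsub_toV ρ Θ, KKind.vsub_toV _ K]
end

mutual
theorem KObj.vsub_ren : {G G' G'' : List Arity} → (ρ : Ren G G') → (σ : VSub ar G' G'') →
    (M : KObj ar G) → (M.ren ρ).vsub σ = M.vsub (σ.preren ρ)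
  | _, _, _, ρ, σ, .var x F => by
    simp only [KObj.vsub_var, KObj.ren, VSub.preren]; congr 1; funext β y
    exact KAbs.vsub_ren _ _ _
  | _, _, _, ρ, σ, .const c F => by
    simp only [KObj.vsub_const, KObj.ren]; congr 1; funext β y; exact KAbs.vsub_ren _ _ _
theorem KAbs.vsub_ren : {G G' G'' : List Arity} → {α : Arity} → (ρ : Ren G G') →
    (σ : VSub ar G' G'') → (F : KAbs ar G α) → (F.ren ρ).vsub σ = F.vsub (σ.preren ρ)
  | _, _, _, _, ρ, σ, .mk Δ M => by
    simp only [KAbs.vsub_mk, KAbs.ren, VSub.lift_preren, KTel.vsub_ren ρ σ Δ,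
      KObj.vsub_ren _ _ M]
theorem KBase.vsub_ren : {G G' G'' : List Arity} → (ρ : Ren G G') → (σ : VSub ar G' G'') →
    (T : KBase ar G) → (T.ren ρ).vsub σ = T.vsub (σ.preren ρ)
  | _, _, _, ρ, σ, .type => by simp only [KBase.vsub_type, KBase.ren]
  | _, _, _, ρ, σ, .el A => by simp only [KBase.vsub_el, KBase.ren, KObj.vsub_ren ρ σ A]
theorem KKind.vsub_ren : {G G' G'' : List Arity} → {α : Arity} → (ρ : Ren G G') →
    (σ : VSub ar G' G'') → (K : KKind ar G α) → (K.ren ρ).vsub σ = K.vsub (σ.preren ρ)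
  | _, _, _, _, ρ, σ, .mk Δ T => by
    simp only [KKind.vsub_mk, KKind.ren, VSub.lift_preren, KTel.vsub_ren ρ σ Δ,
      KBase.vsub_ren _ _ T]
theorem KTel.vsub_ren : {G G' G'' Δ : List Arity} → (ρ : Ren G G') → (σ : VSub ar G' G'') →
    (Θ : KTel ar G Δ) → (Θ.ren ρ).vsub σ = Θ.vsub (σ.preren ρ)
  | _, _, _, _, ρ, σ, .nil => by simp only [KTel.vsub_nil, KTel.ren]
  | _, _, _, _, ρ, σ, .snoc Θ K => by
    simp only [KTel.vsub_snoc, KTel.ren, VSub.lift_preren, KTel.vsub_ren ρ σ Θ,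
      KKind.vsub_ren _ _ K]
end

theorem Arity.orderList_args (α : Arity) : orderList α.args = α.order := by
  cases α; rw [Arity.order]; rfl

/-- All abstractions in `σ` have arities of order `< b`. -/
def VSub.Bounded (b : ℕ) {G G' : List Arity} (σ : VSub ar G G') : Prop :=
  ∀ α x F, σ α x = .abs F → α.order < b

theorem VSub.Bounded.lift {b : ℕ} {G G' : List Arity} {σ : VSub ar G G'} (h : σ.Bounded b)
    (Δ : List Arity) : (σ.lift Δ).Bounded b := by
  induction Δ with
  | nil => exact h
  | cons β Δ ih =>
    intro α x F hx
    cases x with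
    | zero => cases hx
    | succ x =>
      simp only [VSub.lift, VSub.lift1] at hx
      cases hv : σ.lift Δ α x with
      | var y => rw [hv] at hx; cases hx
      | abs P => exact ih α x P hv

theorem VSub.bounded {G G' : List Arity} (σ : VSub ar G G') : σ.Bounded (orderList G) :=
  fun _ x _ _ => x.order_lt_orderList

theorem VSub.ext_bounded {b : ℕ} {G G' Δ : List Arity} (h : VSub ar Δ G') (σ : VSub ar G G')
    (hb : orderList Δ ≤ b) (hσ : σ.Bounded b) : (h.ext σ).Bounded b := by
  induction Δ with
  | nil => exact hσ
  | cons β Δ ih =>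
    intro α x F hx
    rw [orderList] at hb
    cases x with
    | zero => omega
    | succ x => exact ih _ (by omega) α x F hx

theorem VSub.block_bounded {b : ℕ} {G Δ : List Arity} (h : VSub ar Δ G) (hb : orderList Δ ≤ b) :
    h.block.Bounded b :=
  VSub.ext_bounded _ _ hb fun _ _ _ hx => by cases hx

theorem VSub.ext_preren {G G' G'' Δ : List Arity} (h : VSub ar Δ G'') (σ : VSub ar G' G'')
    (ρ : Ren G G') : (h.ext σ).preren (ρ.lift Δ) = h.ext (σ.preren ρ) := by
  induction Δ with
  | nil => rfl
  | cons β Δ ih =>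
    funext α x
    cases x with
    | zero => rfl
    | succ x => exact congrFun (congrFun (ih fun β y => h β (.succ y)) α) x

theorem VSub.ext_ren {G G' G'' Δ : List Arity} (h : VSub ar Δ G') (σ : VSub ar G G')
    (ρ : Ren G' G'') : (h.ext σ).ren ρ = VSub.ext (h.ren ρ) (σ.ren ρ) := by
  induction Δ with
  | nil => rfl
  | cons β Δ ih =>
    funext α x
    cases x with
    | zero => rfl
    | succ x => exact congrFun (congrFun (ih fun β y => h β (.succ y)) α) x

theorem VSub.block_ren {G G' Δ : List Arity} (h : VSub ar Δ G) (ρ : Ren G G') :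
    h.block.ren ρ = (VSub.block (h.ren ρ)).preren (ρ.lift Δ) := by
  rw [VSub.block, VSub.block, VSub.ext_ren, VSub.ext_preren]; rfl

theorem KAbs.body_ren {G G' : List Arity} {α : Arity} (ρ : Ren G G') (F : KAbs ar G α) :
    (F.ren ρ).body = F.body.ren (ρ.lift α.args) := by
  cases F; simp only [KAbs.ren, KAbs.body]

theorem KAbs.body_vsub {G G' : List Arity} {α : Arity} (σ : VSub ar G G') (F : KAbs ar G α) :
    (F.vsub σ).body = F.body.vsub (σ.lift α.args) := by
  cases F; simp only [KAbs.vsub_mk, KAbs.body]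

/-- Employment of abstractions of order `< b` commutes with renaming. -/
def AppRen (ar : C → Arity) (b : ℕ) : Prop :=
  ∀ {G G' : List Arity} {α : Arity} (ρ : Ren G G') (P : KAbs ar G α) (F : KArgs ar G α.args),
    α.order < b → ((Val.abs P).app F).ren ρ = (Val.abs (P.ren ρ)).app fun β y => (F β y).ren ρ

-- Structural induction settles everything except a head variable that is replaced by an
-- abstraction; that case is exactly `AppRen` at the bound of `σ`, which does not grow under
-- binders.
mutual
theorem KObj.ren_vsub_aux : {b : ℕ} → AppRen ar b → {G G' G'' : List Arity} → (σ : VSub ar G G') →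
    σ.Bounded b → (ρ : Ren G' G'') → (M : KObj ar G) → (M.vsub σ).ren ρ = M.vsub (σ.ren ρ)
  | _, hb, _, _, _, σ, h, ρ, .var (α := α) x F => by
    have hF : (fun β (y : Var α.args β) => ((F β y).vsub σ).ren ρ) =
        fun β y => (F β y).vsub (σ.ren ρ) := by
      funext β y; exact KAbs.ren_vsub_aux hb σ h ρ _
    simp only [KObj.vsub_var, VSub.ren] at hF ⊢
    cases hx : σ _ x with
    | var y => simp only [Val.app, Val.ren, KObj.ren, hF]
    | abs P => rw [hb ρ P _ (h _ _ _ hx), hF]; rfl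
  | _, hb, _, _, _, σ, h, ρ, .const c F => by
    simp only [KObj.vsub_const, KObj.ren]; congr 1; funext β y
    exact KAbs.ren_vsub_aux hb σ h ρ _
theorem KAbs.ren_vsub_aux : {b : ℕ} → AppRen ar b → {G G' G'' : List Arity} → {α : Arity} →
    (σ : VSub ar G G') → σ.Bounded b → (ρ : Ren G' G'') → (F : KAbs ar G α) →
    (F.vsub σ).ren ρ = F.vsub (σ.ren ρ)
  | _, hb, _, _, _, _, σ, h, ρ, .mk Δ M => by
    simp only [KAbs.vsub_mk, KAbs.ren, VSub.lift_ren, KTel.ren_vsub_aux hb σ h ρ Δ,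
      KObj.ren_vsub_aux hb _ (h.lift _) _ M]
theorem KBase.ren_vsub_aux : {b : ℕ} → AppRen ar b → {G G' G'' : List Arity} → (σ : VSub ar G G') →
    σ.Bounded b → (ρ : Ren G' G'') → (T : KBase ar G) → (T.vsub σ).ren ρ = T.vsub (σ.ren ρ)
  | _, hb, _, _, _, σ, h, ρ, .type => by simp only [KBase.vsub_type, KBase.ren]
  | _, hb, _, _, _, σ, h, ρ, .el A => by
    simp only [KBase.vsub_el, KBase.ren, KObj.ren_vsub_aux hb σ h ρ A]
theorem KKind.ren_vsub_aux : {b : ℕ} → AppRen ar b → {G G' G'' : List Arity} → {α : Arity} →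
    (σ : VSub ar G G') → σ.Bounded b → (ρ : Ren G' G'') → (K : KKind ar G α) →
    (K.vsub σ).ren ρ = K.vsub (σ.ren ρ)
  | _, hb, _, _, _, _, σ, h, ρ, .mk Δ T => by
    simp only [KKind.vsub_mk, KKind.ren, VSub.lift_ren, KTel.ren_vsub_aux hb σ h ρ Δ,
      KBase.ren_vsub_aux hb _ (h.lift _) _ T]
theorem KTel.ren_vsub_aux : {b : ℕ} → AppRen ar b → {G G' G'' Δ : List Arity} →
    (σ : VSub ar G G') → σ.Bounded b → (ρ : Ren G' G'') → (Θ : KTel ar G Δ) →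
    (Θ.vsub σ).ren ρ = Θ.vsub (σ.ren ρ)
  | _, hb, _, _, _, _, σ, h, ρ, .nil => by simp only [KTel.vsub_nil, KTel.ren]
  | _, hb, _, _, _, _, σ, h, ρ, .snoc Θ K => by
    simp only [KTel.vsub_snoc, KTel.ren, VSub.lift_ren, KTel.ren_vsub_aux hb σ h ρ Θ,
      KKind.ren_vsub_aux hb _ (h.lift _) _ K]
end

/-- Employing an abstraction of order at most `b` instantiates its own bound variables, whose orders
are below `b`, so the structural lemma at `b` applies to the body. -/
theorem appRen (b : ℕ) : AppRen ar b := by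
  induction b with
  | zero => intro G G' α ρ P F h; exact absurd h (Nat.not_lt_zero _)
  | succ b ih =>
    intro G G' α ρ P F h
    have hl : orderList α.args ≤ b := by rw [α.orderList_args]; omega
    simp only [Val.app]
    rw [KObj.ren_vsub_aux ih _ (VSub.block_bounded _ hl), VSub.block_ren, KAbs.body_ren,
      KObj.vsub_ren]
    rfl

theorem KAbs.ren_vsub {G G' G'' : List Arity} {α : Arity} (σ : VSub ar G G') (ρ : Ren G' G'')
    (F : KAbs ar G α) : (F.vsub σ).ren ρ = F.vsub (σ.ren ρ) :=
  KAbs.ren_vsub_aux (appRen _) σ σ.bounded ρ F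
theorem KKind.ren_vsub {G G' G'' : List Arity} {α : Arity} (σ : VSub ar G G') (ρ : Ren G' G'')
    (K : KKind ar G α) : (K.vsub σ).ren ρ = K.vsub (σ.ren ρ) :=
  KKind.ren_vsub_aux (appRen _) σ σ.bounded ρ K
/-! ## Composition of instantiations -/

def Val.vsub {G G' : List Arity} {α : Arity} (τ : VSub ar G G') : Val ar G α → Val ar G' α
  | .var x => τ _ x
  | .abs F => .abs (F.vsub τ)

def VSub.comp {Δ G G' : List Arity} (σ : VSub ar Δ G) (τ : VSub ar G G') : VSub ar Δ G' :=
  fun α x => (σ α x).vsub τ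

theorem Val.vsub_ren {G G' G'' : List Arity} {α : Arity} (ρ : Ren G G') (τ : VSub ar G' G'')
    (v : Val ar G α) : (v.ren ρ).vsub τ = v.vsub (τ.preren ρ) := by
  cases v with
  | var x => rfl
  | abs F => simp only [Val.ren, Val.vsub, KAbs.vsub_ren]

theorem Val.ren_vsub {G G' G'' : List Arity} {α : Arity} (σ : VSub ar G G') (ρ : Ren G' G'')
    (v : Val ar G α) : (v.vsub σ).ren ρ = v.vsub (σ.ren ρ) := by
  cases v with
  | var x => rfl
  | abs F => simp only [Val.ren, Val.vsub, KAbs.ren_vsub]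

theorem VSub.lift_comp {G G' G'' : List Arity} (σ : VSub ar G G') (τ : VSub ar G' G'')
    (Δ : List Arity) : (σ.comp τ).lift Δ = (σ.lift Δ).comp (τ.lift Δ) := by
  induction Δ with
  | nil => rfl
  | cons β Δ ih =>
    funext α x
    cases x with
    | zero => rfl
    | succ x => simp only [VSub.lift, VSub.lift1, ih, VSub.comp, Val.vsub_ren, Val.ren_vsub]; rfl

theorem VSub.ext_comp {G G' G'' Δ : List Arity} (h : VSub ar Δ G') (σ : VSub ar G G')
    (τ : VSub ar G' G'') : (h.ext σ).comp τ = VSub.ext (h.comp τ) (σ.comp τ) := by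
  induction Δ with
  | nil => rfl
  | cons β Δ ih =>
    funext α x
    cases x with
    | zero => rfl
    | succ x => exact congrFun (congrFun (ih fun β y => h β (.succ y)) α) x

theorem KAbs.vsub_id {G : List Arity} {α : Arity} (F : KAbs ar G α) :
    F.vsub (Ren.toV ar (Ren.id G)) = F := by rw [KAbs.vsub_toV, KAbs.ren_id]

theorem Val.vsub_id {G : List Arity} {α : Arity} (v : Val ar G α) :
    v.vsub (Ren.toV ar (Ren.id G)) = v := by
  cases v with
  | var x => rfl
  | abs F => simp only [Val.vsub, KAbs.vsub_id]

theorem VSub.lift_comp_ext {G G' G'' Δ : List Arity} (σ : VSub ar G G') (h : VSub ar Δ G'')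
    (τ : VSub ar G' G'') : (σ.lift Δ).comp (h.ext τ) = h.ext (σ.comp τ) := by
  induction Δ with
  | nil => rfl
  | cons β Δ ih =>
    funext α x
    cases x with
    | zero => rfl
    | succ x =>
      simp only [VSub.lift, VSub.lift1, VSub.comp, Val.vsub_ren]
      exact congrFun (congrFun (ih fun β y => h β (.succ y)) α) x

theorem VSub.comp_id {Δ G : List Arity} (σ : VSub ar Δ G) :
    σ.comp (Ren.toV ar (Ren.id G)) = σ := by
  funext α x; exact Val.vsub_id _

/-- The interchange law: in both composites a variable of `Δ` goes to its value instantiated by `τ`,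
and every other variable goes to its image under `τ`. -/
theorem VSub.block_comp {G G' Δ : List Arity} (h : VSub ar Δ G) (τ : VSub ar G G') :
    h.block.comp τ = (τ.lift Δ).comp (VSub.block (h.comp τ)) := by
  rw [VSub.block, VSub.block, VSub.ext_comp, VSub.lift_comp_ext, VSub.comp_id]; rfl

/-- `b` bounds the employed abstraction and `b'` the instantiation that follows. They are kept apart
because the induction exchanges their roles. -/
def AppSub (ar : C → Arity) (b b' : ℕ) : Prop :=
  ∀ {G G' : List Arity} {α : Arity} (τ : VSub ar G G') (P : KAbs ar G α) (F : KArgs ar G α.args),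
    α.order < b → τ.Bounded b' →
      ((Val.abs P).app F).vsub τ = (Val.abs (P.vsub τ)).app fun β y => (F β y).vsub τ

mutual
theorem KObj.vsub_vsub_aux : {b b' : ℕ} → AppSub ar b b' → {G G' G'' : List Arity} →
    (σ : VSub ar G G') → σ.Bounded b → (τ : VSub ar G' G'') → τ.Bounded b' → (M : KObj ar G) →
    (M.vsub σ).vsub τ = M.vsub (σ.comp τ)
  | _, _, hb, _, _, _, σ, h, τ, h', .var (α := α) x F => by
    have hF : (fun β (y : Var α.args β) => ((F β y).vsub σ).vsub τ) =
        fun β y => (F β y).vsub (σ.comp τ) := by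
      funext β y; exact KAbs.vsub_vsub_aux hb σ h τ h' _
    simp only [KObj.vsub_var, VSub.comp] at hF ⊢
    cases hx : σ _ x with
    | var y => simp only [Val.app, Val.vsub, KObj.vsub_var, hF]
    | abs P => rw [hb τ P _ (h _ _ _ hx) h', hF]; rfl
  | _, _, hb, _, _, _, σ, h, τ, h', .const c F => by
    simp only [KObj.vsub_const]; congr 1; funext β y
    exact KAbs.vsub_vsub_aux hb σ h τ h' _
theorem KAbs.vsub_vsub_aux : {b b' : ℕ} → AppSub ar b b' → {G G' G'' : List Arity} → {α : Arity} →
    (σ : VSub ar G G') → σ.Bounded b → (τ : VSub ar G' G'') → τ.Bounded b' → (F : KAbs ar G α) →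
    (F.vsub σ).vsub τ = F.vsub (σ.comp τ)
  | _, _, hb, _, _, _, _, σ, h, τ, h', .mk Δ M => by
    simp only [KAbs.vsub_mk, VSub.lift_comp, KTel.vsub_vsub_aux hb σ h τ h' Δ,
      KObj.vsub_vsub_aux hb _ (h.lift _) _ (h'.lift _) M]
theorem KBase.vsub_vsub_aux : {b b' : ℕ} → AppSub ar b b' → {G G' G'' : List Arity} →
    (σ : VSub ar G G') → σ.Bounded b → (τ : VSub ar G' G'') → τ.Bounded b' → (T : KBase ar G) →
    (T.vsub σ).vsub τ = T.vsub (σ.comp τ)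
  | _, _, hb, _, _, _, σ, h, τ, h', .type => by simp only [KBase.vsub_type]
  | _, _, hb, _, _, _, σ, h, τ, h', .el A => by
    simp only [KBase.vsub_el, KObj.vsub_vsub_aux hb σ h τ h' A]
theorem KKind.vsub_vsub_aux : {b b' : ℕ} → AppSub ar b b' → {G G' G'' : List Arity} →
    {α : Arity} → (σ : VSub ar G G') → σ.Bounded b → (τ : VSub ar G' G'') → τ.Bounded b' →
    (K : KKind ar G α) → (K.vsub σ).vsub τ = K.vsub (σ.comp τ)
  | _, _, hb, _, _, _, _, σ, h, τ, h', .mk Δ T => by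
    simp only [KKind.vsub_mk, VSub.lift_comp, KTel.vsub_vsub_aux hb σ h τ h' Δ,
      KBase.vsub_vsub_aux hb _ (h.lift _) _ (h'.lift _) T]
theorem KTel.vsub_vsub_aux : {b b' : ℕ} → AppSub ar b b' → {G G' G'' Δ : List Arity} →
    (σ : VSub ar G G') → σ.Bounded b → (τ : VSub ar G' G'') → τ.Bounded b' →
    (Θ : KTel ar G Δ) → (Θ.vsub σ).vsub τ = Θ.vsub (σ.comp τ)
  | _, _, hb, _, _, _, _, σ, h, τ, h', .nil => by simp only [KTel.vsub_nil]
  | _, _, hb, _, _, _, _, σ, h, τ, h', .snoc Θ K => by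
    simp only [KTel.vsub_snoc, VSub.lift_comp, KTel.vsub_vsub_aux hb σ h τ h' Θ,
      KKind.vsub_vsub_aux hb _ (h.lift _) _ (h'.lift _) K]
end

/-- Commuting `τ` past an employment requires composing the block with `τ` on one side, and `τ` with
a block on the other. Both pairs of bounds have the sum `α.order + b'`, which is less than `b + b'`;
hence the induction on the sum. -/
theorem appSub (n : ℕ) : ∀ b b' : ℕ, b + b' = n → AppSub ar b b' := by
  induction n using Nat.strong_induction_on with
  | _ n ih =>
    intro b b' hn G G' α τ P F h hτ
    rw [← α.orderList_args] at h
    simp only [Val.app]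
    rw [KObj.vsub_vsub_aux (ih (orderList α.args + b') (by omega) _ _ rfl) _
      (VSub.block_bounded _ le_rfl) τ hτ, VSub.block_comp, KAbs.body_vsub,
      KObj.vsub_vsub_aux (ih (b' + orderList α.args) (by omega) _ _ rfl) _
      (hτ.lift _) _ (VSub.block_bounded _ le_rfl)]
    rfl

theorem KKind.vsub_vsub {G G' G'' : List Arity} {α : Arity} (σ : VSub ar G G')
    (τ : VSub ar G' G'') (K : KKind ar G α) : (K.vsub σ).vsub τ = K.vsub (σ.comp τ) :=
  KKind.vsub_vsub_aux (appSub _ _ _ rfl) σ σ.bounded τ τ.bounded K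
theorem Val.app_vsub {G G' : List Arity} {α : Arity} (τ : VSub ar G G') (v : Val ar G α)
    (F : KArgs ar G α.args) : (v.app F).vsub τ = (v.vsub τ).app fun β y => (F β y).vsub τ := by
  cases v with
  | var x => exact KObj.vsub_var _ _ _
  | abs P => exact appSub _ _ _ rfl τ P F (Nat.lt_succ_self _) τ.bounded

/-! ## Evaluation of `TF`-expressions in `TFₖ` -/

section Evaluation

variable (ar) in
/-- A kind, from which the labels of arguments are computed, and a value. -/
structure EVal (G : List Arity) (α : Arity) : Type u where
  kind : KKind ar G α
  val : Val ar G α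

variable (ar) in
abbrev Env (G G₀ : List Arity) : Type u := ∀ α, Var G α → EVal ar G₀ α

def EVal.ren {G G' : List Arity} {α : Arity} (ρ : Ren G G') (v : EVal ar G α) : EVal ar G' α :=
  ⟨v.kind.ren ρ, v.val.ren ρ⟩

def EVal.vsub {G G' : List Arity} {α : Arity} (σ : VSub ar G G') (v : EVal ar G α) :
    EVal ar G' α :=
  ⟨v.kind.vsub σ, v.val.vsub σ⟩

def Env.ren {G G₀ G₁ : List Arity} (ρ : Ren G₀ G₁) (e : Env ar G G₀) : Env ar G G₁ :=
  fun _ x => (e _ x).ren ρ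

def Env.vsub {G G₀ G₁ : List Arity} (σ : VSub ar G₀ G₁) (e : Env ar G G₀) : Env ar G G₁ :=
  fun _ x => (e _ x).vsub σ

def Env.preren {G G' G₀ : List Arity} (ρ : Ren G G') (e : Env ar G' G₀) : Env ar G G₀ :=
  fun _ x => e _ (ρ _ x)

/-- An environment carried under the binding of variables with kinds `Θ`. -/
def Env.up {G G₀ : List Arity} (e : Env ar G G₀) :
    {Δ : List Arity} → KTel ar G₀ Δ → Env ar (Δ ++ G) (Δ ++ G₀)
  | _, .nil => e
  | _, .snoc Θ K => fun _ x => match x with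
    | .zero => ⟨K.ren (Ren.wk1 _), .var .zero⟩
    | .succ x => (Env.up e Θ _ x).ren (Ren.wk1 _)

/-- An environment extended by values of kinds `Θ`. -/
def Env.ext {G G₀ : List Arity} (e : Env ar G G₀) :
    {Δ : List Arity} → KTel ar G₀ Δ → VSub ar Δ G₀ → Env ar (Δ ++ G) G₀
  | _, .nil, _ => e
  | _, .snoc Θ K, h => fun _ x => match x with
    | .zero => ⟨K.vsub (VSub.block fun β y => h β (.succ y)), h _ .zero⟩
    | .succ x => Env.ext e Θ (fun β y => h β (.succ y)) _ x

/-- The arguments whose labels are computed from the kinds `Θ`, and whose bodies are given as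
functions of the labels. -/
def labArgs {G₀ : List Arity} : {Δ : List Arity} → KTel ar G₀ Δ →
    (∀ β, Var Δ β → KTel ar G₀ β.args → KObj ar (β.args ++ G₀)) → KArgs ar G₀ Δ
  | _, .nil, _ => fun _ y => nomatch y
  | _, .snoc Θ K, f => fun _ y => match y with
    | .zero =>
      .mk (K.vsub (KArgs.toV (labArgs Θ fun β y => f β (.succ y))).block).tel
        (f _ .zero (K.vsub (KArgs.toV (labArgs Θ fun β y => f β (.succ y))).block).tel)
    | .succ y => labArgs Θ (fun β y => f β (.succ y)) _ y

variable (κ : ∀ c, KKind ar [] (ar c))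

/-- The value of an object, given kinds for the constants. -/
def Obj.ev : {G : List Arity} → Obj ar G → {G₀ : List Arity} → Env ar G G₀ → KObj ar G₀
  | _, .var x F, _, e =>
    (e _ x).val.app (labArgs (e _ x).kind.tel fun β y Θ => (F β y).ev (e.up Θ))
  | _, .const c F, G₀, e =>
    .const c (labArgs ((κ c).ren (Ren.empty G₀)).tel fun β y Θ => (F β y).ev (e.up Θ))

def Base.ev {G G₀ : List Arity} (T : Base ar G) (e : Env ar G G₀) : KBase ar G₀ :=
  match T with
  | .type => .type
  | .el A => .el (A.ev κ e)

mutual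
def Kind.ev : {G : List Arity} → {α : Arity} → Kind ar G α → {G₀ : List Arity} → Env ar G G₀ →
    KKind ar G₀ α
  | _, _, .mk Δ T, _, e => .mk (Tel.ev Δ e) (T.ev κ (e.up (Tel.ev Δ e)))
def Tel.ev : {G Δ : List Arity} → Tel ar G Δ → {G₀ : List Arity} → Env ar G G₀ → KTel ar G₀ Δ
  | _, _, .nil, _, _ => .nil
  | _, _, .snoc Θ K, _, e => .snoc (Tel.ev Θ e) (Kind.ev K (e.up (Tel.ev Θ e)))
end

/-- The arguments of a symbol whose arguments have kinds `Θ`. -/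
def Args.ev {G G₀ Δ : List Arity} (F : Args ar G Δ) (e : Env ar G G₀) (Θ : KTel ar G₀ Δ) :
    KArgs ar G₀ Δ :=
  labArgs Θ fun β y Ξ => (F β y).ev κ (e.up Ξ)

variable {κ}

theorem Obj.ev_var {G G₀ : List Arity} {α : Arity} (x : Var G α) (F : Args ar G α.args)
    (e : Env ar G G₀) :
    (Obj.var x F).ev κ e = (e _ x).val.app (F.ev κ e (e _ x).kind.tel) := by
  rw [Obj.ev]; rfl

theorem Obj.ev_const {G G₀ : List Arity} (c : C) (F : Args ar G (ar c).args)
    (e : Env ar G G₀) :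
    (Obj.const c F).ev κ e = .const c (F.ev κ e ((κ c).ren (Ren.empty G₀)).tel) := by
  rw [Obj.ev]; rfl

theorem Kind.tel_ev {G G₀ : List Arity} {α : Arity} (K : Kind ar G α) (e : Env ar G G₀) :
    (K.ev κ e).tel = K.tel.ev κ e := by
  cases K; simp only [Kind.ev, KKind.tel, Kind.tel]

theorem Kind.base_ev {G G₀ : List Arity} {α : Arity} (K : Kind ar G α) (e : Env ar G G₀) :
    (K.ev κ e).base = K.base.ev κ (e.up (K.tel.ev κ e)) := by
  cases K; simp only [Kind.ev, KKind.base, Kind.base, Kind.tel]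

theorem KKind.tel_vsub {G G' : List Arity} {α : Arity} (σ : VSub ar G G') (K : KKind ar G α) :
    (K.vsub σ).tel = K.tel.vsub σ := by
  cases K; simp only [KKind.vsub_mk, KKind.tel]

theorem KKind.tel_ren {G G' : List Arity} {α : Arity} (ρ : Ren G G') (K : KKind ar G α) :
    (K.ren ρ).tel = K.tel.ren ρ := by
  cases K; simp only [KKind.ren, KKind.tel]

theorem KKind.base_ren {G G' : List Arity} {α : Arity} (ρ : Ren G G') (K : KKind ar G α) :
    (K.ren ρ).base = K.base.ren (ρ.lift α.args) := by
  cases K; simp only [KKind.ren, KKind.base]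

/-! ### Instantiation of the result -/

theorem EVal.vsub_ren {G G' G'' : List Arity} {α : Arity} (ρ : Ren G G') (τ : VSub ar G' G'')
    (v : EVal ar G α) : (v.ren ρ).vsub τ = v.vsub (τ.preren ρ) := by
  simp only [EVal.vsub, EVal.ren, KKind.vsub_ren, Val.vsub_ren]

theorem EVal.ren_vsub {G G' G'' : List Arity} {α : Arity} (σ : VSub ar G G') (ρ : Ren G' G'')
    (v : EVal ar G α) : (v.vsub σ).ren ρ = v.vsub (σ.ren ρ) := by
  simp only [EVal.vsub, EVal.ren, KKind.ren_vsub, Val.ren_vsub]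

theorem EVal.vsub_toV {G G' : List Arity} {α : Arity} (ρ : Ren G G') (v : EVal ar G α) :
    v.vsub (ρ.toV ar) = v.ren ρ := by
  simp only [EVal.vsub, EVal.ren, KKind.vsub_toV]
  congr 1
  cases v.val with
  | var x => rfl
  | abs F => simp only [Val.vsub, Val.ren, KAbs.vsub_toV]

theorem Env.vsub_toV {G G₀ G₁ : List Arity} (ρ : Ren G₀ G₁) (e : Env ar G G₀) :
    e.vsub (ρ.toV ar) = e.ren ρ := by
  funext α x; exact EVal.vsub_toV _ _

theorem Env.up_vsub {G G₀ G₁ Δ : List Arity} (e : Env ar G G₀) (Θ : KTel ar G₀ Δ)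
    (σ : VSub ar G₀ G₁) : (e.up Θ).vsub (σ.lift Δ) = (e.vsub σ).up (Θ.vsub σ) := by
  induction Δ with
  | nil => cases Θ; rfl
  | cons β Δ ih =>
    cases Θ with
    | snoc Θ K =>
      funext α x
      rw [KTel.vsub_snoc]
      cases x with
      | zero =>
        simp only [Env.up, Env.vsub, EVal.vsub, KKind.vsub_ren, KKind.ren_vsub]
        rfl
      | succ x =>
        simp only [Env.up, Env.vsub, ← ih, EVal.vsub_ren, EVal.ren_vsub]
        rfl

/-- Going under a binder and then instantiating the bound variables amounts to recording their
values in the environment. This turns the employment of an evaluated abstraction into an evaluation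
of its body. -/
theorem Env.up_vsub_ext {G G₀ G₁ Δ : List Arity} (e : Env ar G G₀) (Θ : KTel ar G₀ Δ)
    (σ : VSub ar G₀ G₁) (h : VSub ar Δ G₁) :
    (e.up Θ).vsub (h.ext σ) = (e.vsub σ).ext (Θ.vsub σ) h := by
  induction Δ with
  | nil => cases Θ; rfl
  | cons β Δ ih =>
    cases Θ with
    | snoc Θ K =>
      funext α x
      rw [KTel.vsub_snoc]
      cases x with
      | zero =>
        simp only [Env.up, Env.ext, Env.vsub, EVal.vsub, KKind.vsub_ren, KKind.vsub_vsub,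
          VSub.block, VSub.lift_comp_ext, VSub.comp_id]
        rfl
      | succ x =>
        simp only [Env.up, Env.ext, Env.vsub, ← ih, EVal.vsub_ren]
        rfl

theorem KArgs.toV_comp {G G' Δ : List Arity} (F : KArgs ar G Δ) (σ : VSub ar G G') :
    F.toV.comp σ = KArgs.toV fun β y => (F β y).vsub σ := rfl

theorem KKind.vsub_block_vsub {G G' Δ : List Arity} {α : Arity} (h : VSub ar Δ G)
    (σ : VSub ar G G') (K : KKind ar (Δ ++ G) α) :
    (K.vsub h.block).vsub σ = (K.vsub (σ.lift Δ)).vsub (VSub.block (h.comp σ)) := by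
  rw [KKind.vsub_vsub, KKind.vsub_vsub, VSub.block_comp]

/-- The induction runs along the sequence since each label is an instance of a kind by the earlier
arguments, so those must be known to commute with `σ` first. -/
theorem labArgs_vsub {G₀ G₁ Δ : List Arity} (σ : VSub ar G₀ G₁) (Θ : KTel ar G₀ Δ)
    (f : ∀ β, Var Δ β → KTel ar G₀ β.args → KObj ar (β.args ++ G₀))
    (f' : ∀ β, Var Δ β → KTel ar G₁ β.args → KObj ar (β.args ++ G₁))
    (h : ∀ β y Ξ, (f β y Ξ).vsub (σ.lift β.args) = f' β y (Ξ.vsub σ)) :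
    (fun β y => (labArgs Θ f β y).vsub σ) = labArgs (Θ.vsub σ) f' := by
  induction Δ with
  | nil => funext β y; cases y
  | cons α Δ ih =>
    cases Θ with
    | snoc Θ K =>
      have ih' := ih Θ (fun β y => f β (.succ y)) (fun β y => f' β (.succ y))
        fun β y Ξ => h β (.succ y) Ξ
      funext β y
      rw [KTel.vsub_snoc]
      cases y with
      | zero =>
        simp only [labArgs, KAbs.vsub_mk, h, ← KKind.tel_vsub, KKind.vsub_block_vsub,
          KArgs.toV_comp, ih']
      | succ y => exact congrFun (congrFun ih' β) y

theorem VSub.empty_eq {G : List Arity} (σ τ : VSub ar [] G) : σ = τ := by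
  funext α x; cases x

theorem KKind.vsub_empty {G G' : List Arity} {α : Arity} (σ : VSub ar G G') (K : KKind ar [] α) :
    (K.ren (Ren.empty G)).vsub σ = K.ren (Ren.empty G') := by
  rw [KKind.vsub_ren, ← KKind.vsub_toV]; congr 1; exact VSub.empty_eq _ _

/-- The labels at a variable come from the stored kind, which is instantiated together with the
environment; the labels at a constant come from a closed kind, which `σ` leaves alone. -/
theorem Obj.ev_vsub {G G₀ G₁ : List Arity} (M : Obj ar G) (e : Env ar G G₀) (σ : VSub ar G₀ G₁) :
    (M.ev κ e).vsub σ = M.ev κ (e.vsub σ) := by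
  induction M generalizing G₀ G₁ with
  | var x F ih =>
    rw [Obj.ev_var, Obj.ev_var, Val.app_vsub]
    simp only [Args.ev]
    rw [labArgs_vsub σ _ _ (fun β y Θ => (F β y).ev κ ((e.vsub σ).up Θ)), ← KKind.tel_vsub]
    · rfl
    · intro β y Ξ
      simp only [ih, Env.up_vsub]
  | const c F ih =>
    rw [Obj.ev_const, Obj.ev_const, KObj.vsub_const]
    simp only [Args.ev]
    rw [labArgs_vsub σ _ _ (fun β y Θ => (F β y).ev κ ((e.vsub σ).up Θ)), ← KKind.tel_vsub,
      KKind.vsub_empty]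
    · intro β y Ξ
      simp only [ih, Env.up_vsub]

theorem Base.ev_vsub {G G₀ G₁ : List Arity} (T : Base ar G) (e : Env ar G G₀)
    (σ : VSub ar G₀ G₁) : (T.ev κ e).vsub σ = T.ev κ (e.vsub σ) := by
  cases T with
  | type => exact KBase.vsub_type _
  | el A => simp only [Base.ev, KBase.vsub_el, Obj.ev_vsub]

mutual
theorem Kind.ev_vsub : {G G₀ G₁ : List Arity} → {α : Arity} → (K : Kind ar G α) →
    (e : Env ar G G₀) → (σ : VSub ar G₀ G₁) → (K.ev κ e).vsub σ = K.ev κ (e.vsub σ)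
  | _, _, _, _, .mk Δ T, e, σ => by
    simp only [Kind.ev, KKind.vsub_mk, Base.ev_vsub, Env.up_vsub, Tel.ev_vsub Δ]
theorem Tel.ev_vsub : {G G₀ G₁ Δ : List Arity} → (Θ : Tel ar G Δ) → (e : Env ar G G₀) →
    (σ : VSub ar G₀ G₁) → (Θ.ev κ e).vsub σ = Θ.ev κ (e.vsub σ)
  | _, _, _, _, .nil, e, σ => by simp only [Tel.ev, KTel.vsub_nil]
  | _, _, _, _, .snoc Θ K, e, σ => by
    simp only [Tel.ev, KTel.vsub_snoc, Kind.ev_vsub K, Env.up_vsub, Tel.ev_vsub Θ]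
end

theorem Obj.ev_ren {G G₀ G₁ : List Arity} (M : Obj ar G) (e : Env ar G G₀) (ρ : Ren G₀ G₁) :
    (M.ev κ e).ren ρ = M.ev κ (e.ren ρ) := by
  rw [← KObj.vsub_toV, Obj.ev_vsub, Env.vsub_toV]
theorem Base.ev_ren {G G₀ G₁ : List Arity} (T : Base ar G) (e : Env ar G G₀) (ρ : Ren G₀ G₁) :
    (T.ev κ e).ren ρ = T.ev κ (e.ren ρ) := by
  rw [← KBase.vsub_toV, Base.ev_vsub, Env.vsub_toV]
theorem Kind.ev_ren {G G₀ G₁ : List Arity} {α : Arity} (K : Kind ar G α) (e : Env ar G G₀)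
    (ρ : Ren G₀ G₁) : (K.ev κ e).ren ρ = K.ev κ (e.ren ρ) := by
  rw [← KKind.vsub_toV, Kind.ev_vsub, Env.vsub_toV]
theorem Tel.ev_ren {G G₀ G₁ Δ : List Arity} (Θ : Tel ar G Δ) (e : Env ar G G₀)
    (ρ : Ren G₀ G₁) : (Θ.ev κ e).ren ρ = Θ.ev κ (e.ren ρ) := by
  rw [← KTel.vsub_toV, Tel.ev_vsub, Env.vsub_toV]

theorem Env.up_ren {G G₀ G₁ Δ : List Arity} (e : Env ar G G₀) (Θ : KTel ar G₀ Δ)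
    (ρ : Ren G₀ G₁) : (e.up Θ).ren (ρ.lift Δ) = (e.ren ρ).up (Θ.ren ρ) := by
  rw [← Env.vsub_toV, ← VSub.lift_toV, Env.up_vsub, Env.vsub_toV, KTel.vsub_toV]

/-! ### Renaming and instantiation of the argument -/

theorem Env.up_preren {G G' G₀ Δ : List Arity} (ρ : Ren G G') (e : Env ar G' G₀)
    (Θ : KTel ar G₀ Δ) : (e.preren ρ).up Θ = (e.up Θ).preren (ρ.lift Δ) := by
  induction Δ with
  | nil => cases Θ; rfl
  | cons β Δ ih =>
    cases Θ with
    | snoc Θ K =>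
      funext α x
      cases x with
      | zero => rfl
      | succ x => simp only [Env.up, ih]; rfl

theorem Obj.ren_ev {G G' G₀ : List Arity} (ρ : Ren G G') (M : Obj ar G) (e : Env ar G' G₀) :
    (M.ren ρ).ev κ e = M.ev κ (e.preren ρ) := by
  induction M generalizing G' G₀ with
  | var x F ih => simp only [Obj.ren, Obj.ev_var, Args.ev, ih, Env.up_preren]; rfl
  | const c F ih => simp only [Obj.ren, Obj.ev_const, Args.ev, ih, Env.up_preren]

theorem Base.ren_ev {G G' G₀ : List Arity} (ρ : Ren G G') (T : Base ar G) (e : Env ar G' G₀) :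
    (T.ren ρ).ev κ e = T.ev κ (e.preren ρ) := by
  cases T with
  | type => rfl
  | el A => simp only [Base.ren, Base.ev, Obj.ren_ev]

mutual
theorem Kind.ren_ev : {G G' G₀ : List Arity} → {α : Arity} → (ρ : Ren G G') → (K : Kind ar G α) →
    (e : Env ar G' G₀) → (K.ren ρ).ev κ e = K.ev κ (e.preren ρ)
  | _, _, _, _, ρ, .mk Δ T, e => by
    simp only [Kind.ren, Kind.ev, Base.ren_ev, Tel.ren_ev ρ Δ, Env.up_preren]
theorem Tel.ren_ev : {G G' G₀ Δ : List Arity} → (ρ : Ren G G') → (Θ : Tel ar G Δ) →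
    (e : Env ar G' G₀) → (Θ.ren ρ).ev κ e = Θ.ev κ (e.preren ρ)
  | _, _, _, _, ρ, .nil, e => by simp only [Tel.ren, Tel.ev]
  | _, _, _, _, ρ, .snoc Θ K, e => by
    simp only [Tel.ren, Tel.ev, Kind.ren_ev _ K, Tel.ren_ev ρ Θ, Env.up_preren]
end

variable (κ) in
/-- `e'` is the environment `e` composed with the instantiation `σ`. -/
def Sub.Compat {b : ℕ} {G G' G₀ : List Arity} (σ : Sub ar b G G') (e : Env ar G' G₀)
    (e' : Env ar G G₀) : Prop :=
  ∀ α (x : Var G α), match σ α x with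
    | .var x' => e' α x = e α x'
    | .abs _ F => (e' α x).val = .abs (.mk (e' α x).kind.tel (F.ev κ (e.up (e' α x).kind.tel)))

theorem Sub.Compat.lift {b : ℕ} {G G' G₀ Δ : List Arity} {σ : Sub ar b G G'} {e : Env ar G' G₀}
    {e' : Env ar G G₀} (h : σ.Compat κ e e') (Θ : KTel ar G₀ Δ) :
    (σ.lift Δ).Compat κ (e.up Θ) (e'.up Θ) := by
  induction Δ with
  | nil => cases Θ; exact h
  | cons β Δ ih =>
    cases Θ with
    | snoc Θ K =>
      intro α x
      cases x with
      | zero => rfl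
      | succ x =>
        have hx := ih Θ α x
        simp only [Sub.lift, Sub.lift1]
        cases hv : σ.lift Δ α x with
        | var y =>
          rw [hv] at hx
          simp only [Entry.ren, Env.up]
          simp only at hx
          rw [hx]; rfl
        | abs hb F =>
          rw [hv] at hx
          simp only [Entry.ren]
          simp only at hx
          simp only [Env.up, EVal.ren]
          rw [hx]
          simp only [Val.ren, KAbs.ren, KKind.tel_ren, Obj.ev_ren, Obj.ren_ev, Env.up_ren]
          rw [← Env.up_preren]
          rfl

/-- `Θ` need not be related to the true kinds of `F`: compatibility only asks that the recorded
kinds and the labels on the evaluated arguments agree, and both are taken from `Θ`. -/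
theorem Sub.block_compat {b : ℕ} {G G₀ Δ : List Arity} (hb : orderList Δ ≤ b) (F : Args ar G Δ)
    (e : Env ar G G₀) (Θ : KTel ar G₀ Δ) :
    (Sub.block hb F).Compat κ e (e.ext Θ (F.ev κ e Θ).toV) := by
  induction Δ with
  | nil => cases Θ; intro α x; rfl
  | cons β Δ ih =>
    cases Θ with
    | snoc Θ K =>
      intro α x
      cases x with
      | zero => rfl
      | succ x => exact ih _ (fun β y => F β (.succ y)) Θ α x

theorem Env.vsub_id {G G₀ : List Arity} (e : Env ar G G₀) :
    e.vsub (Ren.toV ar (Ren.id G₀)) = e := by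
  funext α x
  simp only [Env.vsub, EVal.vsub, Val.vsub_id, KKind.vsub_toV, KKind.ren_id]

theorem KTel.vsub_id {G Δ : List Arity} (Θ : KTel ar G Δ) :
    Θ.vsub (Ren.toV ar (Ren.id G)) = Θ := by
  rw [KTel.vsub_toV, KTel.ren_id]

theorem Env.up_vsub_block {G G₀ Δ : List Arity} (e : Env ar G G₀) (Θ : KTel ar G₀ Δ)
    (h : VSub ar Δ G₀) : (e.up Θ).vsub h.block = e.ext Θ h := by
  rw [VSub.block, Env.up_vsub_ext, Env.vsub_id, KTel.vsub_id]

/-- `hb` is the same assertion for the employment of abstractions of order below `b`; induction on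
the bound in `employ_ev` discharges it. -/
theorem Obj.sub_ev_aux {b : ℕ}
    (hb : ∀ {G G₀ : List Arity} {α : Arity} (h : α.order < b) (P : Abs ar G α)
      (F : Args ar G α.args) (e : Env ar G G₀) (Θ : KTel ar G₀ α.args),
      (employ b h P F).ev κ e = P.ev κ (e.ext Θ (F.ev κ e Θ).toV))
    {G G' G₀ : List Arity} (M : Obj ar G) (σ : Sub ar b G G') (e : Env ar G' G₀)
    (e' : Env ar G G₀) (h : σ.Compat κ e e') : (M.sub σ).ev κ e = M.ev κ e' := by
  induction M generalizing G' G₀ with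
  | const c F ih =>
    simp only [Obj.sub, Obj.subWith, Obj.ev_const, Args.ev] at ih ⊢
    congr 2; funext β y Θ
    exact ih _ _ _ _ _ (h.lift Θ)
  | var x F ih =>
    have hx := h _ x
    simp only [Obj.sub, Obj.subWith, Obj.ev_var] at ih ⊢
    have hF : ∀ Θ : KTel ar G₀ _,
        Args.ev κ (fun β y => (F β y).subWith (employ b) (Sub.lift σ β.args)) e Θ =
          Args.ev κ F e' Θ := by
      intro Θ
      simp only [Args.ev]
      congr 1; funext β y Θ
      exact ih _ _ _ _ _ (h.lift Θ)
    cases hv : σ _ x with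
    | var y =>
      rw [hv] at hx
      simp only [Obj.ev_var] at hx ⊢
      rw [hF, hx]
    | abs hα P =>
      rw [hv] at hx
      simp only at hx ⊢
      -- By compatibility the value of `x` is `P` evaluated under the labels `(e' _ x).kind.tel`.
      -- With this telescope in `hb`, employing `P` in TF and employing its value in
      -- $\mathrm{TF}_{\mathrm k}$ are the same evaluation of `P`.
      rw [hb hα P _ e (e' _ x).kind.tel, hF, hx]
      simp only [Val.app, KAbs.body]
      rw [Obj.ev_vsub, Env.up_vsub_block]

theorem employ_ev (b : ℕ) {G G₀ : List Arity} {α : Arity} (h : α.order < b) (P : Abs ar G α)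
    (F : Args ar G α.args) (e : Env ar G G₀) (Θ : KTel ar G₀ α.args) :
    (employ b h P F).ev κ e = P.ev κ (e.ext Θ (F.ev κ e Θ).toV) := by
  induction b generalizing G G₀ α with
  | zero => exact absurd h (Nat.not_lt_zero _)
  | succ b ih =>
    cases α with
    | mk l =>
      rw [employ]
      exact Obj.sub_ev_aux ih _ _ _ _ (Sub.block_compat _ _ _ _)

theorem Obj.sub_ev {b : ℕ} {G G' G₀ : List Arity} (M : Obj ar G) {σ : Sub ar b G G'}
    {e : Env ar G' G₀} {e' : Env ar G G₀} (h : σ.Compat κ e e') : (M.sub σ).ev κ e = M.ev κ e' :=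
  Obj.sub_ev_aux (employ_ev b) M σ e e' h

theorem Base.sub_ev {b : ℕ} {G G' G₀ : List Arity} (T : Base ar G) {σ : Sub ar b G G'}
    {e : Env ar G' G₀} {e' : Env ar G G₀} (h : σ.Compat κ e e') :
    (T.sub σ).ev κ e = T.ev κ e' := by
  cases T with
  | type => rfl
  | el A => simp only [Base.sub, Base.ev, Obj.sub_ev A h]

mutual
theorem Kind.sub_ev : {b : ℕ} → {G G' G₀ : List Arity} → {α : Arity} → (K : Kind ar G α) →
    {σ : Sub ar b G G'} → {e : Env ar G' G₀} → {e' : Env ar G G₀} → σ.Compat κ e e' →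
    (K.sub σ).ev κ e = K.ev κ e'
  | _, _, _, _, _, .mk Δ T, σ, e, e', h => by
    simp only [Kind.sub, Kind.ev, Tel.sub_ev Δ h, Base.sub_ev T (h.lift _)]
theorem Tel.sub_ev : {b : ℕ} → {G G' G₀ Δ : List Arity} → (Θ : Tel ar G Δ) →
    {σ : Sub ar b G G'} → {e : Env ar G' G₀} → {e' : Env ar G G₀} → σ.Compat κ e e' →
    (Θ.sub σ).ev κ e = Θ.ev κ e'
  | _, _, _, _, _, .nil, σ, e, e', h => by simp only [Tel.sub, Tel.ev]
  | _, _, _, _, _, .snoc Θ K, σ, e, e', h => by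
    simp only [Tel.sub, Tel.ev, Tel.sub_ev Θ h, Kind.sub_ev K (h.lift _)]
end

/-- The left side does not mention `Θ`, so any telescope of the right shape may be chosen to label
the arguments. -/
theorem Obj.inst_ev {G G₀ Δ : List Arity} (F : Args ar G Δ) (M : Obj ar (Δ ++ G))
    (e : Env ar G G₀) (Θ : KTel ar G₀ Δ) :
    (M.inst F).ev κ e = M.ev κ (e.ext Θ (F.ev κ e Θ).toV) :=
  Obj.sub_ev M (Sub.block_compat _ _ _ _)
theorem Base.inst_ev {G G₀ Δ : List Arity} (F : Args ar G Δ) (T : Base ar (Δ ++ G))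
    (e : Env ar G G₀) (Θ : KTel ar G₀ Δ) :
    (T.inst F).ev κ e = T.ev κ (e.ext Θ (F.ev κ e Θ).toV) :=
  Base.sub_ev T (Sub.block_compat _ _ _ _)
theorem Kind.inst_ev {G G₀ Δ : List Arity} {α : Arity} (F : Args ar G Δ) (K : Kind ar (Δ ++ G) α)
    (e : Env ar G G₀) (Θ : KTel ar G₀ Δ) :
    (K.inst F).ev κ e = K.ev κ (e.ext Θ (F.ev κ e Θ).toV) :=
  Kind.sub_ev K (Sub.block_compat _ _ _ _)

theorem Tel.argKind_ev {G G₀ Δ : List Arity} (Θ : Tel ar G Δ) (F : Args ar G Δ) (e : Env ar G G₀)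
    (β : Arity) (y : Var Δ β) :
    (Θ.argKind F β y).ev κ e = (Θ.ev κ e).argKind (F.ev κ e (Θ.ev κ e)) β y := by
  induction Δ with
  | nil => cases y
  | cons α Δ ih =>
    cases Θ with
    | snoc Θ K =>
      simp only [Tel.ev]
      cases y with
      | zero =>
        simp only [Tel.argKind, KTel.argKind]
        rw [Kind.inst_ev _ _ _ (Θ.ev κ e), KKind.inst_eq, Kind.ev_vsub, Env.up_vsub_block]
        rfl
      | succ y => exact ih Θ (fun β y => F β (.succ y)) y

end Evaluation

/-! ## A Kripke logical relation over `TFₖ` -/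

section Semantics

variable (S : Set (KDecl ar))

/-- Equality of well-typed objects. -/
structure TypEq {G : List Arity} (Γ : KCtx ar G) (M N : KObj ar G) (T : KBase ar G) : Prop where
  left : KDer S (.typ Γ M T)
  right : KDer S (.typ Γ N T)
  eq : KDer S (.eq Γ M N T)

/-- Equality of well-formed base kinds. -/
def BaseRel {G : List Arity} (Γ : KCtx ar G) : KBase ar G → KBase ar G → Prop
  | .type, .type => True
  | .el A, .el B => TypEq S Γ A B .type
  | _, _ => False

/-- Renamings into a valid context that respect the kinds of the variables. -/
structure KRen {G G' : List Arity} (Γ : KCtx ar G) (Γ' : KCtx ar G') (ρ : Ren G G') : Prop where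
  valid : KDer S (.valid Γ')
  lookup : ∀ α x, Γ'.lookup (ρ α x) = (Γ.lookup x).ren ρ

variable (ar) in
/-- Relations on kinds of arity `α`, and on values of such a kind. -/
structure ArityRel (α : Arity) : Type u where
  kind : ∀ {G : List Arity}, KCtx ar G → KKind ar G α → KKind ar G α → Prop
  val : ∀ {G : List Arity}, KCtx ar G → KKind ar G α → Val ar G α → Val ar G α → Prop

variable (ar) in
/-- Relations on contexts of arity `Δ`, and on sequences of values of such a context. -/
structure ListRel (Δ : List Arity) : Type u where
  tel : ∀ {G : List Arity}, KCtx ar G → KTel ar G Δ → KTel ar G Δ → Prop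
  seq : ∀ {G : List Arity}, KCtx ar G → KTel ar G Δ → VSub ar Δ G → VSub ar Δ G → Prop

variable {S} in
def VSub.tail {G Δ : List Arity} {α : Arity} (h : VSub ar (α :: Δ) G) : VSub ar Δ G :=
  fun β y => h β (.succ y)

/-- Quantifying over all renamings makes the relation stable under weakening, and quantifying over
pairs of related sequences makes functionality part of it. -/
def ListRel.kindRel {α : Arity} (R : ListRel ar α.args) {G : List Arity} (Γ : KCtx ar G)
    (K K' : KKind ar G α) : Prop :=
  R.tel Γ K.tel K'.tel ∧
    ∀ {G₁ : List Arity} (Γ₁ : KCtx ar G₁) (ρ : Ren G G₁), KRen S Γ Γ₁ ρ →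
      ∀ h h', R.seq Γ₁ (K.tel.ren ρ) h h' →
        BaseRel S Γ₁ ((K.base.ren (ρ.lift α.args)).vsub h.block)
          ((K'.base.ren (ρ.lift α.args)).vsub h'.block)

/-- Variables remain values of their own and are not $\eta$-expanded: a variable is related only to
itself, at the kinds related to its declared kind. The labels of an abstraction need only be related
to the telescope of `K`. -/
def ListRel.valRel {α : Arity} (R : ListRel ar α.args) {G : List Arity} (Γ : KCtx ar G)
    (K : KKind ar G α) : Val ar G α → Val ar G α → Prop
  | .var x, .var x' => x = x' ∧ R.kindRel S Γ (Γ.lookup x) K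
  | .abs F, .abs F' => R.tel Γ F.tel K.tel ∧ R.tel Γ F'.tel K.tel ∧
    ∀ {G₁ : List Arity} (Γ₁ : KCtx ar G₁) (ρ : Ren G G₁), KRen S Γ Γ₁ ρ →
      ∀ h h', R.seq Γ₁ (K.tel.ren ρ) h h' →
        TypEq S Γ₁ ((F.body.ren (ρ.lift α.args)).vsub h.block)
          ((F'.body.ren (ρ.lift α.args)).vsub h'.block)
          ((K.base.ren (ρ.lift α.args)).vsub h.block)
  | _, _ => False

def ListRel.toArity {α : Arity} (R : ListRel ar α.args) : ArityRel ar α where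
  kind Γ K K' := R.kindRel S Γ K K'
  val Γ K v v' := R.valRel S Γ K v v'

def ListRel.cons {α : Arity} {Δ : List Arity} (A : ArityRel ar α) (R : ListRel ar Δ) :
    ListRel ar (α :: Δ) where
  tel {G} Γ Θ Θ' := match Θ, Θ' with
    | .snoc Θ K, .snoc Θ' K' => R.tel Γ Θ Θ' ∧
      ∀ {G₁ : List Arity} (Γ₁ : KCtx ar G₁) (ρ : Ren G G₁), KRen S Γ Γ₁ ρ →
        ∀ h h', R.seq Γ₁ (Θ.ren ρ) h h' →
          A.kind Γ₁ ((K.ren (ρ.lift Δ)).vsub h.block) ((K'.ren (ρ.lift Δ)).vsub h'.block)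
  seq Γ Θ h h' := match Θ with
    | .snoc Θ K => R.seq Γ Θ h.tail h'.tail ∧
      A.val Γ (K.vsub h.tail.block) (h _ .zero) (h' _ .zero)

-- The recursion is on arities because the kinds that occur are instantiated by earlier values,
-- which changes the kind but not its arity.
mutual
def arityRel : (α : Arity) → ArityRel ar α
  | .mk l => ListRel.toArity S (α := .mk l) (listRel l)
def listRel : (Δ : List Arity) → ListRel ar Δ
  | [] => ⟨fun _ _ _ => True, fun _ _ _ _ => True⟩
  | α :: Δ => ListRel.cons S (arityRel α) (listRel Δ)
end

def KindRel {G : List Arity} {α : Arity} (Γ : KCtx ar G) (K K' : KKind ar G α) : Prop :=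
  (arityRel S α).kind Γ K K'
def ValRel {G : List Arity} {α : Arity} (Γ : KCtx ar G) (K : KKind ar G α) (v v' : Val ar G α) :
    Prop :=
  (arityRel S α).val Γ K v v'
def TelRel {G Δ : List Arity} (Γ : KCtx ar G) (Θ Θ' : KTel ar G Δ) : Prop :=
  (listRel S Δ).tel Γ Θ Θ'
def SeqRel {G Δ : List Arity} (Γ : KCtx ar G) (Θ : KTel ar G Δ) (h h' : VSub ar Δ G) : Prop :=
  (listRel S Δ).seq Γ Θ h h'

variable {S} {G : List Arity} {Γ : KCtx ar G}

theorem arityRel_eq (α : Arity) : arityRel S α = ListRel.toArity S (listRel S α.args) := by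
  cases α; rw [arityRel]; rfl

theorem kindRel_iff {α : Arity} {K K' : KKind ar G α} :
    KindRel S Γ K K' ↔ TelRel S Γ K.tel K'.tel ∧
      ∀ {G₁ : List Arity} (Γ₁ : KCtx ar G₁) (ρ : Ren G G₁), KRen S Γ Γ₁ ρ →
        ∀ h h', SeqRel S Γ₁ (K.tel.ren ρ) h h' →
          BaseRel S Γ₁ ((K.base.ren (ρ.lift α.args)).vsub h.block)
            ((K'.base.ren (ρ.lift α.args)).vsub h'.block) := by
  rw [KindRel, arityRel_eq]; rfl

theorem valRel_var_iff {α : Arity} {K : KKind ar G α} {x x' : Var G α} :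
    ValRel S Γ K (.var x) (.var x') ↔ x = x' ∧ KindRel S Γ (Γ.lookup x) K := by
  rw [ValRel, KindRel, arityRel_eq]; rfl

theorem valRel_abs_iff {α : Arity} {K : KKind ar G α} {F F' : KAbs ar G α} :
    ValRel S Γ K (.abs F) (.abs F') ↔ TelRel S Γ F.tel K.tel ∧ TelRel S Γ F'.tel K.tel ∧
      ∀ {G₁ : List Arity} (Γ₁ : KCtx ar G₁) (ρ : Ren G G₁), KRen S Γ Γ₁ ρ →
        ∀ h h', SeqRel S Γ₁ (K.tel.ren ρ) h h' →
          TypEq S Γ₁ ((F.body.ren (ρ.lift α.args)).vsub h.block)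
            ((F'.body.ren (ρ.lift α.args)).vsub h'.block)
            ((K.base.ren (ρ.lift α.args)).vsub h.block) := by
  rw [ValRel, arityRel_eq]; rfl

theorem valRel_cases {α : Arity} {K : KKind ar G α} {v v' : Val ar G α}
    (h : ValRel S Γ K v v') :
    (∃ x, v = .var x ∧ v' = .var x) ∨ ∃ F F', v = .abs F ∧ v' = .abs F' := by
  rw [ValRel, arityRel_eq] at h
  cases v <;> cases v'
  · exact .inl ⟨_, rfl, by rw [h.1]⟩
  · exact h.elim
  · exact h.elim
  · exact .inr ⟨_, _, rfl, rfl⟩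

theorem telRel_nil {Θ Θ' : KTel ar G []} : TelRel S Γ Θ Θ' := by
  rw [TelRel, listRel]; trivial

theorem seqRel_nil {Θ : KTel ar G []} {h h' : VSub ar [] G} : SeqRel S Γ Θ h h' := by
  rw [SeqRel, listRel]; trivial

theorem telRel_snoc_iff {Δ : List Arity} {α : Arity} {Θ Θ' : KTel ar G Δ}
    {K K' : KKind ar (Δ ++ G) α} :
    TelRel S Γ (.snoc Θ K) (.snoc Θ' K') ↔ TelRel S Γ Θ Θ' ∧
      ∀ {G₁ : List Arity} (Γ₁ : KCtx ar G₁) (ρ : Ren G G₁), KRen S Γ Γ₁ ρ →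
        ∀ h h', SeqRel S Γ₁ (Θ.ren ρ) h h' →
          KindRel S Γ₁ ((K.ren (ρ.lift Δ)).vsub h.block) ((K'.ren (ρ.lift Δ)).vsub h'.block) := by
  rw [TelRel, listRel]; rfl

theorem seqRel_snoc_iff {Δ : List Arity} {α : Arity} {Θ : KTel ar G Δ}
    {K : KKind ar (Δ ++ G) α} {h h' : VSub ar (α :: Δ) G} :
    SeqRel S Γ (.snoc Θ K) h h' ↔ SeqRel S Γ Θ h.tail h'.tail ∧
      ValRel S Γ (K.vsub h.tail.block) (h _ .zero) (h' _ .zero) := by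
  rw [SeqRel, listRel]; rfl

/-! ### Monotonicity -/

theorem KRen.id (h : KDer S (.valid Γ)) : KRen S Γ Γ (Ren.id G) :=
  ⟨h, fun _ _ => by rw [KKind.ren_id]⟩

theorem KRen.comp {G' G'' : List Arity} {Γ' : KCtx ar G'} {Γ'' : KCtx ar G''} {ρ : Ren G G'}
    {ρ' : Ren G' G''} (h : KRen S Γ Γ' ρ) (h' : KRen S Γ' Γ'' ρ') :
    KRen S Γ Γ'' (ρ.comp ρ') :=
  ⟨h'.valid, fun _ _ => by rw [h'.lookup, h.lookup, KKind.ren_ren]⟩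

variable {G' : List Arity} {Γ' : KCtx ar G'} {ρ : Ren G G'}

/-- A renaming out of `Γ'` becomes one out of `Γ` after precomposition with `ρ`, so the Kripke
quantifier carries the claim. -/
theorem TelRel.mono {Δ : List Arity} {Θ Θ' : KTel ar G Δ} (h : TelRel S Γ Θ Θ')
    (hρ : KRen S Γ Γ' ρ) : TelRel S Γ' (Θ.ren ρ) (Θ'.ren ρ) := by
  induction Δ with
  | nil => exact telRel_nil
  | cons α Δ ih =>
    cases Θ; cases Θ'
    simp only [KTel.ren]
    rw [telRel_snoc_iff] at h ⊢
    refine ⟨ih h.1, fun Γ₁ ρ₁ hρ₁ s s' hs => ?_⟩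
    rw [KTel.ren_ren] at hs
    have := h.2 Γ₁ _ (hρ.comp hρ₁) s s' hs
    rwa [Ren.lift_comp, ← KKind.ren_ren, ← KKind.ren_ren] at this

theorem KindRel.mono {α : Arity} {K K' : KKind ar G α} (h : KindRel S Γ K K')
    (hρ : KRen S Γ Γ' ρ) : KindRel S Γ' (K.ren ρ) (K'.ren ρ) := by
  rw [kindRel_iff] at h ⊢
  simp only [KKind.tel_ren, KKind.base_ren]
  refine ⟨h.1.mono hρ, fun Γ₁ ρ₁ hρ₁ s s' hs => ?_⟩
  rw [KTel.ren_ren] at hs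
  have := h.2 Γ₁ _ (hρ.comp hρ₁) s s' hs
  rwa [Ren.lift_comp, ← KBase.ren_ren, ← KBase.ren_ren] at this

theorem KAbs.tel_ren {α : Arity} (F : KAbs ar G α) : (F.ren ρ).tel = F.tel.ren ρ := by
  cases F; simp only [KAbs.ren, KAbs.tel]

theorem ValRel.mono {α : Arity} {K : KKind ar G α} {v v' : Val ar G α} (h : ValRel S Γ K v v')
    (hρ : KRen S Γ Γ' ρ) : ValRel S Γ' (K.ren ρ) (v.ren ρ) (v'.ren ρ) := by
  obtain ⟨x, rfl, rfl⟩ | ⟨F, F', rfl, rfl⟩ := valRel_cases h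
  · simp only [Val.ren]
    rw [valRel_var_iff] at h ⊢
    rw [hρ.lookup]
    exact ⟨rfl, h.2.mono hρ⟩
  · simp only [Val.ren]
    rw [valRel_abs_iff] at h ⊢
    simp only [KKind.tel_ren, KKind.base_ren, KAbs.tel_ren, KAbs.body_ren]
    refine ⟨h.1.mono hρ, h.2.1.mono hρ, fun Γ₁ ρ₁ hρ₁ s s' hs => ?_⟩
    rw [KTel.ren_ren] at hs
    have := h.2.2 Γ₁ _ (hρ.comp hρ₁) s s' hs
    rwa [Ren.lift_comp, ← KBase.ren_ren, ← KObj.ren_ren, ← KObj.ren_ren] at this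

theorem KKind.vsub_block_ren {G G' Δ : List Arity} {α : Arity} (h : VSub ar Δ G)
    (ρ : Ren G G') (K : KKind ar (Δ ++ G) α) :
    (K.vsub h.block).ren ρ = (K.ren (ρ.lift Δ)).vsub (VSub.block (h.ren ρ)) := by
  rw [KKind.ren_vsub, KKind.vsub_ren, VSub.block_ren]

theorem SeqRel.mono {Δ : List Arity} {Θ : KTel ar G Δ} {s s' : VSub ar Δ G}
    (h : SeqRel S Γ Θ s s') (hρ : KRen S Γ Γ' ρ) : SeqRel S Γ' (Θ.ren ρ) (s.ren ρ) (s'.ren ρ) := by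
  induction Δ with
  | nil => exact seqRel_nil
  | cons α Δ ih =>
    cases Θ
    simp only [KTel.ren]
    rw [seqRel_snoc_iff] at h ⊢
    refine ⟨ih h.1, ?_⟩
    have := h.2.mono hρ
    rwa [KKind.vsub_block_ren] at this

/-! ### Symmetry, transitivity and conversion -/

theorem TypEq.symm {M N : KObj ar G} {T : KBase ar G} (h : TypEq S Γ M N T) : TypEq S Γ N M T :=
  ⟨h.right, h.left, .sym h.eq⟩

theorem TypEq.trans {M N P : KObj ar G} {T : KBase ar G} (h : TypEq S Γ M N T)
    (h' : TypEq S Γ N P T) : TypEq S Γ M P T :=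
  ⟨h.left, h'.right, .trans h.eq h'.eq⟩

theorem TypEq.conv {M N : KObj ar G} {T T' : KBase ar G} (h : TypEq S Γ M N T)
    (h' : BaseRel S Γ T T') : TypEq S Γ M N T' := by
  cases T <;> cases T'
  · exact h
  · exact h'.elim
  · exact h'.elim
  · exact ⟨.conv h.left h'.eq, .conv h.right h'.eq, .conv_eq h.eq h'.eq⟩

theorem BaseRel.symm {T T' : KBase ar G} (h : BaseRel S Γ T T') : BaseRel S Γ T' T := by
  cases T <;> cases T'
  · trivial
  · exact h.elim
  · exact h.elim
  · exact TypEq.symm h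

theorem BaseRel.trans {T T' T'' : KBase ar G} (h : BaseRel S Γ T T') (h' : BaseRel S Γ T' T'') :
    BaseRel S Γ T T'' := by
  cases T <;> cases T' <;> cases T'' <;> first | exact h.elim | exact h'.elim | skip
  · trivial
  · exact TypEq.trans h h'

-- The properties are proved together: later kinds depend on earlier values, so symmetry and
-- transitivity for sequences require conversion, and conversion uses them in turn. Validity of `Γ`
-- makes the identity an admissible renaming.
variable (S) in
structure ArityPer (α : Arity) : Prop where
  ksymm : ∀ {G : List Arity} {Γ : KCtx ar G} {K K' : KKind ar G α}, KDer S (.valid Γ) →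
    KindRel S Γ K K' → KindRel S Γ K' K
  ktrans : ∀ {G : List Arity} {Γ : KCtx ar G} {K K' K'' : KKind ar G α}, KDer S (.valid Γ) →
    KindRel S Γ K K' → KindRel S Γ K' K'' → KindRel S Γ K K''
  vsymm : ∀ {G : List Arity} {Γ : KCtx ar G} {K : KKind ar G α} {v v' : Val ar G α},
    KDer S (.valid Γ) → KindRel S Γ K K → ValRel S Γ K v v' → ValRel S Γ K v' v
  vtrans : ∀ {G : List Arity} {Γ : KCtx ar G} {K : KKind ar G α} {v v' v'' : Val ar G α},
    KDer S (.valid Γ) → KindRel S Γ K K → ValRel S Γ K v v' → ValRel S Γ K v' v'' →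
    ValRel S Γ K v v''
  vconv : ∀ {G : List Arity} {Γ : KCtx ar G} {K K' : KKind ar G α} {v v' : Val ar G α},
    KDer S (.valid Γ) → KindRel S Γ K K' → ValRel S Γ K v v' → ValRel S Γ K' v v'

variable (S) in
structure ListPer (Δ : List Arity) : Prop where
  tsymm : ∀ {G : List Arity} {Γ : KCtx ar G} {Θ Θ' : KTel ar G Δ}, KDer S (.valid Γ) →
    TelRel S Γ Θ Θ' → TelRel S Γ Θ' Θ
  ttrans : ∀ {G : List Arity} {Γ : KCtx ar G} {Θ Θ' Θ'' : KTel ar G Δ}, KDer S (.valid Γ) →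
    TelRel S Γ Θ Θ' → TelRel S Γ Θ' Θ'' → TelRel S Γ Θ Θ''
  ssymm : ∀ {G : List Arity} {Γ : KCtx ar G} {Θ : KTel ar G Δ} {h h' : VSub ar Δ G},
    KDer S (.valid Γ) → TelRel S Γ Θ Θ → SeqRel S Γ Θ h h' → SeqRel S Γ Θ h' h
  strans : ∀ {G : List Arity} {Γ : KCtx ar G} {Θ : KTel ar G Δ} {h h' h'' : VSub ar Δ G},
    KDer S (.valid Γ) → TelRel S Γ Θ Θ → SeqRel S Γ Θ h h' → SeqRel S Γ Θ h' h'' →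
    SeqRel S Γ Θ h h''
  sconv : ∀ {G : List Arity} {Γ : KCtx ar G} {Θ Θ' : KTel ar G Δ} {h h' : VSub ar Δ G},
    KDer S (.valid Γ) → TelRel S Γ Θ Θ' → SeqRel S Γ Θ h h' → SeqRel S Γ Θ' h h'

theorem ListPer.srefl {Δ : List Arity} (p : ListPer S Δ) {G : List Arity} {Γ : KCtx ar G}
    {Θ : KTel ar G Δ} {h h' : VSub ar Δ G} (hΓ : KDer S (.valid Γ)) (hΘ : TelRel S Γ Θ Θ)
    (hs : SeqRel S Γ Θ h h') : SeqRel S Γ Θ h h :=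
  p.strans hΓ hΘ hs (p.ssymm hΓ hΘ hs)

theorem ListPer.trefl {Δ : List Arity} (p : ListPer S Δ) {G : List Arity} {Γ : KCtx ar G}
    {Θ Θ' : KTel ar G Δ} (hΓ : KDer S (.valid Γ)) (hΘ : TelRel S Γ Θ Θ') : TelRel S Γ Θ Θ :=
  p.ttrans hΓ hΘ (p.tsymm hΓ hΘ)

theorem telRel_snoc_inst {Δ : List Arity} {α : Arity} {Θ Θ' : KTel ar G Δ}
    {K K' : KKind ar (Δ ++ G) α} {s s' : VSub ar Δ G} (hΓ : KDer S (.valid Γ))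
    (h : TelRel S Γ (.snoc Θ K) (.snoc Θ' K')) (hs : SeqRel S Γ Θ s s') :
    KindRel S Γ (K.vsub s.block) (K'.vsub s'.block) := by
  have := (telRel_snoc_iff.1 h).2 Γ _ (KRen.id hΓ) s s' (by rwa [KTel.ren_id])
  rwa [Ren.lift_id, KKind.ren_id, KKind.ren_id] at this

theorem listPer_nil : ListPer S [] where
  tsymm _ _ := telRel_nil
  ttrans _ _ _ := telRel_nil
  ssymm _ _ _ := seqRel_nil
  strans _ _ _ _ := seqRel_nil
  sconv _ _ _ := seqRel_nil

theorem ListPer.cons {α : Arity} {Δ : List Arity} (A : ArityPer S α) (R : ListPer S Δ) :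
    ListPer S (α :: Δ) := by
  have tsymm : ∀ {G : List Arity} {Γ : KCtx ar G} {Θ Θ' : KTel ar G (α :: Δ)}, KDer S (.valid Γ) →
      TelRel S Γ Θ Θ' → TelRel S Γ Θ' Θ := by
    intro G Γ Θ Θ' hΓ h
    cases Θ; cases Θ'
    rw [telRel_snoc_iff] at h ⊢
    have h1 := R.tsymm hΓ h.1
    refine ⟨h1, fun Γ₁ ρ hρ s s' hs => ?_⟩
    -- The given sequences are related at `Θ'`, while the hypothesis on kinds speaks of `Θ`.
    -- Convert, exchange the two sequences, and exchange the resulting kinds back.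
    have hs' := R.sconv hρ.valid (h1.mono hρ) hs
    exact A.ksymm hρ.valid (h.2 Γ₁ ρ hρ _ _
      (R.ssymm hρ.valid ((R.trefl hΓ h.1).mono hρ) hs'))
  have ttrans : ∀ {G : List Arity} {Γ : KCtx ar G} {Θ Θ' Θ'' : KTel ar G (α :: Δ)},
      KDer S (.valid Γ) → TelRel S Γ Θ Θ' → TelRel S Γ Θ' Θ'' → TelRel S Γ Θ Θ'' := by
    intro G Γ Θ Θ' Θ'' hΓ h h'
    cases Θ; cases Θ'; cases Θ''
    rw [telRel_snoc_iff] at h h' ⊢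
    refine ⟨R.ttrans hΓ h.1 h'.1, fun Γ₁ ρ hρ s s' hs => ?_⟩
    -- The middle term is `K'` at `s`: the first relation is used at the pair `s, s`, the second at
    -- `s, s'`.
    exact A.ktrans hρ.valid
      (h.2 Γ₁ ρ hρ _ _ (R.srefl hρ.valid ((R.trefl hΓ h.1).mono hρ) hs))
      (h'.2 Γ₁ ρ hρ _ _ (R.sconv hρ.valid (h.1.mono hρ) hs))
  refine ⟨tsymm, ttrans, ?_, ?_, ?_⟩
  · intro G Γ Θ s s' hΓ hΘ h
    cases Θ
    have hΘ' := (telRel_snoc_iff.1 hΘ).1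
    rw [seqRel_snoc_iff] at h ⊢
    have h1 := R.ssymm hΓ hΘ' h.1
    exact ⟨h1, A.vconv hΓ (telRel_snoc_inst hΓ hΘ h.1)
      (A.vsymm hΓ (telRel_snoc_inst hΓ hΘ (R.srefl hΓ hΘ' h.1)) h.2)⟩
  · intro G Γ Θ s s' s'' hΓ hΘ h h'
    cases Θ
    have hΘ' := (telRel_snoc_iff.1 hΘ).1
    rw [seqRel_snoc_iff] at h h' ⊢
    exact ⟨R.strans hΓ hΘ' h.1 h'.1,
      A.vtrans hΓ (telRel_snoc_inst hΓ hΘ (R.srefl hΓ hΘ' h.1)) h.2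
        (A.vconv hΓ (telRel_snoc_inst hΓ hΘ (R.ssymm hΓ hΘ' h.1)) h'.2)⟩
  · intro G Γ Θ Θ' s s' hΓ hΘ h
    cases Θ; cases Θ'
    have hΘ' := (telRel_snoc_iff.1 hΘ).1
    rw [seqRel_snoc_iff] at h ⊢
    exact ⟨R.sconv hΓ hΘ' h.1,
      A.vconv hΓ (telRel_snoc_inst hΓ hΘ (R.srefl hΓ (R.trefl hΓ hΘ') h.1)) h.2⟩

theorem ListPer.arity {α : Arity} (R : ListPer S α.args) : ArityPer S α := by
  have ksymm : ∀ {G : List Arity} {Γ : KCtx ar G} {K K' : KKind ar G α}, KDer S (.valid Γ) →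
      KindRel S Γ K K' → KindRel S Γ K' K := by
    intro G Γ K K' hΓ h
    rw [kindRel_iff] at h ⊢
    have h1 := R.tsymm hΓ h.1
    refine ⟨h1, fun Γ₁ ρ hρ s s' hs => ?_⟩
    exact (h.2 Γ₁ ρ hρ _ _ (R.ssymm hρ.valid ((R.trefl hΓ h.1).mono hρ)
      (R.sconv hρ.valid (h1.mono hρ) hs))).symm
  have ktrans : ∀ {G : List Arity} {Γ : KCtx ar G} {K K' K'' : KKind ar G α}, KDer S (.valid Γ) →
      KindRel S Γ K K' → KindRel S Γ K' K'' → KindRel S Γ K K'' := by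
    intro G Γ K K' K'' hΓ h h'
    rw [kindRel_iff] at h h' ⊢
    refine ⟨R.ttrans hΓ h.1 h'.1, fun Γ₁ ρ hρ s s' hs => ?_⟩
    exact (h.2 Γ₁ ρ hρ _ _ (R.srefl hρ.valid ((R.trefl hΓ h.1).mono hρ) hs)).trans
      (h'.2 Γ₁ ρ hρ _ _ (R.sconv hρ.valid (h.1.mono hρ) hs))
  refine ⟨ksymm, ktrans, ?_, ?_, ?_⟩
  · intro G Γ K v v' hΓ hK h
    obtain ⟨x, rfl, rfl⟩ | ⟨F, F', rfl, rfl⟩ := valRel_cases h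
    · exact h
    · rw [valRel_abs_iff] at h ⊢
      rw [kindRel_iff] at hK
      refine ⟨h.2.1, h.1, fun Γ₁ ρ hρ s s' hs => ?_⟩
      exact (h.2.2 Γ₁ ρ hρ _ _ (R.ssymm hρ.valid (hK.1.mono hρ) hs)).symm.conv
        (hK.2 Γ₁ ρ hρ _ _ hs).symm
  · intro G Γ K v v' v'' hΓ hK h h'
    obtain ⟨x, rfl, rfl⟩ | ⟨F, F', rfl, rfl⟩ := valRel_cases h
    · exact h'
    · obtain ⟨x, hx, -⟩ | ⟨P, F'', hP, rfl⟩ := valRel_cases h'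
      · cases hx
      · rw [valRel_abs_iff] at h h' ⊢
        rw [kindRel_iff] at hK
        refine ⟨h.1, h'.2.1, fun Γ₁ ρ hρ s s' hs => ?_⟩
        exact (h.2.2 Γ₁ ρ hρ _ _ (R.srefl hρ.valid (hK.1.mono hρ) hs)).trans
          (h'.2.2 Γ₁ ρ hρ _ _ hs)
  · intro G Γ K K' v v' hΓ hK h
    obtain ⟨x, rfl, rfl⟩ | ⟨F, F', rfl, rfl⟩ := valRel_cases h
    · rw [valRel_var_iff] at h ⊢
      exact ⟨rfl, ktrans hΓ h.2 hK⟩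
    · rw [valRel_abs_iff] at h ⊢
      have hK' := kindRel_iff.1 hK
      refine ⟨R.ttrans hΓ h.1 hK'.1, R.ttrans hΓ h.2.1 hK'.1, fun Γ₁ ρ hρ s s' hs => ?_⟩
      have h1 := (R.tsymm hΓ hK'.1).mono hρ
      have hs' := R.sconv hρ.valid h1 hs
      exact (h.2.2 Γ₁ ρ hρ _ _ hs').conv
        (hK'.2 Γ₁ ρ hρ _ _ (R.srefl hρ.valid ((R.trefl hΓ hK'.1).mono hρ) hs'))

mutual
theorem arityPer : (α : Arity) → ArityPer S α
  | .mk l => ListPer.arity (α := .mk l) (listPer l)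
theorem listPer : (Δ : List Arity) → ListPer S Δ
  | [] => listPer_nil
  | α :: Δ => ListPer.cons (arityPer α) (listPer Δ)
end

/-! ### Related contexts and kinds are equal -/

def Var.inl {Δ : List Arity} (G : List Arity) : {α : Arity} → Var Δ α → Var (Δ ++ G) α
  | _, .zero => .zero
  | _, .succ x => .succ (x.inl G)

variable (ar) in
/-- The variables of `Δ`, in the scope extended by `Δ`. -/
def VSub.fresh (Δ G : List Arity) : VSub ar Δ (Δ ++ G) := fun _ y => .var (y.inl G)

theorem VSub.fresh_ext_wk (Δ G : List Arity) :
    (VSub.fresh ar Δ G).ext (Ren.toV ar (Ren.wk Δ)) = Ren.toV ar (Ren.id (Δ ++ G)) := by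
  -- With the identity alone the induction would not close, since the tail of the block is seen
  -- through a weakening; hence an arbitrary `ρ`.
  have : ∀ (G' : List Arity) (ρ : Ren (Δ ++ G) G'),
      ((VSub.fresh ar Δ G).ren ρ).ext (Ren.toV ar ((Ren.wk Δ).comp ρ)) = Ren.toV ar ρ := by
    induction Δ with
    | nil => intro G' ρ; rfl
    | cons α Δ ih =>
      intro G' ρ
      funext β x
      cases x with
      | zero => rfl
      | succ x => exact congrFun (congrFun (ih G' ((Ren.wk1 α).comp ρ)) β) x
  have h := this _ (Ren.id _)
  rw [← h]
  rfl

theorem VSub.fresh_block (Δ G : List Arity) :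
    (VSub.fresh ar Δ G).block.preren ((Ren.wk Δ).lift Δ) = Ren.toV ar (Ren.id (Δ ++ G)) := by
  rw [← VSub.fresh_ext_wk, VSub.block, VSub.ext_preren]
  rfl

theorem KObj.fresh {Δ : List Arity} (M : KObj ar (Δ ++ G)) :
    (M.ren ((Ren.wk Δ).lift Δ)).vsub (VSub.fresh ar Δ G).block = M := by
  rw [KObj.vsub_ren, VSub.fresh_block, KObj.vsub_toV, KObj.ren_id]
theorem KBase.fresh {Δ : List Arity} (T : KBase ar (Δ ++ G)) :
    (T.ren ((Ren.wk Δ).lift Δ)).vsub (VSub.fresh ar Δ G).block = T := by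
  rw [KBase.vsub_ren, VSub.fresh_block, KBase.vsub_toV, KBase.ren_id]
theorem KKind.fresh {Δ : List Arity} {α : Arity} (K : KKind ar (Δ ++ G) α) :
    (K.ren ((Ren.wk Δ).lift Δ)).vsub (VSub.fresh ar Δ G).block = K := by
  rw [KKind.vsub_ren, VSub.fresh_block, KKind.vsub_toV, KKind.ren_id]

theorem KRen.append {Δ : List Arity} {Θ : KTel ar G Δ} (h : KDer S (.valid (Γ.append Θ))) :
    KRen S Γ (Γ.append Θ) (Ren.wk Δ) := by
  refine ⟨h, fun α x => ?_⟩
  clear h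
  induction Δ with
  | nil => cases Θ; exact (KKind.ren_id _).symm
  | cons β Δ ih =>
    cases Θ with
    | snoc Θ K =>
      have h : (Γ.append (Θ.snoc K)).lookup (Ren.wk (β :: Δ) α x) =
        ((Γ.append Θ).lookup (Ren.wk Δ α x)).ren (Ren.wk1 β) := rfl
      rw [h, ih, KKind.ren_ren]
      rfl

variable (S) in
def ReifyKind (α : Arity) : Prop :=
  ∀ {G : List Arity} {Γ : KCtx ar G} {K K' : KKind ar G α}, KDer S (.valid Γ) →
    KindRel S Γ K K' → KDer S (Γ.isKind K) ∧ KKindEq S Γ K K'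

-- The last conjunct is what drives the induction: the fresh variables are related to themselves, so
-- the relation on the next kind can be applied to them and yields a statement about that kind
-- itself.
variable (S) in
def ReifyTel (Δ : List Arity) : Prop :=
  ∀ {G : List Arity} {Γ : KCtx ar G} {Θ Θ' : KTel ar G Δ}, KDer S (.valid Γ) →
    TelRel S Γ Θ Θ' → KDer S (.valid (Γ.append Θ)) ∧ KTelEq S Γ Θ Θ' ∧
      SeqRel S (Γ.append Θ) (Θ.ren (Ren.wk Δ)) (VSub.fresh ar Δ G) (VSub.fresh ar Δ G)

theorem reifyTel_nil : ReifyTel S [] := by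
  intro G Γ Θ Θ' hΓ _
  cases Θ; cases Θ'
  exact ⟨hΓ, .nil hΓ, seqRel_nil⟩

theorem reifyTel_cons {α : Arity} {Δ : List Arity} (A : ReifyKind S α) (R : ReifyTel S Δ) :
    ReifyTel S (α :: Δ) := by
  intro G Γ Θ Θ' hΓ h
  cases Θ with
  | snoc Θ K =>
  cases Θ' with
  | snoc Θ' K' =>
  have h' := telRel_snoc_iff.1 h
  obtain ⟨hv, he, hs⟩ := R hΓ h'.1
  have hK := h'.2 _ _ (KRen.append hv) _ _ hs
  rw [KKind.fresh, KKind.fresh] at hK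
  obtain ⟨hk, hke⟩ := A hv hK
  have hv' : KDer S (.valid (Γ.append (Θ.snoc K))) := .ctxt _ _ hk
  refine ⟨hv', .snoc he hke, ?_⟩
  have hw : KRen S (Γ.append Θ) (Γ.append (Θ.snoc K)) (Ren.wk1 α) := ⟨hv', fun _ _ => rfl⟩
  simp only [KTel.ren]
  rw [seqRel_snoc_iff]
  refine ⟨?_, ?_⟩
  · have := hs.mono hw
    rwa [KTel.ren_ren] at this
  · have hl : (K.ren ((Ren.wk (α :: Δ)).lift Δ)).vsub
        (VSub.tail (VSub.fresh ar (α :: Δ) G)).block = K.ren (Ren.wk1 α) := by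
      have := congrArg (KKind.ren (Ren.wk1 α)) (KKind.fresh K)
      rw [KKind.vsub_block_ren, KKind.ren_ren, ← Ren.lift_comp] at this
      exact this
    rw [hl]
    simp only [VSub.fresh]
    rw [valRel_var_iff]
    exact ⟨rfl, ((arityPer α).ktrans hv hK ((arityPer α).ksymm hv hK)).mono hw⟩

theorem ReifyTel.kind {α : Arity} (R : ReifyTel S α.args) : ReifyKind S α := by
  intro G Γ K K' hΓ h
  have h' := kindRel_iff.1 h
  obtain ⟨hv, he, hs⟩ := R hΓ h'.1
  have hT := h'.2 _ _ (KRen.append hv) _ _ hs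
  rw [KBase.fresh, KBase.fresh] at hT
  cases K with
  | mk Θ T =>
  cases K' with
  | mk Θ' T' =>
  simp only [KKind.tel, KKind.base] at hv he hT
  cases T <;> cases T'
  · exact ⟨hv, .mk he (.type hv)⟩
  · exact hT.elim
  · exact hT.elim
  · exact ⟨TypEq.left hT, .mk he (.el (TypEq.eq hT))⟩

mutual
theorem reifyKind : (α : Arity) → ReifyKind S α
  | .mk l => ReifyTel.kind (α := .mk l) (reifyTel l)
theorem reifyTel : (Δ : List Arity) → ReifyTel S Δ
  | [] => reifyTel_nil
  | α :: Δ => reifyTel_cons (reifyKind α) (reifyTel Δ)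
end

theorem reifyAbs {α : Arity} {K : KKind ar G α} {F F' : KAbs ar G α} (hΓ : KDer S (.valid Γ))
    (h : ValRel S Γ K (.abs F) (.abs F')) :
    KAbsTyp S Γ F K ∧ KAbsEq S Γ F F' K := by
  rw [valRel_abs_iff] at h
  have h1 := (listPer _).tsymm hΓ h.1
  have h2 := (listPer _).tsymm hΓ h.2.1
  obtain ⟨hv, he, hs⟩ := reifyTel _ hΓ h1
  obtain ⟨-, he', -⟩ := reifyTel _ hΓ h2
  have hM := h.2.2 _ _ (KRen.append hv) _ _ hs
  rw [KBase.fresh, KObj.fresh, KObj.fresh] at hM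
  cases K; cases F; cases F'
  exact ⟨.mk he hM.left, .mk he he' hM.eq⟩

theorem SeqRel.argKind {Δ : List Arity} {Θ : KTel ar G Δ} {F F' : KArgs ar G Δ}
    (h : SeqRel S Γ Θ F.toV F'.toV) (β : Arity) (y : Var Δ β) :
    ValRel S Γ (Θ.argKind F β y) (.abs (F β y)) (.abs (F' β y)) := by
  induction Δ with
  | nil => cases y
  | cons α Δ ih =>
    cases Θ with
    | snoc Θ K =>
      rw [seqRel_snoc_iff] at h
      cases y with
      | zero =>
        simp only [KTel.argKind]
        rw [KKind.inst_eq]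
        exact h.2
      | succ y => exact ih (F := fun β y => F β (.succ y)) (F' := fun β y => F' β (.succ y)) h.1 y

theorem SeqRel.satEq {Δ : List Arity} {Θ : KTel ar G Δ} {F F' : KArgs ar G Δ}
    (hΓ : KDer S (.valid Γ)) (h : SeqRel S Γ Θ F.toV F'.toV) : KSatEq S Γ F F' Θ :=
  .mk hΓ fun β y => (reifyAbs hΓ (h.argKind β y)).2

theorem SeqRel.sat {Δ : List Arity} {Θ : KTel ar G Δ} {F F' : KArgs ar G Δ}
    (hΓ : KDer S (.valid Γ)) (h : SeqRel S Γ Θ F.toV F'.toV) : KSat S Γ F Θ :=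
  .mk hΓ fun β y => (reifyAbs hΓ (h.argKind β y)).1

end Semantics

/-! ## Soundness of evaluation -/

section Soundness

variable (S : Set (KDecl ar)) (κ : ∀ c, KKind ar [] (ar c))

def Env.tail {G G₀ : List Arity} {α : Arity} (e : Env ar (α :: G) G₀) : Env ar G G₀ :=
  e.preren (Ren.wk1 α)

variable (ar) in
def Env.nil (G₀ : List Arity) : Env ar [] G₀ := fun _ x => nomatch x

/-- Related environments for a context. -/
def EnvRel : {G : List Arity} → Ctx ar G → {G₀ : List Arity} → KCtx ar G₀ → Env ar G G₀ →
    Env ar G G₀ → Prop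
  | _, .nil, _, _, _, _ => True
  | _, .snoc Γ K, _, Γ₀, e, e' => EnvRel Γ Γ₀ e.tail e'.tail ∧
    KindRel S Γ₀ (K.ev κ e.tail) (e _ .zero).kind ∧
    KindRel S Γ₀ (K.ev κ e.tail) (e' _ .zero).kind ∧
    ValRel S Γ₀ (K.ev κ e.tail) (e _ .zero).val (e' _ .zero).val

def KindSem {G : List Arity} {α : Arity} (Γ : Ctx ar G) (K : Kind ar G α) : Prop :=
  ∀ ⦃G₀ : List Arity⦄ ⦃Γ₀ : KCtx ar G₀⦄ ⦃e e' : Env ar G G₀⦄, KDer S (.valid Γ₀) →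
    EnvRel S κ Γ Γ₀ e e' → KindRel S Γ₀ (K.ev κ e) (K.ev κ e')

def BaseSem {G : List Arity} (Γ : Ctx ar G) (T : Base ar G) : Prop :=
  ∀ ⦃G₀ : List Arity⦄ ⦃Γ₀ : KCtx ar G₀⦄ ⦃e e' : Env ar G G₀⦄, KDer S (.valid Γ₀) →
    EnvRel S κ Γ Γ₀ e e' → BaseRel S Γ₀ (T.ev κ e) (T.ev κ e')

/-- The two sides are evaluated in different environments, so validity already contains
functionality. The relation between the two instances of `T` is kept because typings must be moved
from one environment to the other. -/
def ObjSem {G : List Arity} (Γ : Ctx ar G) (M N : Obj ar G) (T : Base ar G) : Prop :=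
  ∀ ⦃G₀ : List Arity⦄ ⦃Γ₀ : KCtx ar G₀⦄ ⦃e e' : Env ar G G₀⦄, KDer S (.valid Γ₀) →
    EnvRel S κ Γ Γ₀ e e' →
      TypEq S Γ₀ (M.ev κ e) (N.ev κ e') (T.ev κ e) ∧ BaseRel S Γ₀ (T.ev κ e) (T.ev κ e')

def CtxSem : {G : List Arity} → Ctx ar G → Prop
  | _, .nil => True
  | _, .snoc Γ K => CtxSem Γ ∧ KindSem S κ Γ K

def TelOk {G : List Arity} (Γ : Ctx ar G) : {Δ : List Arity} → Tel ar G Δ → Prop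
  | _, .nil => True
  | _, .snoc Θ K => TelOk Γ Θ ∧ KindSem S κ (Γ.append Θ) K

/-- `KindSem` does not record that the telescope of `K` is a valid extension of `Γ`. Going under the
binders of `K` needs this, so `CtxOk` stores it for every variable. -/
def KindOk {G : List Arity} {α : Arity} (Γ : Ctx ar G) (K : Kind ar G α) : Prop :=
  TelOk S κ Γ K.tel ∧ BaseSem S κ (Γ.append K.tel) K.base

def CtxOk : {G : List Arity} → Ctx ar G → Prop
  | _, .nil => True
  | _, .snoc Γ K => CtxOk Γ ∧ KindOk S κ Γ K

variable {S κ} {G : List Arity} {Γ : Ctx ar G} {G₀ : List Arity} {Γ₀ : KCtx ar G₀}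
  {e e' : Env ar G G₀}

theorem EnvRel.mono {G₁ : List Arity} {Γ₁ : KCtx ar G₁} {ρ : Ren G₀ G₁}
    (h : EnvRel S κ Γ Γ₀ e e') (hρ : KRen S Γ₀ Γ₁ ρ) :
    EnvRel S κ Γ Γ₁ (e.ren ρ) (e'.ren ρ) := by
  induction Γ with
  | nil => trivial
  | snoc Γ K ih =>
    refine ⟨ih h.1, ?_⟩
    have h1 := h.2.1.mono hρ
    have h2 := h.2.2.1.mono hρ
    have h3 := h.2.2.2.mono hρ
    rw [Kind.ev_ren] at h1 h2 h3
    exact ⟨h1, h2, h3⟩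

theorem EnvRel.refl_left (hΓ : CtxSem S κ Γ) (hv : KDer S (.valid Γ₀))
    (h : EnvRel S κ Γ Γ₀ e e') : EnvRel S κ Γ Γ₀ e e := by
  induction Γ with
  | nil => trivial
  | snoc Γ K ih =>
    have ht := ih hΓ.1 h.1
    have hk := hΓ.2 hv ht
    exact ⟨ht, h.2.1, h.2.1, (arityPer _).vtrans hv hk h.2.2.2 ((arityPer _).vsymm hv hk h.2.2.2)⟩

/-- The clauses of `EnvRel` are stated at the kinds evaluated in the first environment; they are
moved to the second along `hk'`, which relates the two evaluations. -/
theorem EnvRel.symm (hΓ : CtxSem S κ Γ) (hv : KDer S (.valid Γ₀))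
    (h : EnvRel S κ Γ Γ₀ e e') : EnvRel S κ Γ Γ₀ e' e := by
  induction Γ with
  | nil => trivial
  | snoc Γ K ih =>
    have ht := h.1.refl_left hΓ.1 hv
    have hk := hΓ.2 hv ht
    have hk' := hΓ.2 hv h.1
    have hk'' := (arityPer _).ksymm hv hk'
    exact ⟨ih hΓ.1 h.1, (arityPer _).ktrans hv hk'' h.2.2.1, (arityPer _).ktrans hv hk'' h.2.1,
      (arityPer _).vconv hv hk' ((arityPer _).vsymm hv hk h.2.2.2)⟩

theorem CtxSem.append {Δ : List Arity} {Θ : Tel ar G Δ} (hΓ : CtxSem S κ Γ)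
    (hΘ : TelOk S κ Γ Θ) : CtxSem S κ (Γ.append Θ) := by
  induction Δ with
  | nil => cases Θ; exact hΓ
  | cons α Δ ih =>
    cases Θ with
    | snoc Θ K => exact ⟨ih hΘ.1, hΘ.2⟩

/-- The recorded kinds `Θ₁` and `Θ₂` need only be related to the evaluated telescope. This freedom
is used when the labels of an abstraction differ from the kind against which it is checked. -/
theorem EnvRel.ext {Δ : List Arity} {Θ : Tel ar G Δ} {Θ₁ Θ₂ : KTel ar G₀ Δ}
    {h h' : VSub ar Δ G₀} (hΓ : CtxSem S κ Γ) (hΘ : TelOk S κ Γ Θ) (hv : KDer S (.valid Γ₀))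
    (he : EnvRel S κ Γ Γ₀ e e') (h₀ : TelRel S Γ₀ (Θ.ev κ e) (Θ.ev κ e))
    (h₁ : TelRel S Γ₀ (Θ.ev κ e) Θ₁)
    (h₂ : TelRel S Γ₀ (Θ.ev κ e) Θ₂) (hs : SeqRel S Γ₀ (Θ.ev κ e) h h') :
    EnvRel S κ (Γ.append Θ) Γ₀ (e.ext Θ₁ h) (e'.ext Θ₂ h') := by
  induction Δ generalizing e' with
  | nil => cases Θ; cases Θ₁; cases Θ₂; exact he
  | cons α Δ ih =>
    cases Θ with
    | snoc Θ K =>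
    cases Θ₁ with
    | snoc Θ₁ K₁ =>
    cases Θ₂ with
    | snoc Θ₂ K₂ =>
    simp only [Tel.ev] at h₀ h₁ h₂ hs
    have hs' := seqRel_snoc_iff.1 hs
    have h₀' := (telRel_snoc_iff.1 h₀).1
    have h₁' := (telRel_snoc_iff.1 h₁).1
    have h₂' := (telRel_snoc_iff.1 h₂).1
    have hr := (listPer _).srefl hv h₀' hs'.1
    -- `K` is evaluated where `Θ₁` is recorded, whereas the hypotheses evaluate it where `Θ.ev κ e`
    -- is recorded; the reflexive instance of the induction hypothesis relates the two.
    have hk := hΘ.2 hv (ih (e' := e) hΘ.1 (he.refl_left hΓ hv) h₀' h₁' h₀' hr)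
    have k₁ := telRel_snoc_inst hv h₁ hr
    have k₂ := telRel_snoc_inst hv h₂ hs'.1
    have hs₂ := hs'.2
    rw [Kind.ev_vsub, Env.up_vsub_block] at k₁ k₂ hs₂
    refine ⟨ih hΘ.1 he h₀' h₁' h₂' hs'.1, ?_⟩
    exact ⟨(arityPer _).ktrans hv hk k₁, (arityPer _).ktrans hv hk k₂,
      (arityPer _).vconv hv ((arityPer _).ksymm hv hk) hs₂⟩

theorem Kind.ev_ren_block {Δ G₁ : List Arity} {α : Arity} (K : Kind ar (Δ ++ G) α)
    (e : Env ar G G₀) (Θ : KTel ar G₀ Δ) (ρ : Ren G₀ G₁) (h : VSub ar Δ G₁) :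
    ((K.ev κ (e.up Θ)).ren (ρ.lift Δ)).vsub h.block = K.ev κ ((e.ren ρ).ext (Θ.ren ρ) h) := by
  rw [Kind.ev_ren, Kind.ev_vsub, Env.up_ren, Env.up_vsub_block]
theorem Base.ev_ren_block {Δ G₁ : List Arity} (T : Base ar (Δ ++ G))
    (e : Env ar G G₀) (Θ : KTel ar G₀ Δ) (ρ : Ren G₀ G₁) (h : VSub ar Δ G₁) :
    ((T.ev κ (e.up Θ)).ren (ρ.lift Δ)).vsub h.block = T.ev κ ((e.ren ρ).ext (Θ.ren ρ) h) := by
  rw [Base.ev_ren, Base.ev_vsub, Env.up_ren, Env.up_vsub_block]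
theorem Obj.ev_ren_block {Δ G₁ : List Arity} (M : Obj ar (Δ ++ G))
    (e : Env ar G G₀) (Θ : KTel ar G₀ Δ) (ρ : Ren G₀ G₁) (h : VSub ar Δ G₁) :
    ((M.ev κ (e.up Θ)).ren (ρ.lift Δ)).vsub h.block = M.ev κ ((e.ren ρ).ext (Θ.ren ρ) h) := by
  rw [Obj.ev_ren, Obj.ev_vsub, Env.up_ren, Env.up_vsub_block]

theorem TelOk.rel {Δ : List Arity} {Θ : Tel ar G Δ} (hΘ : TelOk S κ Γ Θ) (hΓ : CtxSem S κ Γ)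
    (hv : KDer S (.valid Γ₀)) (he : EnvRel S κ Γ Γ₀ e e') :
    TelRel S Γ₀ (Θ.ev κ e) (Θ.ev κ e') := by
  induction Δ generalizing G₀ with
  | nil => exact telRel_nil
  | cons α Δ ih =>
    cases Θ with
    | snoc Θ K =>
    simp only [Tel.ev]
    rw [telRel_snoc_iff]
    refine ⟨ih hΘ.1 hv he, fun Γ₁ ρ hρ s s' hs => ?_⟩
    rw [Kind.ev_ren_block, Kind.ev_ren_block, Tel.ev_ren, Tel.ev_ren]
    rw [Tel.ev_ren] at hs
    have he' := he.mono hρ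
    have h0 := ih hΘ.1 hρ.valid (he'.refl_left hΓ hρ.valid)
    exact hΘ.2 hρ.valid (he'.ext hΓ hΘ.1 hρ.valid h0 h0 (ih hΘ.1 hρ.valid he') hs)

theorem EnvRel.ext_self {Δ : List Arity} {Θ : Tel ar G Δ}
    {h h' : VSub ar Δ G₀} (hΓ : CtxSem S κ Γ) (hΘ : TelOk S κ Γ Θ) (hv : KDer S (.valid Γ₀))
    (he : EnvRel S κ Γ Γ₀ e e') (hs : SeqRel S Γ₀ (Θ.ev κ e) h h') :
    EnvRel S κ (Γ.append Θ) Γ₀ (e.ext (Θ.ev κ e) h) (e'.ext (Θ.ev κ e') h') :=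
  have h0 := hΘ.rel hΓ hv (he.refl_left hΓ hv)
  he.ext hΓ hΘ hv h0 h0 (hΘ.rel hΓ hv he) hs

theorem KindOk.sem {α : Arity} {K : Kind ar G α} (hK : KindOk S κ Γ K) (hΓ : CtxSem S κ Γ) :
    KindSem S κ Γ K := by
  intro G₀ Γ₀ e e' hv he
  rw [kindRel_iff]
  simp only [Kind.tel_ev, Kind.base_ev]
  refine ⟨hK.1.rel hΓ hv he, fun Γ₁ ρ hρ s s' hs => ?_⟩
  rw [Base.ev_ren_block, Base.ev_ren_block, Tel.ev_ren, Tel.ev_ren]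
  rw [Tel.ev_ren] at hs
  exact hK.2 hρ.valid ((he.mono hρ).ext_self hΓ hK.1 hρ.valid hs)

theorem CtxOk.sem (hΓ : CtxOk S κ Γ) : CtxSem S κ Γ := by
  induction Γ with
  | nil => trivial
  | snoc Γ K ih => exact ⟨ih hΓ.1, hΓ.2.sem (ih hΓ.1)⟩

theorem CtxOk.of_append {Δ : List Arity} {Θ : Tel ar G Δ} (h : CtxOk S κ (Γ.append Θ)) :
    CtxOk S κ Γ ∧ TelOk S κ Γ Θ := by
  induction Δ with
  | nil => cases Θ; exact ⟨h, trivial⟩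
  | cons α Δ ih =>
    cases Θ with
    | snoc Θ K => exact ⟨(ih h.1).1, (ih h.1).2, h.2.sem h.1.sem⟩

/-! ### Renaming of contexts -/

variable (S κ) in
def SemRen {G G' : List Arity} (Γ : Ctx ar G) (Γ' : Ctx ar G') (ρ : Ren G G') : Prop :=
  ∀ ⦃G₀ : List Arity⦄ ⦃Γ₀ : KCtx ar G₀⦄ ⦃e e' : Env ar G' G₀⦄, EnvRel S κ Γ' Γ₀ e e' →
    EnvRel S κ Γ Γ₀ (e.preren ρ) (e'.preren ρ)

variable {G' : List Arity} {Γ' : Ctx ar G'} {ρ : Ren G G'}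

theorem SemRen.append {Δ : List Arity} (h : SemRen S κ Γ Γ' ρ) (Θ : Tel ar G Δ) :
    SemRen S κ (Γ.append Θ) (Γ'.append (Θ.ren ρ)) (ρ.lift Δ) := by
  induction Δ with
  | nil => cases Θ; simp only [Tel.ren]; exact h
  | cons α Δ ih =>
    cases Θ with
    | snoc Θ K =>
    simp only [Tel.ren]
    intro G₀ Γ₀ e e' he
    have h2 := he.2
    rw [Kind.ren_ev] at h2
    exact ⟨ih Θ he.1, h2⟩

theorem KindSem.ren {α : Arity} {K : Kind ar G α} (hK : KindSem S κ Γ K)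
    (h : SemRen S κ Γ Γ' ρ) : KindSem S κ Γ' (K.ren ρ) := by
  intro G₀ Γ₀ e e' hv he
  rw [Kind.ren_ev, Kind.ren_ev]
  exact hK hv (h he)

theorem BaseSem.ren {T : Base ar G} (hT : BaseSem S κ Γ T)
    (h : SemRen S κ Γ Γ' ρ) : BaseSem S κ Γ' (T.ren ρ) := by
  intro G₀ Γ₀ e e' hv he
  rw [Base.ren_ev, Base.ren_ev]
  exact hT hv (h he)

theorem TelOk.ren {Δ : List Arity} {Θ : Tel ar G Δ} (hΘ : TelOk S κ Γ Θ)
    (h : SemRen S κ Γ Γ' ρ) : TelOk S κ Γ' (Θ.ren ρ) := by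
  induction Δ with
  | nil => cases Θ; simp only [Tel.ren]; trivial
  | cons α Δ ih =>
    cases Θ with
    | snoc Θ K =>
    simp only [Tel.ren]
    exact ⟨ih hΘ.1, hΘ.2.ren (h.append Θ)⟩

theorem Kind.tel_ren {α : Arity} (ρ : Ren G G') (K : Kind ar G α) :
    (K.ren ρ).tel = K.tel.ren ρ := by
  cases K; simp only [Kind.ren, Kind.tel]

theorem Kind.base_ren {α : Arity} (ρ : Ren G G') (K : Kind ar G α) :
    (K.ren ρ).base = K.base.ren (ρ.lift α.args) := by
  cases K; simp only [Kind.ren, Kind.base]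

theorem KindOk.ren {α : Arity} {K : Kind ar G α} (hK : KindOk S κ Γ K)
    (h : SemRen S κ Γ Γ' ρ) : KindOk S κ Γ' (K.ren ρ) := by
  rw [KindOk, Kind.tel_ren, Kind.base_ren]
  exact ⟨hK.1.ren h, hK.2.ren (h.append _)⟩

theorem SemRen.wk1 {α : Arity} {K : Kind ar G α} : SemRen S κ Γ (Γ.snoc K) (Ren.wk1 α) :=
  fun _ _ _ _ he => he.1

theorem SemRen.empty : SemRen S κ .nil Γ (Ren.empty G) :=
  fun _ _ _ _ _ => trivial

theorem CtxOk.lookup (hΓ : CtxOk S κ Γ) {α : Arity} (x : Var G α) :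
    KindOk S κ Γ (Γ.lookup x) := by
  induction Γ with
  | nil => cases x
  | snoc Γ K ih =>
    cases x with
    | zero => exact hΓ.2.ren SemRen.wk1
    | succ x => exact (ih hΓ.1 x).ren SemRen.wk1

theorem EnvRel.lookup (he : EnvRel S κ Γ Γ₀ e e') {α : Arity} (x : Var G α) :
    KindRel S Γ₀ ((Γ.lookup x).ev κ e) (e _ x).kind ∧
    KindRel S Γ₀ ((Γ.lookup x).ev κ e) (e' _ x).kind ∧
    ValRel S Γ₀ ((Γ.lookup x).ev κ e) (e _ x).val (e' _ x).val := by
  induction Γ with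
  | nil => cases x
  | snoc Γ K ih =>
    cases x with
    | zero =>
      simp only [Ctx.lookup, Kind.ren_ev]
      exact he.2
    | succ x =>
      simp only [Ctx.lookup, Kind.ren_ev]
      exact ih he.1 x

/-! ### Arguments -/

/-- Pass through `N` in the second environment: `M` in `e` is equal to it by the hypothesis at `(e,
e')`, and `M` in `e'` by the hypothesis at `(e', e')`. -/
theorem ObjSem.refl_left {M N : Obj ar G} {T : Base ar G} (h : ObjSem S κ Γ M N T)
    (hΓ : CtxSem S κ Γ) : ObjSem S κ Γ M M T := by
  intro G₀ Γ₀ e e' hv he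
  have h1 := h hv he
  have h2 := h hv ((he.symm hΓ hv).refl_left hΓ hv)
  exact ⟨h1.1.trans (h2.1.symm.conv h1.2.symm), h1.2⟩

variable (S κ) in
/-- Semantic equality of sequences of arguments of kinds `Θ`. -/
def ArgsSem {Δ : List Arity} (Γ : Ctx ar G) (Θ : Tel ar G Δ) (F F' : Args ar G Δ) : Prop :=
  ∀ β y, TelOk S κ Γ (Θ.argKind F β y).tel ∧
    ObjSem S κ (Γ.append (Θ.argKind F β y).tel) (F β y) (F' β y) (Θ.argKind F β y).base

theorem ArgsSem.refl_left {Δ : List Arity} {Θ : Tel ar G Δ} {F F' : Args ar G Δ}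
    (h : ArgsSem S κ Γ Θ F F') (hΓ : CtxSem S κ Γ) : ArgsSem S κ Γ Θ F F :=
  fun β y => ⟨(h β y).1, (h β y).2.refl_left (hΓ.append (h β y).1)⟩

/-- Allowing any labels related to the telescope is what makes comparable the two sides of an
equation between arguments, whose labels are computed from different instances. -/
theorem ObjSem.valRel {α : Arity} {K : Kind ar G α} {F F' : Abs ar G α}
    {L₁ L₂ : KTel ar G₀ α.args} (hΓ : CtxSem S κ Γ) (hK : TelOk S κ Γ K.tel)
    (hF : ObjSem S κ (Γ.append K.tel) F F' K.base) (hv : KDer S (.valid Γ₀))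
    (he : EnvRel S κ Γ Γ₀ e e') (h₁ : TelRel S Γ₀ (K.tel.ev κ e) L₁)
    (h₂ : TelRel S Γ₀ (K.tel.ev κ e) L₂) :
    ValRel S Γ₀ (K.ev κ e) (.abs (.mk L₁ (F.ev κ (e.up L₁))))
      (.abs (.mk L₂ (F'.ev κ (e'.up L₂)))) := by
  rw [valRel_abs_iff]
  simp only [Kind.tel_ev, Kind.base_ev, KAbs.tel, KAbs.body]
  refine ⟨(listPer _).tsymm hv h₁, (listPer _).tsymm hv h₂, fun Γ₁ ρ hρ s s' hs => ?_⟩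
  rw [Obj.ev_ren_block, Obj.ev_ren_block, Base.ev_ren_block, Tel.ev_ren]
  have h₁' := h₁.mono hρ
  have h₂' := h₂.mono hρ
  rw [Tel.ev_ren] at hs h₁' h₂'
  have he' := he.mono hρ
  have he₀ := he'.refl_left hΓ hρ.valid
  have h₀ := hK.rel hΓ hρ.valid he₀
  -- The typing comes out at `K.base` evaluated with `L₁` recorded; the second half of `hF` converts
  -- it to `K.base` with the evaluated telescope recorded.
  exact (hF hρ.valid (he'.ext hΓ hK hρ.valid h₀ h₁' h₂' hs)).1.conv
    (hF hρ.valid (he₀.ext hΓ hK hρ.valid h₀ h₁' h₀ ((listPer _).srefl hρ.valid h₀ hs))).2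

theorem KindRel.tel {α : Arity} {K K' : KKind ar G₀ α} (h : KindRel S Γ₀ K K') :
    TelRel S Γ₀ K.tel K'.tel := (kindRel_iff.1 h).1

theorem KindRel.base {α : Arity} {K K' : KKind ar G₀ α} (h : KindRel S Γ₀ K K')
    (hv : KDer S (.valid Γ₀)) {s s' : VSub ar α.args G₀} (hs : SeqRel S Γ₀ K.tel s s') :
    BaseRel S Γ₀ (K.base.vsub s.block) (K'.base.vsub s'.block) := by
  have := (kindRel_iff.1 h).2 Γ₀ _ (KRen.id hv) s s' (by rwa [KTel.ren_id])
  rwa [Ren.lift_id, KBase.ren_id, KBase.ren_id] at this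

theorem ArgsSem.seqRel {Δ : List Arity} {Θ : Tel ar G Δ} {F F' : Args ar G Δ}
    {Θ₁ Θ₂ : KTel ar G₀ Δ} (h : ArgsSem S κ Γ Θ F F') (hΓ : CtxSem S κ Γ) (hΘ : TelOk S κ Γ Θ)
    (hv : KDer S (.valid Γ₀)) (he : EnvRel S κ Γ Γ₀ e e')
    (h₁ : TelRel S Γ₀ (Θ.ev κ e) Θ₁) (h₂ : TelRel S Γ₀ (Θ.ev κ e) Θ₂) :
    SeqRel S Γ₀ (Θ.ev κ e) (F.ev κ e Θ₁).toV (F'.ev κ e' Θ₂).toV := by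
  induction Δ generalizing e' with
  | nil => exact seqRel_nil
  | cons α Δ ih =>
    cases Θ with
    | snoc Θ K =>
    cases Θ₁ with
    | snoc Θ₁ K₁ =>
    cases Θ₂ with
    | snoc Θ₂ K₂ =>
    have hr := h.refl_left hΓ
    have he₀ := he.refl_left hΓ hv
    have h₀ : TelRel S Γ₀ (Θ.ev κ e) (Θ.ev κ e) := hΘ.1.rel hΓ hv he₀
    simp only [Tel.ev] at h₁ h₂ ⊢
    rw [seqRel_snoc_iff]
    have h₁' := (telRel_snoc_iff.1 h₁).1
    have h₂' := (telRel_snoc_iff.1 h₂).1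
    have ht : ArgsSem S κ Γ Θ (fun β y => F β (.succ y)) fun β y => F' β (.succ y) :=
      fun β y => h β (.succ y)
    have hs := ih ht hΘ.1 he h₁' h₂'
    have hs' := ih (ht.refl_left hΓ) hΘ.1 he₀ h₀ h₁'
    refine ⟨hs, ?_⟩
    have k₁ := telRel_snoc_inst hv h₁ ((listPer _).srefl hv h₀ hs)
    have k₂ := telRel_snoc_inst hv h₂ hs
    have hz := h α .zero
    simp only [Tel.argKind] at hz
    -- The expected kind is instantiated in TF, while the label uses arguments evaluated with the
    -- telescope `Θ₁`. The two evaluations of the arguments differ in their labels, so these kinds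
    -- are related rather than equal.
    have hk : KindRel S Γ₀ ((K.inst fun β y => F β (.succ y)).ev κ e)
        ((K.ev κ (e.up (Θ.ev κ e))).vsub
          (Args.ev κ (fun β y => F β (.succ y)) e Θ₁).toV.block) := by
      rw [Kind.inst_ev _ _ _ (Θ.ev κ e), Kind.ev_vsub, Env.up_vsub_block]
      exact hΘ.2 hv (he₀.ext hΓ hΘ.1 hv h₀ h₀ h₀ hs')
    have l₁ := ((arityPer _).ktrans hv hk k₁).tel
    have l₂ := ((arityPer _).ktrans hv hk k₂).tel
    rw [Kind.tel_ev] at l₁ l₂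
    exact (arityPer _).vconv hv hk (hz.2.valRel hΓ hz.1 hv he l₁ l₂)

/-- For abstractions this is the definition of the relation at the identity renaming. For a variable
the rules of $\mathrm{TF}_{\mathrm k}$ apply at its declared kind; the typing of `x[a']` comes out
at the instance by `a'` and is converted to the instance by `a`. -/
theorem ValRel.app {α : Arity} {K : KKind ar G₀ α} {v v' : Val ar G₀ α} {a a' : KArgs ar G₀ α.args}
    (hv : KDer S (.valid Γ₀)) (h : ValRel S Γ₀ K v v')
    (hs : SeqRel S Γ₀ K.tel a.toV a'.toV) :
    TypEq S Γ₀ (v.app a) (v'.app a') (K.base.vsub a.toV.block) := by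
  obtain ⟨x, rfl, rfl⟩ | ⟨F, F', rfl, rfl⟩ := valRel_cases h
  · have hk := (valRel_var_iff.1 h).2
    have hs₁ := (listPer _).sconv hv ((listPer _).tsymm hv hk.tel) hs
    have hl := (listPer _).trefl hv hk.tel
    have hs₂ := (listPer _).ssymm hv hl hs₁
    have hb := hk.base hv ((listPer _).srefl hv hl hs₁)
    have hb' := hk.base hv hs₂
    have t₁ := KDer.var Γ₀ x a (hs₁.sat hv)
    have t₂ := KDer.var Γ₀ x a' (hs₂.sat hv)
    have t₃ := KDer.var_eq Γ₀ x a a' (hs₁.satEq hv)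
    rw [KBase.inst_eq] at t₁ t₂ t₃
    have e₁ : TypEq S Γ₀ (.var x a) (.var x a) _ := ⟨t₁, t₁, .ref t₁⟩
    have e₂ : TypEq S Γ₀ (.var x a') (.var x a') _ := ⟨t₂, t₂, .ref t₂⟩
    have e₃ : TypEq S Γ₀ (.var x a) (.var x a')
        ((Γ₀.lookup x).base.vsub a.toV.block) :=
      ⟨t₁, (e₂.conv (hb'.trans hb.symm)).left, t₃⟩
    exact e₃.conv hb
  · have := (valRel_abs_iff.1 h).2.2 Γ₀ _ (KRen.id hv) a.toV a'.toV (by rwa [KTel.ren_id])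
    rwa [Ren.lift_id, KObj.ren_id, KObj.ren_id, KBase.ren_id] at this

theorem Base.inst_ev_self {α : Arity} (K : Kind ar G α) (F : Args ar G α.args) (e : Env ar G G₀) :
    (K.base.inst F).ev κ e = (K.ev κ e).base.vsub (F.ev κ e (K.tel.ev κ e)).toV.block := by
  rw [Base.inst_ev _ _ _ (K.tel.ev κ e), Kind.base_ev, Base.ev_vsub, Env.up_vsub_block]

/-- The semantics of a symbol of kind `K` that is applied to arguments. -/
theorem ArgsSem.objSem {α : Arity} {K : Kind ar G α} {F F' : Args ar G α.args} {M M' : Obj ar G}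
    (h : ArgsSem S κ Γ K.tel F F') (hΓ : CtxSem S κ Γ) (hK : KindOk S κ Γ K)
    (hM : ∀ {G₀ : List Arity} {Γ₀ : KCtx ar G₀} {e e' : Env ar G G₀}, KDer S (.valid Γ₀) →
      EnvRel S κ Γ Γ₀ e e' → KindRel S Γ₀ (K.ev κ e) (K.ev κ e) →
      ∃ Θ₁ Θ₂, TelRel S Γ₀ (K.tel.ev κ e) Θ₁ ∧ TelRel S Γ₀ (K.tel.ev κ e) Θ₂ ∧
        (SeqRel S Γ₀ (K.tel.ev κ e) (F.ev κ e Θ₁).toV (F'.ev κ e' Θ₂).toV →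
          TypEq S Γ₀ (M.ev κ e) (M'.ev κ e')
            ((K.ev κ e).base.vsub (F.ev κ e Θ₁).toV.block))) :
    ObjSem S κ Γ M M' (K.base.inst F) := by
  intro G₀ Γ₀ e e' hv he
  have he₀ := he.refl_left hΓ hv
  have hr := h.refl_left hΓ
  have hk := hK.sem hΓ hv he₀
  have h₀ := hK.1.rel hΓ hv he₀
  obtain ⟨Θ₁, Θ₂, h₁, h₂, hE⟩ := hM hv he hk
  rw [Base.inst_ev_self, Base.inst_ev_self]
  have hs₁ : SeqRel S Γ₀ (K.ev κ e).tel (F.ev κ e Θ₁).toV (F.ev κ e (K.tel.ev κ e)).toV := by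
    rw [Kind.tel_ev]; exact hr.seqRel hΓ hK.1 hv he₀ h₁ h₀
  have hs₂ : SeqRel S Γ₀ (K.ev κ e).tel (F.ev κ e (K.tel.ev κ e)).toV
      (F.ev κ e' (K.tel.ev κ e')).toV := by
    rw [Kind.tel_ev]; exact hr.seqRel hΓ hK.1 hv he h₀ (hK.1.rel hΓ hv he)
  exact ⟨(hE (h.seqRel hΓ hK.1 hv he h₁ h₂)).conv (hk.base hv hs₁),
    (hK.sem hΓ hv he).base hv hs₂⟩

theorem objSem_var {α : Arity} (x : Var G α) {F F' : Args ar G α.args} (hΓ : CtxOk S κ Γ)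
    (h : ArgsSem S κ Γ (Γ.lookup x).tel F F') :
    ObjSem S κ Γ (.var x F) (.var x F') ((Γ.lookup x).base.inst F) := by
  refine h.objSem hΓ.sem (hΓ.lookup x) fun {G₀ Γ₀ e e'} hv he _ => ?_
  obtain ⟨k₁, k₂, hval⟩ := he.lookup x
  refine ⟨(e _ x).kind.tel, (e' _ x).kind.tel, ?_, ?_, fun hs => ?_⟩
  · rw [← Kind.tel_ev]; exact k₁.tel
  · rw [← Kind.tel_ev]; exact k₂.tel
  · rw [Obj.ev_var, Obj.ev_var]
    rw [← Kind.tel_ev] at hs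
    exact hval.app hv hs

theorem Env.nil_eq (e e' : Env ar [] G₀) : e = e' := by
  funext α x; cases x

theorem Kind.ev_empty {α : Arity} (K : Kind ar [] α) (e : Env ar G G₀) :
    (K.ren (Ren.empty G)).ev κ e = (K.ev κ (Env.nil ar [])).ren (Ren.empty G₀) := by
  rw [Kind.ren_ev, Kind.ev_ren]; congr 1; exact Env.nil_eq _ _

theorem Tel.ev_empty {Δ : List Arity} (Θ : Tel ar [] Δ) (e : Env ar G G₀) :
    (Θ.ren (Ren.empty G)).ev κ e = (Θ.ev κ (Env.nil ar [])).ren (Ren.empty G₀) := by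
  rw [Tel.ren_ev, Tel.ev_ren]; congr 1; exact Env.nil_eq _ _

/-- By `hc` the kind that labels the arguments of `c` is the evaluation of its declared kind, so the
rule of $\mathrm{TF}_{\mathrm k}$ for `c : κ c` matches the semantic premises. -/
theorem objSem_const {c : C} {K : Kind ar [] (ar c)} {F F' : Args ar G (ar c).args}
    (hΓ : CtxOk S κ Γ) (hK : KindOk S κ .nil K) (hc : κ c = K.ev κ (Env.nil ar []))
    (hS : KDecl.const c (κ c) ∈ S)
    (h : ArgsSem S κ Γ (K.ren (Ren.empty G)).tel F F') :
    ObjSem S κ Γ (.const c F) (.const c F') ((K.ren (Ren.empty G)).base.inst F) := by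
  refine h.objSem hΓ.sem (hK.ren SemRen.empty) fun {G₀ Γ₀ e e'} hv he hk => ?_
  have hE : (K.ren (Ren.empty G)).ev κ e = (κ c).ren (Ren.empty G₀) := by
    rw [Kind.ev_empty, hc]
  have hE' : (K.ren (Ren.empty G)).tel.ev κ e = ((κ c).ren (Ren.empty G₀)).tel := by
    rw [← Kind.tel_ev, hE]
  rw [hE] at hk
  rw [hE, hE', Obj.ev_const, Obj.ev_const]
  refine ⟨_, _, hk.tel, hk.tel, fun hs => ?_⟩
  have hs' := (listPer _).ssymm hv hk.tel hs
  have t₁ := KDer.const Γ₀ c (κ c) _ hS (hs.sat hv)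
  have t₂ := KDer.const Γ₀ c (κ c) _ hS (hs'.sat hv)
  have t₃ := KDer.const_eq Γ₀ c (κ c) _ _ hS (hs.satEq hv)
  rw [KBase.inst_eq] at t₁ t₂ t₃
  have e₂ : TypEq S Γ₀ _ _ _ := ⟨t₂, t₂, .ref t₂⟩
  exact ⟨t₁, (e₂.conv (hk.base hv hs')).right, t₃⟩

theorem Env.ext_preren {Δ : List Arity} (e : Env ar G' G₀) (Θ : KTel ar G₀ Δ) (h : VSub ar Δ G₀)
    (ρ : Ren G G') : (e.ext Θ h).preren (ρ.lift Δ) = (e.preren ρ).ext Θ h := by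
  induction Δ with
  | nil => cases Θ; rfl
  | cons β Δ ih =>
    cases Θ with
    | snoc Θ K =>
      funext α x
      cases x with
      | zero => rfl
      | succ x => exact congrFun (congrFun (ih Θ fun β y => h β (.succ y)) α) x

variable (κ) in
/-- The environment in which the closed context `Θ` is evaluated to the variables. -/
def Tel.env {Δ : List Arity} (Θ : Tel ar [] Δ) : Env ar (Δ ++ []) (Δ ++ []) :=
  (Env.nil ar []).up (Θ.ev κ (Env.nil ar []))

theorem Tel.env_inst {Δ : List Arity} (Θ : Tel ar [] Δ) (e : Env ar G G₀) (h : VSub ar Δ G₀) :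
    ((Θ.env κ).ren ((Ren.empty G₀).lift Δ)).vsub h.block =
      (e.ext ((Θ.ren (Ren.empty G)).ev κ e) h).preren ((Ren.empty G).lift Δ) := by
  rw [Env.ext_preren, Tel.ev_empty, Tel.env, Env.up_ren, Env.up_vsub_block]
  congr 1; exact Env.nil_eq _ _

theorem Obj.inst_ev_empty {Δ : List Arity} (Θ : Tel ar [] Δ) (M : Obj ar (Δ ++ []))
    (F : Args ar G Δ) (e : Env ar G G₀) :
    ((M.ren ((Ren.empty G).lift Δ)).inst F).ev κ e =
      ((M.ev κ (Θ.env κ)).ren ((Ren.empty G₀).lift Δ)).inst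
        (F.ev κ e ((Θ.ren (Ren.empty G)).ev κ e)) := by
  rw [KObj.inst_eq, Obj.ev_ren, Obj.ev_vsub, Tel.env_inst Θ e,
    Obj.inst_ev _ _ _ ((Θ.ren (Ren.empty G)).ev κ e), Obj.ren_ev]

theorem Base.inst_ev_empty {Δ : List Arity} (Θ : Tel ar [] Δ) (T : Base ar (Δ ++ []))
    (F : Args ar G Δ) (e : Env ar G G₀) :
    ((T.ren ((Ren.empty G).lift Δ)).inst F).ev κ e =
      ((T.ev κ (Θ.env κ)).ren ((Ren.empty G₀).lift Δ)).inst
        (F.ev κ e ((Θ.ren (Ren.empty G)).ev κ e)) := by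
  rw [KBase.inst_eq, Base.ev_ren, Base.ev_vsub, Tel.env_inst Θ e,
    Base.inst_ev _ _ _ ((Θ.ren (Ren.empty G)).ev κ e), Base.ren_ev]

/-- The rule of $\mathrm{TF}_{\mathrm k}$ equates the instances of `M` and `N` within one
environment `e`; the semantic validity of `N` then carries the right side from `e` to `e'`. -/
theorem objSem_eqn {Δ : List Arity} {Θ : Tel ar [] Δ} {M N : Obj ar (Δ ++ [])}
    {T : Base ar (Δ ++ [])} {F : Args ar G Δ}
    (hΓ : CtxOk S κ Γ) (hΘ : TelOk S κ .nil Θ) (hM : ObjSem S κ (Ctx.nil.append Θ) M M T)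
    (hN : ObjSem S κ (Ctx.nil.append Θ) N N T)
    (hS : KDecl.eqn (Θ.ev κ (Env.nil ar [])) (M.ev κ (Θ.env κ)) (N.ev κ (Θ.env κ))
      (T.ev κ (Θ.env κ)) ∈ S)
    (h : ArgsSem S κ Γ (Θ.ren (Ren.empty G)) F F) :
    ObjSem S κ Γ ((M.ren ((Ren.empty G).lift Δ)).inst F) ((N.ren ((Ren.empty G).lift Δ)).inst F)
        ((T.ren ((Ren.empty G).lift Δ)).inst F) := by
  intro G₀ Γ₀ e e' hv he
  have hΘ' := hΘ.ren (SemRen.empty (Γ := Γ))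
  have he₀ := he.refl_left hΓ.sem hv
  have h₀ := hΘ'.rel hΓ.sem hv he₀
  have hs := h.seqRel hΓ.sem hΘ' hv he h₀ (hΘ'.rel hΓ.sem hv he)
  have hs₀ := h.seqRel hΓ.sem hΘ' hv he₀ h₀ h₀
  have hE : ∀ {e' : Env ar G G₀}, EnvRel S κ Γ Γ₀ e e' →
      SeqRel S Γ₀ ((Θ.ren (Ren.empty G)).ev κ e)
        (F.ev κ e ((Θ.ren (Ren.empty G)).ev κ e)).toV
        (F.ev κ e' ((Θ.ren (Ren.empty G)).ev κ e')).toV → EnvRel S κ (Ctx.nil.append Θ) Γ₀ _ _ :=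
    fun he hs => (SemRen.empty (Γ := Γ)).append Θ (he.ext_self hΓ.sem hΘ' hv hs)
  have m := hM hv (hE he₀ hs₀)
  have n := hN hv (hE he hs)
  have heq := hs₀.sat hv
  rw [Tel.ev_empty] at heq
  have r := KDer.eqn Γ₀ _ _ _ _ _ hS heq
  rw [← Tel.ev_empty (G := G) Θ e, ← Obj.inst_ev_empty, ← Obj.inst_ev_empty,
    ← Base.inst_ev_empty] at r
  simp only [← Obj.ren_ev, ← Base.ren_ev, ← Obj.inst_ev, ← Base.inst_ev] at m n
  exact ⟨TypEq.trans ⟨m.1.left, n.1.left, r⟩ n.1, n.2⟩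

/-! ### Derivations -/

variable (S κ) in
def Jdg.Sem : Jdg ar → Prop
  | .valid Γ => CtxOk S κ Γ
  | .typ Γ M T => CtxOk S κ Γ ∧ ObjSem S κ Γ M M T
  | .eq Γ M N T => CtxOk S κ Γ ∧ ObjSem S κ Γ M N T

variable (S κ) in
/-- Declarations that are valid in the semantics and whose translations belong to `S`. -/
def Decl.Sem : Decl ar → Prop
  | .const c K => KindOk S κ .nil K ∧ κ c = K.ev κ (Env.nil ar []) ∧ KDecl.const c (κ c) ∈ S
  | .eqn Θ M N T => TelOk S κ .nil Θ ∧ ObjSem S κ (Ctx.nil.append Θ) M M T ∧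
      ObjSem S κ (Ctx.nil.append Θ) N N T ∧
      KDecl.eqn (Θ.ev κ (Env.nil ar [])) (M.ev κ (Θ.env κ)) (N.ev κ (Θ.env κ))
        (T.ev κ (Θ.env κ)) ∈ S

theorem Jdg.Sem.kindOk {α : Arity} {K : Kind ar G α} (h : (Γ.isKind K).Sem S κ) :
    CtxOk S κ Γ ∧ KindOk S κ Γ K := by
  cases K with
  | mk Δ T =>
  cases T with
  | type =>
    have h' := CtxOk.of_append h
    exact ⟨h'.1, h'.2, fun _ _ _ _ _ _ => trivial⟩
  | el A =>
    have h' := CtxOk.of_append h.1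
    exact ⟨h'.1, h'.2, fun _ _ _ _ hv he => (h.2 hv he).1⟩

/-- The derivation may use any set `S₁` of semantically valid declarations. In the induction over
declarations it is the set of predecessors, while `S` remains the translation of the whole
specification. -/
theorem Der.sem {S₁ : Set (Decl ar)} (hS : ∀ δ ∈ S₁, δ.Sem S κ) {J : Jdg ar} (h : Der S₁ J) :
    J.Sem S κ := by
  induction h with
  | emp => trivial
  | ctxt Γ K _ ih => exact ih.kindOk
  | var Γ x F _ _ ih ihF =>
    exact ⟨ih, objSem_var x ih fun β y => ⟨(ihF β y).1.of_append.2, (ihF β y).2⟩⟩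
  | var_eq Γ x F F' _ _ ih ihF =>
    exact ⟨ih, objSem_var x ih fun β y => ⟨(ihF β y).1.of_append.2, (ihF β y).2⟩⟩
  | ref _ ih => exact ih
  | sym _ ih =>
    refine ⟨ih.1, fun G₀ Γ₀ e e' hv he => ?_⟩
    have h1 := ih.2 hv he
    have h2 := ih.2 hv (he.symm ih.1.sem hv)
    exact ⟨h2.1.symm.conv h1.2.symm, h1.2⟩
  | trans _ _ ih₁ ih₂ =>
    refine ⟨ih₁.1, fun G₀ Γ₀ e e' hv he => ?_⟩
    -- Only one premise may change environments: the first is used at `(e, e)`, the second at `(e,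
    -- e')`.
    have h1 := ih₁.2 hv (he.refl_left ih₁.1.sem hv)
    have h2 := ih₂.2 hv he
    exact ⟨h1.1.trans h2.1, h2.2⟩
  | conv _ _ ih₁ ih₂ =>
    refine ⟨ih₁.1, fun G₀ Γ₀ e e' hv he => ?_⟩
    have he₀ := he.refl_left ih₁.1.sem hv
    have h1 := ih₁.2 hv he
    exact ⟨h1.1.conv (T' := .el _) (ih₂.2 hv he₀).1,
      -- `B` in `e` equals `A` in `e`, which equals `A` in `e'`, which equals `B` in `e'`.
      TypEq.trans (TypEq.trans (ih₂.2 hv he₀).1.symm h1.2) (ih₂.2 hv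
        ((he.symm ih₁.1.sem hv).refl_left ih₁.1.sem hv)).1⟩
  | conv_eq _ _ ih₁ ih₂ =>
    refine ⟨ih₁.1, fun G₀ Γ₀ e e' hv he => ?_⟩
    have he₀ := he.refl_left ih₁.1.sem hv
    have h1 := ih₁.2 hv he
    exact ⟨h1.1.conv (T' := .el _) (ih₂.2 hv he₀).1,
      TypEq.trans (TypEq.trans (ih₂.2 hv he₀).1.symm h1.2) (ih₂.2 hv
        ((he.symm ih₁.1.sem hv).refl_left ih₁.1.sem hv)).1⟩
  | const Γ c K F hc _ _ ih ihF =>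
    have h := hS _ hc
    exact ⟨ih, objSem_const ih h.1 h.2.1 h.2.2
      fun β y => ⟨(ihF β y).1.of_append.2, (ihF β y).2⟩⟩
  | const_eq Γ c K F F' hc _ _ ih ihF =>
    have h := hS _ hc
    exact ⟨ih, objSem_const ih h.1 h.2.1 h.2.2
      fun β y => ⟨(ihF β y).1.of_append.2, (ihF β y).2⟩⟩
  | eqn Γ Θ M N T F hd _ _ ih ihF =>
    have h := hS _ hd
    exact ⟨ih, objSem_eqn ih h.1 h.2.1 h.2.2.1 h.2.2.2
      fun β y => ⟨(ihF β y).1.of_append.2, (ihF β y).2⟩⟩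

/-! ### The environment of a context -/

/-- The translation of a context, with the environment that maps each variable to itself. -/
def Ctx.evEnv (κ : ∀ c, KKind ar [] (ar c)) : {G : List Arity} → Ctx ar G →
    KCtx ar G × Env ar G G
  | _, .nil => ⟨.nil, Env.nil ar []⟩
  | _, .snoc Γ K => ⟨.snoc (Ctx.evEnv κ Γ).1 (K.ev κ (Ctx.evEnv κ Γ).2), fun _ x => match x with
    | .zero => ⟨(K.ev κ (Ctx.evEnv κ Γ).2).ren (Ren.wk1 _), .var .zero⟩
    | .succ x => ((Ctx.evEnv κ Γ).2 _ x).ren (Ren.wk1 _)⟩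

variable (κ) in
def Ctx.ev (Γ : Ctx ar G) : KCtx ar G := (Γ.evEnv κ).1
variable (κ) in
def Ctx.env (Γ : Ctx ar G) : Env ar G G := (Γ.evEnv κ).2

/-- Reification of the kind of each new variable makes the evaluated context valid; weakening along
the new variable is then admissible, and that variable is related to itself because its declared
kind is the evaluated one. -/
theorem CtxOk.env (hΓ : CtxOk S κ Γ) :
    KDer S (.valid (Γ.ev κ)) ∧ EnvRel S κ Γ (Γ.ev κ) (Γ.env κ) (Γ.env κ) := by
  induction Γ with
  | nil => exact ⟨.emp, trivial⟩
  | snoc Γ K ih =>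
    obtain ⟨hv, he⟩ := ih hΓ.1
    have hk := hΓ.2.sem hΓ.1.sem hv he
    have hv' : KDer S (.valid (Ctx.ev κ (Γ.snoc K))) := .ctxt _ _ (reifyKind _ hv hk).1
    have hw : KRen S (Γ.ev κ) (Ctx.ev κ (Γ.snoc K)) (Ren.wk1 _) := ⟨hv', fun _ _ => rfl⟩
    have hk' := hk.mono hw
    rw [Kind.ev_ren] at hk'
    refine ⟨hv', he.mono hw, ?_⟩
    have hz : (Ctx.env κ (Γ.snoc K) _ .zero).kind = K.ev κ (Ctx.env κ (Γ.snoc K)).tail :=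
      Kind.ev_ren _ _ _
    rw [hz]
    refine ⟨hk', hk', ?_⟩
    have hz' : (Ctx.env κ (Γ.snoc K) _ .zero).val = .var .zero := rfl
    rw [hz', valRel_var_iff]
    refine ⟨rfl, ?_⟩
    have hl : (Ctx.ev κ (Γ.snoc K)).lookup .zero = K.ev κ (Ctx.env κ (Γ.snoc K)).tail :=
      Kind.ev_ren _ _ _
    rw [hl]
    exact hk'

variable (κ) in
def Jdg.ev : Jdg ar → KJdg ar
  | .valid Γ => .valid (Γ.ev κ)
  | .typ Γ M T => .typ (Γ.ev κ) (M.ev κ (Γ.env κ)) (T.ev κ (Γ.env κ))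
  | .eq Γ M N T => .eq (Γ.ev κ) (M.ev κ (Γ.env κ)) (N.ev κ (Γ.env κ)) (T.ev κ (Γ.env κ))

theorem Jdg.Sem.der {J : Jdg ar} (h : J.Sem S κ) : KDer S (J.ev κ) := by
  cases J with
  | valid Γ => exact (CtxOk.env h).1
  | typ Γ M T => exact (h.2 h.1.env.1 h.1.env.2).1.left
  | eq Γ M N T => exact (h.2 h.1.env.1 h.1.env.2).1.eq

end Soundness

/-! ## Erasure of labels, and consequences for instantiation in `TF` -/

mutual
def KObj.erase : {G : List Arity} → KObj ar G → Obj ar G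
  | _, .var x F => .var x fun β y => (F β y).erase
  | _, .const c F => .const c fun β y => (F β y).erase
def KAbs.erase : {G : List Arity} → {α : Arity} → KAbs ar G α → Abs ar G α
  | _, _, .mk _ M => M.erase
def KBase.erase : {G : List Arity} → KBase ar G → Base ar G
  | _, .type => .type
  | _, .el A => .el A.erase
def KKind.erase : {G : List Arity} → {α : Arity} → KKind ar G α → Kind ar G α
  | _, _, .mk Δ T => .mk Δ.erase T.erase
def KTel.erase : {G Δ : List Arity} → KTel ar G Δ → Tel ar G Δ
  | _, _, .nil => .nil
  | _, _, .snoc Θ K => .snoc Θ.erase K.erase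
end

-- Arbitrary kinds of a given arity, used where the labels computed from them are erased or do not
-- matter.
mutual
def KKind.default (ar : C → Arity) : (G : List Arity) → (α : Arity) → KKind ar G α
  | G, .mk l => .mk (KTel.default ar G l) .type
def KTel.default (ar : C → Arity) : (G Δ : List Arity) → KTel ar G Δ
  | _, [] => .nil
  | G, α :: Δ => .snoc (KTel.default ar G Δ) (KKind.default ar (Δ ++ G) α)
end

section Erase

variable {κ : ∀ c, KKind ar [] (ar c)}

def Env.IsVar {G : List Arity} (e : Env ar G G) : Prop := ∀ α x, (e α x).val = .var x

theorem Env.IsVar.up {G Δ : List Arity} {e : Env ar G G} (he : e.IsVar) (Θ : KTel ar G Δ) :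
    (e.up Θ).IsVar := by
  induction Δ with
  | nil => cases Θ; exact he
  | cons β Δ ih =>
    cases Θ with
    | snoc Θ K =>
      intro α x
      cases x with
      | zero => rfl
      | succ x =>
        simp only [Env.up, EVal.ren]
        rw [ih Θ α x]
        rfl

theorem labArgs_erase {G Δ : List Arity} (Θ : KTel ar G Δ)
    (f : ∀ β, Var Δ β → KTel ar G β.args → KObj ar (β.args ++ G)) (F : Args ar G Δ)
    (h : ∀ β y Ξ, (f β y Ξ).erase = F β y) (β : Arity) (y : Var Δ β) :
    (labArgs Θ f β y).erase = F β y := by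
  induction Δ with
  | nil => cases y
  | cons α Δ ih =>
    cases Θ with
    | snoc Θ K =>
      cases y with
      | zero => simp only [labArgs, KAbs.erase, h]
      | succ y => exact ih Θ _ (fun β y => F β (.succ y)) (fun β y Ξ => h β (.succ y) Ξ) y

theorem Obj.erase_ev {G : List Arity} (M : Obj ar G) {e : Env ar G G} (he : e.IsVar) :
    (M.ev κ e).erase = M := by
  induction M with
  | var x F ih =>
    rw [Obj.ev_var, he]
    simp only [Val.app, KObj.erase]
    congr 1; funext β y
    exact labArgs_erase _ _ F (fun β y Ξ => ih β y (he.up Ξ)) β y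
  | const c F ih =>
    rw [Obj.ev_const]
    simp only [KObj.erase]
    congr 1; funext β y
    exact labArgs_erase _ _ F (fun β y Ξ => ih β y (he.up Ξ)) β y

theorem Base.erase_ev {G : List Arity} (T : Base ar G) {e : Env ar G G} (he : e.IsVar) :
    (T.ev κ e).erase = T := by
  cases T with
  | type => simp only [Base.ev, KBase.erase]
  | el A => simp only [Base.ev, KBase.erase, A.erase_ev he]

mutual
theorem Kind.erase_ev : {G : List Arity} → {α : Arity} → (K : Kind ar G α) → {e : Env ar G G} →
    e.IsVar → (K.ev κ e).erase = K
  | _, _, .mk Δ T, _, he => by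
    simp only [Kind.ev, KKind.erase, Tel.erase_ev Δ he, T.erase_ev (he.up _)]
theorem Tel.erase_ev : {G Δ : List Arity} → (Θ : Tel ar G Δ) → {e : Env ar G G} →
    e.IsVar → (Θ.ev κ e).erase = Θ
  | _, _, .nil, _, he => by simp only [Tel.ev, KTel.erase]
  | _, _, .snoc Θ K, _, he => by
    simp only [Tel.ev, KTel.erase, Tel.erase_ev Θ he, Kind.erase_ev K (he.up _)]
end

variable (ar) in
def Env.default (G : List Arity) : Env ar G G := fun α x => ⟨KKind.default ar G α, .var x⟩

/-- Erasing the labels recovers a kind from its evaluation at the identity values, whatever labels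
were used. Identities for renaming and instantiation in TF thus follow from the evaluation lemmas,
without a second development of hereditary substitution. -/
theorem Kind.ext_ev {G : List Arity} {α : Arity} {K K' : Kind ar G α}
    (h : ∀ (κ : ∀ c, KKind ar [] (ar c)) (e : Env ar G G), K.ev κ e = K'.ev κ e) : K = K' := by
  have he : (Env.default ar G).IsVar := fun _ _ => rfl
  rw [← K.erase_ev (κ := fun c => KKind.default ar [] (ar c)) he, h, K'.erase_ev he]

variable (κ) in
/-- An environment that is composed with an instantiation. -/
def Sub.env {b : ℕ} {G G' G₀ : List Arity} (σ : Sub ar b G G') (e : Env ar G' G₀) :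
    Env ar G G₀ := fun α x => match σ α x with
  | .var x' => e α x'
  | .abs _ F => ⟨KKind.default ar G₀ α, .abs (.mk (KKind.default ar G₀ α).tel
      (F.ev κ (e.up (KKind.default ar G₀ α).tel)))⟩

/-- The default kind is sufficient for an instantiated variable, as compatibility only compares its
labels with those on its value. -/
theorem Sub.env_compat {b : ℕ} {G G' G₀ : List Arity} (σ : Sub ar b G G') (e : Env ar G' G₀) :
    σ.Compat κ e (σ.env κ e) := by
  intro α x
  simp only [Sub.env]
  cases σ α x <;> rfl

def Sub.preren {b : ℕ} {G G' G'' : List Arity} (ρ : Ren G G') (σ : Sub ar b G' G'') :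
    Sub ar b G G'' := fun α x => σ α (ρ α x)

theorem Sub.lift1_compat {b : ℕ} {G G' G₀ : List Arity} {β : Arity} {σ : Sub ar b G G'}
    {e : Env ar (β :: G') G₀} {e' : Env ar G G₀} (h : σ.Compat κ e.tail e') :
    ∃ e'' : Env ar (β :: G) G₀, (σ.lift1 β).Compat κ e e'' ∧ e''.tail = e' := by
  refine ⟨fun α x => match x with
    | .zero => e _ .zero
    | .succ x => e' _ x, fun α x => ?_, rfl⟩
  cases x with
  | zero => rfl
  | succ x =>
    have hx := h α x
    simp only [Sub.lift1]
    cases hv : σ α x with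
    | var y =>
      rw [hv] at hx
      simp only [Entry.ren] at hx ⊢
      exact hx
    | abs hb F =>
      rw [hv] at hx
      simp only [Entry.ren] at hx ⊢
      rw [hx, Obj.ren_ev, ← Env.up_preren]
      rfl

theorem Kind.wk1_sub_lift1 {b : ℕ} {G G' : List Arity} {α β : Arity} (σ : Sub ar b G G')
    (K : Kind ar G α) : (K.ren (Ren.wk1 β)).sub (σ.lift1 β) = (K.sub σ).ren (Ren.wk1 β) := by
  refine Kind.ext_ev fun κ e => ?_
  obtain ⟨e'', h, ht⟩ := Sub.lift1_compat (σ.env_compat (κ := κ) e.tail)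
  rw [Kind.sub_ev _ h, Kind.ren_ev, Kind.ren_ev]
  exact (congrArg _ ht).trans (Kind.sub_ev K (σ.env_compat e.tail)).symm

theorem Kind.ren_sub {b : ℕ} {G G' G'' : List Arity} {α : Arity} (ρ : Ren G G')
    (σ : Sub ar b G' G'') (K : Kind ar G α) : (K.ren ρ).sub σ = K.sub (σ.preren ρ) := by
  refine Kind.ext_ev fun κ e => ?_
  rw [Kind.sub_ev _ (σ.env_compat e), Kind.ren_ev]
  exact (Kind.sub_ev (σ := σ.preren ρ) K (e' := (σ.env κ e).preren ρ)
    fun α x => σ.env_compat e α (ρ α x)).symm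

theorem Kind.inst_eq_sub {b : ℕ} {G Δ : List Arity} {α : Arity} (hb : orderList Δ ≤ b)
    (F : Args ar G Δ) (K : Kind ar (Δ ++ G) α) : K.sub (Sub.block hb F) = K.inst F := by
  refine Kind.ext_ev fun κ e => ?_
  rw [Kind.inst_ev _ _ _ (KTel.default ar G Δ), Kind.sub_ev _ (Sub.block_compat _ _ _ _)]

theorem Kind.sub_var {G : List Arity} {α : Arity} {b : ℕ} (K : Kind ar G α) :
    K.sub (b := b) (fun _ x => .var x) = K :=
  Kind.ext_ev fun _ _ => Kind.sub_ev K fun _ _ => rfl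

theorem Args.ren_ev {G G' G₀ Δ : List Arity} (ρ : Ren G G') (F : Args ar G Δ) (e : Env ar G' G₀)
    (Θ : KTel ar G₀ Δ) :
    Args.ev κ (fun β y => (F β y).ren (ρ.lift β.args)) e Θ = F.ev κ (e.preren ρ) Θ := by
  simp only [Args.ev, Obj.ren_ev, Env.up_preren]

theorem Args.sub_ev {b : ℕ} {G G' G₀ Δ : List Arity} {σ : Sub ar b G G'} (F : Args ar G Δ)
    {e : Env ar G' G₀} {e' : Env ar G G₀} (h : σ.Compat κ e e') (Θ : KTel ar G₀ Δ) :
    Args.ev κ (fun β y => (F β y).sub (σ.lift β.args)) e Θ = F.ev κ e' Θ := by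
  simp only [Args.ev, fun β y Ξ => Obj.sub_ev (F β y) (h.lift Ξ)]

theorem Tel.argKind_ren {G G' Δ : List Arity} (ρ : Ren G G') (Θ : Tel ar G Δ) (F : Args ar G Δ)
    (β : Arity) (y : Var Δ β) :
    (Θ.ren ρ).argKind (fun β y => (F β y).ren (ρ.lift β.args)) β y =
      (Θ.argKind F β y).ren ρ := by
  refine Kind.ext_ev fun κ e => ?_
  rw [Tel.argKind_ev, Kind.ren_ev, Tel.argKind_ev, Args.ren_ev, Tel.ren_ev]

theorem Tel.argKind_sub {b : ℕ} {G G' Δ : List Arity} (σ : Sub ar b G G') (Θ : Tel ar G Δ)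
    (F : Args ar G Δ) (β : Arity) (y : Var Δ β) :
    (Θ.sub σ).argKind (fun β y => (F β y).sub (σ.lift β.args)) β y =
      (Θ.argKind F β y).sub σ := by
  refine Kind.ext_ev fun κ e => ?_
  rw [Tel.argKind_ev, Kind.sub_ev _ (σ.env_compat e), Tel.argKind_ev,
    Args.sub_ev F (σ.env_compat e), Tel.sub_ev _ (σ.env_compat e)]

end Erase

/-! ## The translation as evaluation -/

section Translation

variable {S : Set (Decl ar)} {κ : ∀ c, KKind ar [] (ar c)}

variable (κ) in
/-- Environments that map the variables of `Γ` to themselves. -/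
def Ctx.IdEnv {G : List Arity} (Γ : Ctx ar G) (e : Env ar G G) : Prop :=
  ∀ α x, e α x = ⟨(Γ.lookup x).ev κ e, .var x⟩

theorem Ctx.IdEnv.up {G Δ : List Arity} {Γ : Ctx ar G} {e : Env ar G G} (he : Γ.IdEnv κ e)
    (Θ : Tel ar G Δ) : (Γ.append Θ).IdEnv κ (e.up (Θ.ev κ e)) := by
  induction Δ with
  | nil => cases Θ; exact he
  | cons β Δ ih =>
    cases Θ with
    | snoc Θ K =>
      intro α x
      simp only [Tel.ev]
      cases x with
      | zero =>
        have h : ((Γ.append (Θ.snoc K)).lookup .zero).ev κ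
            (e.up ((Θ.ev κ e).snoc (K.ev κ (e.up (Θ.ev κ e))))) =
            (K.ev κ (e.up (Θ.ev κ e))).ren (Ren.wk1 _) :=
          (Kind.ren_ev _ _ _).trans (Kind.ev_ren _ _ _).symm
        rw [h]; rfl
      | succ x =>
        have h : ((Γ.append (Θ.snoc K)).lookup (.succ x)).ev κ
            (e.up ((Θ.ev κ e).snoc (K.ev κ (e.up (Θ.ev κ e))))) =
            (((Γ.append Θ).lookup x).ev κ (e.up (Θ.ev κ e))).ren (Ren.wk1 _) :=
          (Kind.ren_ev _ _ _).trans (Kind.ev_ren _ _ _).symm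
        rw [h]
        exact congrArg (EVal.ren (Ren.wk1 _)) (ih Θ α x)

/-- This is the defining equation of $\mathcal L$ for arguments: each label is the telescope of the
kind expected after instantiation by the preceding arguments. -/
theorem Args.ev_apply {G G₀ Δ : List Arity} (F : Args ar G Δ) (e : Env ar G G₀)
    (Θ : KTel ar G₀ Δ) (β : Arity) (y : Var Δ β) :
    F.ev κ e Θ β y = .mk (Θ.argKind (F.ev κ e Θ) β y).tel
      ((F β y).ev κ (e.up (Θ.argKind (F.ev κ e Θ) β y).tel)) := by
  induction Δ with
  | nil => cases y
  | cons α Δ ih =>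
    cases Θ with
    | snoc Θ K =>
      cases y with
      | zero => simp only [KTel.argKind, KKind.inst_eq]; rfl
      | succ y => exact ih (fun β y => F β (.succ y)) Θ y

variable (S κ) in
/-- The kinds of the constants of `S` are evaluated to the kinds that are used for labels. -/
def ConstEv : Prop := ∀ c K, Decl.const c K ∈ S → κ c = K.ev κ (Env.nil ar [])

theorem Args.ev_eq {G Δ : List Arity} {Θ : Tel ar G Δ} {F : Args ar G Δ} {F' : KArgs ar G Δ}
    {e : Env ar G G} (h : ∀ β y, F' β y = .mk ((Θ.argKind F β y).tel.ev κ e)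
      ((F β y).ev κ (e.up ((Θ.argKind F β y).tel.ev κ e)))) : F' = F.ev κ e (Θ.ev κ e) := by
  funext β y
  rw [h, Args.ev_apply, ← Tel.argKind_ev, Kind.tel_ev]

-- Evaluation in an identity environment satisfies the defining equations of $\mathcal L$, whose
-- least solution is therefore contained in it. Both uniqueness of translations and the transfer of
-- derivability rest on this.
mutual
theorem LabObj.eq_ev {G : List Arity} {Γ : Ctx ar G} {M : Obj ar G} {M' : KObj ar G}
    (hκ : ConstEv S κ) : LabObj S Γ M M' → ∀ e : Env ar G G, Γ.IdEnv κ e → M' = M.ev κ e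
  | .var x F F' h, e, he => by
    rw [Obj.ev_var, he, Args.ev_eq fun β y => LabAbs.eq_ev hκ (h β y) e he]
    simp only [Val.app, Kind.tel_ev]
  | .const c K F F' hc h, e, he => by
    rw [Obj.ev_const, Args.ev_eq fun β y => LabAbs.eq_ev hκ (h β y) e he, ← Kind.tel_ev,
      Kind.ev_empty, hκ c K hc]
theorem LabAbs.eq_ev {G : List Arity} {α : Arity} {Γ : Ctx ar G} {K : Kind ar G α} {M : Abs ar G α}
    {M' : KAbs ar G α} (hκ : ConstEv S κ) : LabAbs S Γ K M M' → ∀ e : Env ar G G, Γ.IdEnv κ e →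
      M' = .mk (K.tel.ev κ e) (M.ev κ (e.up (K.tel.ev κ e)))
  | .mk hΔ hM, e, he => by
    rw [LabTel.eq_ev hκ hΔ e he, LabObj.eq_ev hκ hM _ (he.up _)]; rfl
theorem LabBase.eq_ev {G : List Arity} {Γ : Ctx ar G} {T : Base ar G} {T' : KBase ar G}
    (hκ : ConstEv S κ) : LabBase S Γ T T' → ∀ e : Env ar G G, Γ.IdEnv κ e → T' = T.ev κ e
  | .type, e, he => rfl
  | .el hA, e, he => by rw [LabObj.eq_ev hκ hA e he]; rfl
theorem LabKind.eq_ev {G : List Arity} {α : Arity} {Γ : Ctx ar G} {K : Kind ar G α}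
    {K' : KKind ar G α} (hκ : ConstEv S κ) :
    LabKind S Γ K K' → ∀ e : Env ar G G, Γ.IdEnv κ e → K' = K.ev κ e
  | .mk hΔ hT, e, he => by
    rw [LabTel.eq_ev hκ hΔ e he, LabBase.eq_ev hκ hT _ (he.up _), Kind.ev]
theorem LabTel.eq_ev {G Δ : List Arity} {Γ : Ctx ar G} {Θ : Tel ar G Δ}
    {Θ' : KTel ar G Δ} (hκ : ConstEv S κ) :
    LabTel S Γ Θ Θ' → ∀ e : Env ar G G, Γ.IdEnv κ e → Θ' = Θ.ev κ e
  | .nil, e, he => by rw [Tel.ev]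
  | .snoc hΘ hK, e, he => by
    rw [LabTel.eq_ev hκ hΘ e he, LabKind.eq_ev hκ hK _ (he.up _), Tel.ev]
end

theorem Ctx.env_idEnv {G : List Arity} (Γ : Ctx ar G) : Γ.IdEnv κ (Γ.env κ) := by
  induction Γ with
  | nil => intro α x; cases x
  | snoc Γ K ih =>
    intro α x
    cases x with
    | zero =>
      have h : ((Γ.snoc K).lookup .zero).ev κ (Ctx.env κ (Γ.snoc K)) =
          (K.ev κ (Γ.env κ)).ren (Ren.wk1 _) :=
        (Kind.ren_ev _ _ _).trans (Kind.ev_ren _ _ _).symm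
      rw [h]; rfl
    | succ x =>
      have h : ((Γ.snoc K).lookup (.succ x)).ev κ (Ctx.env κ (Γ.snoc K)) =
          ((Γ.lookup x).ev κ (Γ.env κ)).ren (Ren.wk1 _) :=
        (Kind.ren_ev _ _ _).trans (Kind.ev_ren _ _ _).symm
      rw [h]
      exact congrArg (EVal.ren (Ren.wk1 _)) (ih α x)

theorem LabCtx.eq_ev {G : List Arity} {Γ : Ctx ar G} {Γ' : KCtx ar G} (hκ : ConstEv S κ)
    (h : LabCtx S Γ Γ') : Γ' = Γ.ev κ := by
  induction h with
  | nil => rfl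
  | snoc _ hK ih => rw [ih, hK.eq_ev hκ _ (Ctx.env_idEnv _)]; rfl

theorem LabJdg.eq_ev {J : Jdg ar} {J' : KJdg ar} (hκ : ConstEv S κ) (h : LabJdg S J J') :
    J' = J.ev κ := by
  cases h with
  | valid hΓ => rw [hΓ.eq_ev hκ]; rfl
  | typ hΓ hM hT =>
    rw [hΓ.eq_ev hκ, hM.eq_ev hκ _ (Ctx.env_idEnv _), hT.eq_ev hκ _ (Ctx.env_idEnv _)]; rfl
  | eq hΓ hM hN hT =>
    rw [hΓ.eq_ev hκ, hM.eq_ev hκ _ (Ctx.env_idEnv _), hN.eq_ev hκ _ (Ctx.env_idEnv _),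
      hT.eq_ev hκ _ (Ctx.env_idEnv _)]; rfl

variable (κ) in
def Decl.ev : Decl ar → KDecl ar
  | .const c K => .const c (K.ev κ (Env.nil ar []))
  | .eqn Θ M N T => .eqn (Θ.ev κ (Env.nil ar [])) (M.ev κ (Θ.env κ)) (N.ev κ (Θ.env κ))
      (T.ev κ (Θ.env κ))

theorem LabDecl.eq_ev {δ : Decl ar} {δ' : KDecl ar} (hκ : ConstEv S κ) (h : LabDecl S δ δ') :
    δ' = δ.ev κ := by
  have h₀ : (Ctx.nil (ar := ar)).IdEnv κ (Env.nil ar []) := fun α x => by cases x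
  cases h with
  | const hK => rw [hK.eq_ev hκ _ h₀]; rfl
  | eqn hΘ hM hN hT =>
    rw [hΘ.eq_ev hκ _ h₀, hM.eq_ev hκ _ (h₀.up _), hN.eq_ev hκ _ (h₀.up _),
      hT.eq_ev hκ _ (h₀.up _)]
    rfl

/-! ### Monotonicity in the specification -/

variable {S' : Set (Decl ar)}

mutual
theorem LabObj.mono {G : List Arity} {Γ : Ctx ar G} {M : Obj ar G} {M' : KObj ar G}
    (hS : S ⊆ S') : LabObj S Γ M M' → LabObj S' Γ M M'
  | .var x F F' h => .var x F F' fun β y => LabAbs.mono hS (h β y)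
  | .const c K F F' hc h => .const c K F F' (hS hc) fun β y => LabAbs.mono hS (h β y)
theorem LabAbs.mono {G : List Arity} {α : Arity} {Γ : Ctx ar G} {K : Kind ar G α} {M : Abs ar G α}
    {M' : KAbs ar G α} (hS : S ⊆ S') : LabAbs S Γ K M M' → LabAbs S' Γ K M M'
  | .mk hΔ hM => .mk (LabTel.mono hS hΔ) (LabObj.mono hS hM)
theorem LabBase.mono {G : List Arity} {Γ : Ctx ar G} {T : Base ar G} {T' : KBase ar G}
    (hS : S ⊆ S') : LabBase S Γ T T' → LabBase S' Γ T T'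
  | .type => .type
  | .el hA => .el (LabObj.mono hS hA)
theorem LabKind.mono {G : List Arity} {α : Arity} {Γ : Ctx ar G} {K : Kind ar G α}
    {K' : KKind ar G α} (hS : S ⊆ S') : LabKind S Γ K K' → LabKind S' Γ K K'
  | .mk hΔ hT => .mk (LabTel.mono hS hΔ) (LabBase.mono hS hT)
theorem LabTel.mono {G Δ : List Arity} {Γ : Ctx ar G} {Θ : Tel ar G Δ}
    {Θ' : KTel ar G Δ} (hS : S ⊆ S') : LabTel S Γ Θ Θ' → LabTel S' Γ Θ Θ'
  | .nil => .nil
  | .snoc hΘ hK => .snoc (LabTel.mono hS hΘ) (LabKind.mono hS hK)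
end

theorem LabDecl.mono {δ : Decl ar} {δ' : KDecl ar} (hS : S ⊆ S') (h : LabDecl S δ δ') :
    LabDecl S' δ δ' := by
  cases h with
  | const hK => exact .const (hK.mono hS)
  | eqn hΘ hM hN hT => exact .eqn (hΘ.mono hS) (hM.mono hS) (hN.mono hS) (hT.mono hS)

/-! ### Translatability of derivable judgements -/

variable (S) in
/-- The translation is defined on the context and on the object that is typed. -/
def Jdg.Labelled : Jdg ar → Prop
  | .valid Γ => ∃ Γ', LabCtx S Γ Γ'
  | .typ Γ M _ => (∃ Γ', LabCtx S Γ Γ') ∧ ∃ M', LabObj S Γ M M'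
  | .eq _ _ _ _ => True

theorem LabCtx.of_append {G Δ : List Arity} {Γ : Ctx ar G} {Θ : Tel ar G Δ}
    {Γ' : KCtx ar (Δ ++ G)} (h : LabCtx S (Γ.append Θ) Γ') :
    (∃ Γ', LabCtx S Γ Γ') ∧ ∃ Θ', LabTel S Γ Θ Θ' := by
  induction Δ with
  | nil => cases Θ; exact ⟨⟨_, h⟩, _, .nil⟩
  | cons α Δ ih =>
    cases Θ with
    | snoc Θ K =>
      obtain ⟨Γ₁, K', hΓ, hK⟩ : ∃ Γ₁ K', LabCtx S (Γ.append Θ) Γ₁ ∧ LabKind S (Γ.append Θ) K K' := by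
        change LabCtx S ((Γ.append Θ).snoc K) Γ' at h
        generalize Γ.append Θ = Γ₂ at h K
        cases h with
        | snoc h hK => exact ⟨_, _, h, hK⟩
      obtain ⟨h1, Θ', h2⟩ := ih hΓ
      exact ⟨h1, _, .snoc h2 hK⟩

theorem Jdg.Labelled.baseKind {G : List Arity} {Γ : Ctx ar G} {T : Base ar G}
    (h : (Γ.baseKind T).Labelled S) : (∃ Γ', LabCtx S Γ Γ') ∧ ∃ T', LabBase S Γ T T' := by
  cases T with
  | type => exact ⟨h, _, .type⟩
  | el A =>
    obtain ⟨h, A', hA⟩ := h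
    exact ⟨h, _, .el hA⟩

theorem Jdg.Labelled.isKind {G : List Arity} {α : Arity} {Γ : Ctx ar G} {K : Kind ar G α}
    (h : (Γ.isKind K).Labelled S) : (∃ Γ', LabCtx S Γ Γ') ∧ ∃ K', LabKind S Γ K K' := by
  obtain ⟨⟨Γ', hΓ⟩, T', hT⟩ := h.baseKind
  obtain ⟨h1, Θ', h2⟩ := hΓ.of_append
  cases K
  exact ⟨h1, _, .mk h2 hT⟩

theorem Jdg.Labelled.absTyp {G : List Arity} {α : Arity} {Γ : Ctx ar G} {K : Kind ar G α}
    {F : Abs ar G α} (h : (Γ.absTyp F K).Labelled S) : ∃ F', LabAbs S Γ K F F' := by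
  obtain ⟨⟨Γ', hΓ⟩, M', hM⟩ := h
  obtain ⟨-, Θ', h2⟩ := hΓ.of_append
  cases K
  exact ⟨_, .mk h2 hM⟩

/-- The premises of the typing rules contain the kinds from which labels are made, so these are
translated along the derivation. Types are left out of `Jdg.Labelled`: in a conversion the new type
appears only in an equation, about which nothing is claimed. -/
theorem Der.labelled {J : Jdg ar} (h : Der S J) : J.Labelled S := by
  induction h with
  | emp => exact ⟨_, .nil⟩
  | ctxt Γ K _ ih =>
    obtain ⟨⟨Γ', hΓ⟩, K', hK⟩ := ih.isKind
    exact ⟨_, .snoc hΓ hK⟩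
  | var Γ x F _ _ ih ihF =>
    choose F' hF using fun β y => (ihF β y).absTyp
    exact ⟨ih, _, .var x F F' hF⟩
  | const Γ c K F hc _ _ ih ihF =>
    choose F' hF using fun β y => (ihF β y).absTyp
    exact ⟨ih, _, .const c K F F' hc hF⟩
  | conv _ _ ih _ => exact ih
  | var_eq | ref | sym | trans | conv_eq | const_eq | eqn => trivial

end Translation

/-! ## The translation is defined on instances -/

section Instances

variable {S : Set (Decl ar)}

theorem Kind.wk1_ren_lift1 {G G' : List Arity} {α β : Arity} (ρ : Ren G G') (K : Kind ar G α) :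
    (K.ren (Ren.wk1 β)).ren (ρ.lift1 β) = (K.ren ρ).ren (Ren.wk1 β) :=
  Kind.ext_ev fun κ e => by
    rw [Kind.ren_ev, Kind.ren_ev, Kind.ren_ev, Kind.ren_ev]; rfl

theorem Kind.ren_empty_ren {G G' : List Arity} {α : Arity} (ρ : Ren G G') (K : Kind ar [] α) :
    (K.ren (Ren.empty G)).ren ρ = K.ren (Ren.empty G') :=
  Kind.ext_ev fun κ e => by
    rw [Kind.ren_ev, Kind.ren_ev, Kind.ren_ev]
    congr 1; funext α x; cases x

theorem Kind.ren_empty_sub {b : ℕ} {G G' : List Arity} {α : Arity} (σ : Sub ar b G G')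
    (K : Kind ar [] α) : (K.ren (Ren.empty G)).sub σ = K.ren (Ren.empty G') :=
  Kind.ext_ev fun κ e => by
    rw [Kind.sub_ev _ (σ.env_compat e), Kind.ren_ev, Kind.ren_ev]
    congr 1; funext α x; cases x

/-- Renamings that preserve kinds. -/
def Ren.Respects {G G' : List Arity} (ρ : Ren G G') (Γ : Ctx ar G) (Γ' : Ctx ar G') : Prop :=
  ∀ α (x : Var G α), Γ'.lookup (ρ α x) = (Γ.lookup x).ren ρ

theorem Ren.Respects.lift {G G' Δ : List Arity} {ρ : Ren G G'} {Γ : Ctx ar G} {Γ' : Ctx ar G'}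
    (h : ρ.Respects Γ Γ') (Θ : Tel ar G Δ) :
    (ρ.lift Δ).Respects (Γ.append Θ) (Γ'.append (Θ.ren ρ)) := by
  induction Δ with
  | nil => cases Θ; exact h
  | cons β Δ ih =>
    cases Θ with
    | snoc Θ K =>
      intro α x
      cases x with
      | zero => exact (Kind.wk1_ren_lift1 _ _).symm
      | succ x => exact (congrArg _ (ih Θ α x)).trans (Kind.wk1_ren_lift1 _ _).symm

theorem Ren.wk1_respects {G : List Arity} {β : Arity} (Γ : Ctx ar G) (K : Kind ar G β) :
    (Ren.wk1 β).Respects Γ (Γ.snoc K) := fun _ _ => rfl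

theorem Kind.tel_sub {b : ℕ} {G G' : List Arity} {α : Arity} (σ : Sub ar b G G')
    (K : Kind ar G α) : (K.sub σ).tel = K.tel.sub σ := by
  cases K; simp only [Kind.sub, Kind.tel]

-- Only definedness is asserted; when the value of a translation matters, it is determined by
-- evaluation.
mutual
theorem LabObj.ren {G : List Arity} {Γ : Ctx ar G} {M : Obj ar G} {M' : KObj ar G} :
    LabObj S Γ M M' → ∀ {G' : List Arity} {Γ' : Ctx ar G'} {ρ : Ren G G'}, ρ.Respects Γ Γ' →
      ∃ M'', LabObj S Γ' (M.ren ρ) M''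
  | .var x F F' h, _, Γ', ρ, hρ => by
    choose F'' hF using fun β y => LabAbs.ren (h β y) hρ
    rw [Obj.ren]
    refine ⟨_, .var _ _ F'' fun β y => ?_⟩
    rw [hρ, Kind.tel_ren, Tel.argKind_ren]
    exact hF β y
  | .const c K F F' hc h, _, Γ', ρ, hρ => by
    choose F'' hF using fun β y => LabAbs.ren (h β y) hρ
    rw [Obj.ren]
    refine ⟨_, .const c K _ F'' hc fun β y => ?_⟩
    rw [← Kind.ren_empty_ren ρ, Kind.tel_ren, Tel.argKind_ren]
    exact hF β y
theorem LabAbs.ren {G : List Arity} {α : Arity} {Γ : Ctx ar G} {K : Kind ar G α} {M : Abs ar G α}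
    {M' : KAbs ar G α} : LabAbs S Γ K M M' → ∀ {G' : List Arity} {Γ' : Ctx ar G'} {ρ : Ren G G'},
      ρ.Respects Γ Γ' → ∃ M'', LabAbs S Γ' (K.ren ρ) (M.ren (ρ.lift α.args)) M''
  | .mk hΔ hM, _, _, _, hρ => by
    obtain ⟨_, h1⟩ := LabTel.ren hΔ hρ
    obtain ⟨_, h2⟩ := LabObj.ren hM (hρ.lift _)
    rw [Kind.ren]
    exact ⟨_, .mk h1 h2⟩
theorem LabBase.ren {G : List Arity} {Γ : Ctx ar G} {T : Base ar G} {T' : KBase ar G} :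
    LabBase S Γ T T' → ∀ {G' : List Arity} {Γ' : Ctx ar G'} {ρ : Ren G G'}, ρ.Respects Γ Γ' →
      ∃ T'', LabBase S Γ' (T.ren ρ) T''
  | .type, _, _, _, _ => ⟨_, .type⟩
  | .el hA, _, _, _, hρ => by
    obtain ⟨_, h⟩ := LabObj.ren hA hρ
    exact ⟨_, .el h⟩
theorem LabKind.ren {G : List Arity} {α : Arity} {Γ : Ctx ar G} {K : Kind ar G α}
    {K' : KKind ar G α} : LabKind S Γ K K' → ∀ {G' : List Arity} {Γ' : Ctx ar G'} {ρ : Ren G G'},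
      ρ.Respects Γ Γ' → ∃ K'', LabKind S Γ' (K.ren ρ) K''
  | .mk hΔ hT, _, _, _, hρ => by
    obtain ⟨_, h1⟩ := LabTel.ren hΔ hρ
    obtain ⟨_, h2⟩ := LabBase.ren hT (hρ.lift _)
    rw [Kind.ren]
    exact ⟨_, .mk h1 h2⟩
theorem LabTel.ren {G Δ : List Arity} {Γ : Ctx ar G} {Θ : Tel ar G Δ} {Θ' : KTel ar G Δ} :
    LabTel S Γ Θ Θ' → ∀ {G' : List Arity} {Γ' : Ctx ar G'} {ρ : Ren G G'}, ρ.Respects Γ Γ' →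
      ∃ Θ'', LabTel S Γ' (Θ.ren ρ) Θ''
  | .nil, _, _, _, _ => by rw [Tel.ren]; exact ⟨_, .nil⟩
  | .snoc hΘ hK, _, _, _, hρ => by
    obtain ⟨_, h1⟩ := LabTel.ren hΘ hρ
    obtain ⟨_, h2⟩ := LabKind.ren hK (hρ.lift _)
    rw [Tel.ren]
    exact ⟨_, .snoc h1 h2⟩
end

theorem LabCtx.lookup {G : List Arity} {Γ : Ctx ar G} {Γ' : KCtx ar G} (h : LabCtx S Γ Γ')
    {α : Arity} (x : Var G α) : ∃ K', LabKind S Γ (Γ.lookup x) K' := by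
  induction h with
  | nil => cases x
  | @snoc _ _ Γ K _ _ hΓ hK ih =>
    cases x with
    | zero => exact hK.ren (Ren.wk1_respects Γ K)
    | succ x =>
      obtain ⟨_, hx⟩ := ih x
      exact hx.ren (Ren.wk1_respects Γ K)

theorem LabKind.ren_empty {α : Arity} {K : Kind ar [] α} {K' : KKind ar [] α}
    (h : LabKind S .nil K K') {G : List Arity} (Γ : Ctx ar G) :
    ∃ K'', LabKind S Γ (K.ren (Ren.empty G)) K'' :=
  h.ren fun _ x => by cases x

variable (S) in
/-- Instantiations of translatable abstractions of the right kinds. -/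
def Sub.Respects {b : ℕ} {G G' : List Arity} (σ : Sub ar b G G') (Γ : Ctx ar G)
    (Γ' : Ctx ar G') : Prop :=
  ∀ α (x : Var G α), match σ α x with
    | .var x' => Γ'.lookup x' = (Γ.lookup x).sub σ
    | .abs _ P => ∃ P', LabAbs S Γ' ((Γ.lookup x).sub σ) P P'

theorem Sub.Respects.lift {b : ℕ} {G G' Δ : List Arity} {σ : Sub ar b G G'} {Γ : Ctx ar G}
    {Γ' : Ctx ar G'} (h : σ.Respects S Γ Γ') (Θ : Tel ar G Δ) :
    (σ.lift Δ).Respects S (Γ.append Θ) (Γ'.append (Θ.sub σ)) := by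
  induction Δ with
  | nil => cases Θ; exact h
  | cons β Δ ih =>
    cases Θ with
    | snoc Θ K =>
      intro α x
      cases x with
      | zero => exact (Kind.wk1_sub_lift1 _ _).symm
      | succ x =>
        have hx := ih Θ α x
        simp only [Sub.lift, Sub.lift1]
        have hK := Kind.wk1_sub_lift1 (β := β) (σ.lift Δ) ((Γ.append Θ).lookup x)
        cases hv : σ.lift Δ α x with
        | var x' =>
          rw [hv] at hx
          exact (congrArg _ hx).trans hK.symm
        | abs hb P =>
          rw [hv] at hx
          obtain ⟨P', hP⟩ := hx
          obtain ⟨P'', hP'⟩ := hP.ren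
            (Ren.wk1_respects (Γ'.append (Θ.sub σ)) (K.sub (σ.lift Δ)))
          rw [← hK] at hP'
          exact ⟨P'', hP'⟩

theorem Sub.block_respects {b : ℕ} {G Δ : List Arity} (hb : orderList Δ ≤ b) {Γ : Ctx ar G}
    {Θ : Tel ar G Δ} {F : Args ar G Δ}
    (hF : ∀ β y, ∃ P', LabAbs S Γ (Θ.argKind F β y) (F β y) P') :
    (Sub.block hb F).Respects S (Γ.append Θ) Γ := by
  induction Δ with
  | nil =>
    cases Θ
    exact fun α x => (Kind.sub_var _).symm
  | cons β Δ ih =>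
    cases Θ with
    | snoc Θ K =>
      have hb' : orderList Δ ≤ b := le_trans (by rw [orderList]; exact le_max_right _ _) hb
      have hK : ∀ α (K : Kind ar (Δ ++ G) α), (K.ren (Ren.wk1 β)).sub (Sub.block hb F) =
          K.sub (Sub.block hb' fun β y => F β (.succ y)) := fun α K => Kind.ren_sub _ _ _
      intro α x
      cases x with
      | zero =>
        obtain ⟨P', hP⟩ := hF β .zero
        refine ⟨P', ?_⟩
        change LabAbs S Γ ((K.ren (Ren.wk1 β)).sub (Sub.block hb F)) _ _
        rw [hK, Kind.inst_eq_sub]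
        exact hP
      | succ x =>
        have hx := ih hb' (Θ := Θ) (F := fun β y => F β (.succ y)) (fun β y => hF β (.succ y)) α x
        have hL : ((Γ.append (Θ.snoc K)).lookup (Var.succ x)).sub (Sub.block hb F) =
          ((Γ.append Θ).lookup x).sub (Sub.block hb' fun β y => F β (.succ y)) := hK _ _
        rw [hL]
        exact hx

/-- The employment of translatable abstractions gives translatable objects. -/
def EmployLab (S : Set (Decl ar)) (b : ℕ) : Prop :=
  ∀ (G : List Arity) (α : Arity) (h : α.order < b) (Γ : Ctx ar G) (K : Kind ar G α)
    (P : Abs ar G α) (F : Args ar G α.args), (∃ P', LabAbs S Γ K P P') →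
    (∀ β y, ∃ F', LabAbs S Γ (K.tel.argKind F β y) (F β y) F') →
    ∃ M', LabObj S Γ (employ b h P F) M'

-- Structural induction on the translation, relative to employment at orders below `b`. The labels
-- are covered because `LabAbs` contains a translation of the telescope from which each label is
-- made.
mutual
theorem LabObj.sub {b : ℕ} (he : EmployLab S b) {G : List Arity} {Γ : Ctx ar G} {M : Obj ar G}
    {M' : KObj ar G} : LabObj S Γ M M' → ∀ {G' : List Arity} {Γ' : Ctx ar G'} {σ : Sub ar b G G'},
      σ.Respects S Γ Γ' → ∃ M'', LabObj S Γ' (M.sub σ) M''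
  | .var (α := α) x F F' h, _, Γ', σ, hσ => by
    have hF := fun β y => LabAbs.sub he (h β y) hσ
    simp only [← Tel.argKind_sub, ← Kind.tel_sub] at hF
    have hx := hσ α x
    rw [Obj.sub, Obj.subWith]
    cases hv : σ α x with
    | var x' =>
      rw [hv] at hx
      choose F'' hF using hF
      refine ⟨_, .var _ _ F'' fun β y => ?_⟩
      rw [hx]
      exact hF β y
    | abs hb P =>
      rw [hv] at hx
      -- `P` and the instantiated arguments are translatable at matching kinds, so `EmployLab`
      -- applies.
      exact he _ _ hb Γ' _ P _ hx hF
  | .const c K F F' hc h, _, Γ', σ, hσ => by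
    choose F'' hF using fun β y => LabAbs.sub he (h β y) hσ
    rw [Obj.sub, Obj.subWith]
    refine ⟨_, .const c K _ F'' hc fun β y => ?_⟩
    have := hF β y
    rw [← Tel.argKind_sub, ← Kind.tel_sub, Kind.ren_empty_sub] at this
    exact this
theorem LabAbs.sub {b : ℕ} (he : EmployLab S b) {G : List Arity} {α : Arity} {Γ : Ctx ar G}
    {K : Kind ar G α} {M : Abs ar G α} {M' : KAbs ar G α} :
    LabAbs S Γ K M M' → ∀ {G' : List Arity} {Γ' : Ctx ar G'} {σ : Sub ar b G G'},
      σ.Respects S Γ Γ' → ∃ M'', LabAbs S Γ' (K.sub σ) (M.sub (σ.lift α.args)) M''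
  | .mk hΔ hM, _, _, _, hσ => by
    obtain ⟨_, h1⟩ := LabTel.sub he hΔ hσ
    obtain ⟨_, h2⟩ := LabObj.sub he hM (hσ.lift _)
    rw [Kind.sub]
    exact ⟨_, .mk h1 h2⟩
theorem LabBase.sub {b : ℕ} (he : EmployLab S b) {G : List Arity} {Γ : Ctx ar G} {T : Base ar G}
    {T' : KBase ar G} :
    LabBase S Γ T T' → ∀ {G' : List Arity} {Γ' : Ctx ar G'} {σ : Sub ar b G G'},
      σ.Respects S Γ Γ' → ∃ T'', LabBase S Γ' (T.sub σ) T''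
  | .type, _, _, _, _ => ⟨_, .type⟩
  | .el hA, _, _, _, hσ => by
    obtain ⟨_, h⟩ := LabObj.sub he hA hσ
    exact ⟨_, .el h⟩
theorem LabKind.sub {b : ℕ} (he : EmployLab S b) {G : List Arity} {α : Arity} {Γ : Ctx ar G}
    {K : Kind ar G α} {K' : KKind ar G α} :
    LabKind S Γ K K' → ∀ {G' : List Arity} {Γ' : Ctx ar G'} {σ : Sub ar b G G'},
      σ.Respects S Γ Γ' → ∃ K'', LabKind S Γ' (K.sub σ) K''
  | .mk hΔ hT, _, _, _, hσ => by
    obtain ⟨_, h1⟩ := LabTel.sub he hΔ hσ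
    obtain ⟨_, h2⟩ := LabBase.sub he hT (hσ.lift _)
    rw [Kind.sub]
    exact ⟨_, .mk h1 h2⟩
theorem LabTel.sub {b : ℕ} (he : EmployLab S b) {G Δ : List Arity} {Γ : Ctx ar G}
    {Θ : Tel ar G Δ} {Θ' : KTel ar G Δ} :
    LabTel S Γ Θ Θ' → ∀ {G' : List Arity} {Γ' : Ctx ar G'} {σ : Sub ar b G G'},
      σ.Respects S Γ Γ' → ∃ Θ'', LabTel S Γ' (Θ.sub σ) Θ''
  | .nil, _, _, _, _ => by rw [Tel.sub]; exact ⟨_, .nil⟩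
  | .snoc hΘ hK, _, _, _, hσ => by
    obtain ⟨_, h1⟩ := LabTel.sub he hΘ hσ
    obtain ⟨_, h2⟩ := LabKind.sub he hK (hσ.lift _)
    rw [Tel.sub]
    exact ⟨_, .snoc h1 h2⟩
end

/-- Employment at `b + 1` instantiates the body with employment at `b`, and the translation of an
abstraction includes one of its body in the extended context. -/
theorem employLab (b : ℕ) : EmployLab S b := by
  induction b with
  | zero => exact fun G α h => absurd h (Nat.not_lt_zero _)
  | succ b ih =>
    rintro G ⟨l⟩ h Γ K P F ⟨P', hP⟩ hF
    rw [employ]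
    cases hP with
    | mk hΔ hM => exact LabObj.sub ih hM (Sub.block_respects _ hF)

theorem LabBase.inst {G Δ : List Arity} {Γ : Ctx ar G} {Θ : Tel ar G Δ} {T : Base ar (Δ ++ G)}
    {T' : KBase ar (Δ ++ G)} (hT : LabBase S (Γ.append Θ) T T') {F : Args ar G Δ}
    (hF : ∀ β y, ∃ P', LabAbs S Γ (Θ.argKind F β y) (F β y) P') :
    ∃ T'', LabBase S Γ (T.inst F) T'' :=
  LabBase.sub (employLab _) hT (Sub.block_respects _ hF)

theorem LabKind.base {G : List Arity} {α : Arity} {Γ : Ctx ar G} {K : Kind ar G α}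
    {K' : KKind ar G α} (h : LabKind S Γ K K') : ∃ T', LabBase S (Γ.append K.tel) K.base T' := by
  cases h with
  | mk _ hT => exact ⟨_, hT⟩

/-- The types of objects are translatable in a good specification. -/
theorem Der.labelled_type {n : ℕ} (hgood : Good n S)
    (hconst : ∀ c K, Decl.const c K ∈ S → ∃ K', LabKind S .nil K K') {G : List Arity}
    {Γ : Ctx ar G} {M : Obj ar G} {T : Base ar G} (hΓ : Γ.order ≤ n) (h : Der S (.typ Γ M T)) :
    ∃ T', LabBase S Γ T T' := by
  cases h with
  | var _ x F hv hF =>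
    obtain ⟨Γ', hΓ'⟩ := hv.labelled
    obtain ⟨_, hK⟩ := hΓ'.lookup x
    obtain ⟨_, hT⟩ := hK.base
    exact hT.inst fun β y => (hF β y).labelled.absTyp
  | const _ c K F hc hv hF =>
    obtain ⟨_, hK⟩ := hconst c K hc
    obtain ⟨_, hK'⟩ := hK.ren_empty Γ
    obtain ⟨_, hT⟩ := hK'.base
    exact hT.inst fun β y => (hF β y).labelled.absTyp
  | conv _ hAB =>
    -- Goodness turns the equation `A = B` into a typing of `B`, which supplies its translation.
    obtain ⟨-, B', hB⟩ := (hgood _ _ _ _ _ hΓ hAB).2.labelled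
    exact ⟨_, .el hB⟩

theorem Der.labJdg {n : ℕ} (hgood : Good n S)
    (hconst : ∀ c K, Decl.const c K ∈ S → ∃ K', LabKind S .nil K K') {J : Jdg ar}
    (hJ : J.ctxOrder ≤ n) (h : Der S J) : ∃ J', LabJdg S J J' := by
  cases J with
  | valid Γ =>
    obtain ⟨_, hΓ⟩ := h.labelled
    exact ⟨_, .valid hΓ⟩
  | typ Γ M T =>
    obtain ⟨⟨_, hΓ⟩, _, hM⟩ := h.labelled
    obtain ⟨_, hT⟩ := h.labelled_type hgood hconst hJ
    exact ⟨_, .typ hΓ hM hT⟩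
  | eq Γ M N T =>
    obtain ⟨h1, h2⟩ := hgood _ _ _ _ _ hJ h
    obtain ⟨⟨_, hΓ⟩, _, hM⟩ := h1.labelled
    obtain ⟨-, _, hN⟩ := h2.labelled
    obtain ⟨_, hT⟩ := h1.labelled_type hgood hconst hJ
    exact ⟨_, .eq hΓ hM hN hT⟩

end Instances

/-! ## Specifications -/

section Specifications

variable {S : Set (Decl ar)}

theorem Decl.WellFormed.labDecl {δ : Decl ar} (h : δ.WellFormed S) : ∃ δ', LabDecl S δ δ' := by
  cases δ with
  | const c K =>
    obtain ⟨-, _, hK⟩ := (Der.labelled h).isKind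
    exact ⟨_, .const hK⟩
  | eqn Θ M N T =>
    obtain ⟨hM, hN, hT⟩ := h
    obtain ⟨⟨_, hΘ⟩, _, hM⟩ := hM.labelled
    obtain ⟨-, _, hΘ⟩ := hΘ.of_append
    obtain ⟨-, _, hN⟩ := hN.labelled
    obtain ⟨-, _, hT⟩ := hT.labelled.baseKind
    exact ⟨_, .eqn hΘ hM hN hT⟩

theorem LabDecl.exists_kind {c : C} {K : Kind ar [] (ar c)}
    (h : ∃ δ', LabDecl S (.const c K) δ') : ∃ K', LabKind S .nil K K' := by
  obtain ⟨_, h⟩ := h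
  cases h with
  | const hK => exact ⟨_, hK⟩

/-- `κ` has to be fixed before the induction over declarations, and so it is taken from the
translations under the predecessors; these exist by well-formedness alone. Unique declaration makes
the choice independent of `K`. -/
theorem exists_constKinds (hdecl : UniquelyDeclared S) {P : S → Set (Decl ar)}
    (hP : ∀ δ : S, (δ : Decl ar).WellFormed (P δ)) : ∃ κ : ∀ c, KKind ar [] (ar c),
      ∀ c K (h : Decl.const c K ∈ S), LabKind (P ⟨_, h⟩) .nil K (κ c) := by
  have h : ∀ c, ∃ k : KKind ar [] (ar c),
      ∀ K (h : Decl.const c K ∈ S), LabKind (P ⟨_, h⟩) .nil K k := fun c => by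
    by_cases hc : ∃ K, Decl.const c K ∈ S
    · obtain ⟨K, hK⟩ := hc
      obtain ⟨k, hk⟩ := LabDecl.exists_kind (hP ⟨_, hK⟩).labDecl
      refine ⟨k, fun K' hK' => ?_⟩
      cases hdecl c K K' hK hK'
      exact hk
    -- Constants that are not declared receive an arbitrary kind.
    · exact ⟨KKind.default ar [] (ar c), fun K hK => absurd ⟨K, hK⟩ hc⟩
  choose κ hκ using h
  exact ⟨κ, hκ⟩

variable {κ : ∀ c, KKind ar [] (ar c)}

theorem ConstEv.of_sem {S' : Set (KDecl ar)} (h : ∀ δ ∈ S, δ.Sem S' κ) : ConstEv S κ :=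
  fun _ _ hc => (h _ hc).2.1

/-- The induction step. Valid predecessors make `κ` correct for their constants, so the translation
of `δ` under `P` is its evaluation; this gives the equation for `κ c` and the membership in `labSpec
S`, while `Der.sem` gives validity. -/
theorem Decl.WellFormed.sem {P : Set (Decl ar)} {δ : Decl ar} (hδ : δ ∈ S) (hPS : P ⊆ S)
    (hw : δ.WellFormed P) (hP : ∀ ε ∈ P, ε.Sem (labSpec S) κ)
    (hκ : ∀ c K, δ = .const c K → LabKind P .nil K (κ c)) : δ.Sem (labSpec S) κ := by
  have hc : ConstEv P κ := .of_sem hP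
  obtain ⟨δ', hδ'⟩ := hw.labDecl
  have hmem : δ.ev κ ∈ labSpec S := ⟨δ, hδ, hδ'.eq_ev hc ▸ hδ'.mono hPS⟩
  cases δ with
  | const c K =>
    have h := (hκ c K rfl).eq_ev hc (Env.nil ar []) fun α x => by cases x
    refine ⟨(Der.sem hP hw).kindOk.2, h, ?_⟩
    rw [h]
    exact hmem
  | eqn Θ M N T =>
    have hM := Der.sem hP hw.1
    exact ⟨hM.1.of_append.2, hM.2, (Der.sem hP hw.2.1).2, hmem⟩

end Specifications

end TF

-- The main theorem

theorem mainTheorem8 {C : Type u} {ar : C → TF.Arity} (S : Set (TF.Decl ar)) (n : ℕ)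
    (hdecl : TF.UniquelyDeclared S) (hord : TF.Orderable S) (hgood : TF.Good n S)
    (hle : ∀ δ ∈ S, δ.order ≤ n) :
    (∀ δ ∈ S, ∃! δ' : TF.KDecl ar, TF.LabDecl S δ δ') ∧
    ∀ J : TF.Jdg ar, J.ctxOrder ≤ n → TF.Der S J →
      (∃! J' : TF.KJdg ar, TF.LabJdg S J J') ∧
      ∀ J' : TF.KJdg ar, TF.LabJdg S J J' → TF.KDer (TF.labSpec S) J' := by
  obtain ⟨r, hr, hwf⟩ := hord
  have hprior : ∀ δ : S, {ε | ∃ h : ε ∈ S, r ⟨ε, h⟩ δ} ⊆ S := fun δ ε h => h.1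
  obtain ⟨κ, hκ⟩ := TF.exists_constKinds hdecl hwf
  -- Well-founded induction along the given order, with `κ` and the target `labSpec S` fixed
  -- throughout.
  have hsem : ∀ δ : S, (δ : TF.Decl ar).Sem (TF.labSpec S) κ := fun δ =>
    hr.wf.induction (C := fun δ : S => (δ : TF.Decl ar).Sem (TF.labSpec S) κ) δ fun δ ih => by
      refine (hwf δ).sem δ.2 (hprior δ) (fun ε h => ih _ h.2) fun c K h => ?_
      obtain ⟨δ, hδ⟩ := δ
      cases h
      exact hκ c K hδ
  have hsem' : ∀ δ ∈ S, δ.Sem (TF.labSpec S) κ := fun δ hδ => hsem ⟨δ, hδ⟩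
  have hc : TF.ConstEv S κ := .of_sem hsem'
  have hlab : ∀ δ ∈ S, ∃ δ', TF.LabDecl S δ δ' := fun δ hδ => by
    obtain ⟨δ', h⟩ := (hwf ⟨δ, hδ⟩).labDecl
    exact ⟨δ', h.mono (hprior _)⟩
  refine ⟨fun δ hδ => ?_, fun J hJ h => ⟨?_, fun J' hJ' => ?_⟩⟩
  · obtain ⟨δ', h⟩ := hlab δ hδ
    exact ⟨δ', h, fun ε hε => (hε.eq_ev hc).trans (h.eq_ev hc).symm⟩
  · obtain ⟨J', h'⟩ := h.labJdg hgood
      (fun c K hK => TF.LabDecl.exists_kind (hlab _ hK)) hJ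
    exact ⟨J', h', fun J'' h'' => (h''.eq_ev hc).trans (h'.eq_ev hc).symm⟩
  -- A translation of `J` can only be its evaluation, and the fundamental lemma makes that
  -- derivable.
  · rw [hJ'.eq_ev hc]
    exact (h.sem hsem').der
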